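/- Let $\mathbb F$ be a field of characteristic $0$, and let $\mathcal W(-1)$ (the $\mathcal W(2,2)$ Lie conformal algebra) be the Lie conformal algebra that is free as an $\mathbb F[\partial]$-module with basis $L, H$ and has the $\lambda$-brackets $$[L_\lambda L]=(\partial+2\lambda)L,\quad [L_\lambda H]=(\partial+2\lambda)H,\quad [H_\lambda L]=(\partial+2\lambda)H,\quad [H_\lambda H]=0 .$$ For a Lie conformal algebra $\mathcal A$ and an $\mathcal A$-module $M$, a $q$-cochain is an $\mathbb F$-linear map $f:\mathcal A^{\otimes q}\to M[\lambda_1,\dots,\lambda_q]$ with $f_{\lambda_1,\dots,\lambda_q}(\dots,\partial a_i,\dots)=-\lambda_i f_{\lambda_1,\dots,\lambda_q}(\dots,a_i,\dots)$ that is skew-symmetric under simultaneous permutations of the $a_i$ and the $\lambda_i$ (so a $0$-cochain is an element of $M$). The basic complex $\widetilde C^\bullet(\mathcal A,M)$ consists of all cochains, with differential $$(\mathbf df)_{\lambda_1,\dots,\lambda_{q+1}}(a_1,\dots,a_{q+1})=\sum_{k}(-1)^{k+1}a_{k\,\lambda_k}f_{\dots,\hat\lambda_k,\dots}(\dots,\hat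 a_k,\dots)+\sum_{k<l}(-1)^{k+l}f_{\lambda_k+\lambda_l,\dots,\hat\lambda_k,\dots,\hat\lambda_l,\dots}([a_{k\,\lambda_k}a_l],\dots,\hat a_k,\dots,\hat a_l,\dots).$$ With $(\partial f)_{\lambda_1,\dots,\lambda_q}=(\partial^M+\lambda_1+\dots+\lambda_q)f_{\lambda_1,\dots,\lambda_q}$, the reduced complex is $C^\bullet(\mathcal A,M)=\widetilde C^\bullet(\mathcal A,M)/\partial\widetilde C^\bullet(\mathcal A,M)$. Let $\widetilde{\mathrm H}^q(\mathcal A,M)$ and $\mathrm H^q(\mathcal A,M)$ be the cohomologies of the basic and of the reduced complex. Then, with coefficients in the adjoint module, $$\dim\widetilde{\mathrm H}^q(\mathcal W(-1),\mathcal W(-1))=\begin{cases}1,& q=2,4,\\ 2,& q=3,\\ 0,&\text{otherwise},\end{cases}\qquad \dim\mathrm H^q(\mathcal W(-1),\mathcal W(-1))=\begin{cases}1,& q=1,4,\\ 3,& q=2,3,\\ 0,&\text{otherwise}.\end{cases}$$ Moreover, write $f:g_1\otimes\cdots\otimes g_q\mapsto v$, for $(g_1,\dots,g_q)$ of the form $(L,\dots,L,H,\dots,H)$,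 for the $q$-cochain with $f_{\lambda_1,\dots,\lambda_q}(g_1,\dots,g_q)=v$ that vanishes on all other tuples of this form. The following cochains exist (and are determined by these values): - $f_{11}:H\mapsto H$; - $f_{21}:L\otimes H\mapsto H$, $\quad f_{22}:H\otimes H\mapsto(\lambda_1-\lambda_2)L$, $\quad f_{23}:L\otimes H\mapsto(\partial+\lambda_2)H$; - $f_{31}:L\otimes H\otimes H\mapsto(\lambda_2-\lambda_3)L$, $\quad f_{32}:L\otimes L\otimes H\mapsto(\lambda_1-\lambda_2)H$, $\quad f_{33}:L\otimes H\otimes H\mapsto-\lambda_1(\lambda_2-\lambda_3)L$; - $f_{41}:L\otimes L\otimes H\otimes H\mapsto(\lambda_1-\lambda_2)(\lambda_3-\lambda_4)L$. Bases of $\widetilde{\mathrm H}^2,\widetilde{\mathrm H}^3,\widetilde{\mathrm H}^4$ are given by the classes of $\{f_{21}\}$, $\{f_{31},f_{32}\}$, $\{f_{41}\}$, and bases of $\mathrm H^1,\mathrm H^2,\mathrm H^3,\mathrm H^4$ by the classes of $\{f_{11}\}$, $\{f_{21},f_{22},f_{23}\}$, $\{f_{31},f_{32},f_{33}\}$, $\{f_{41}\}$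 modulo $\partial\widetilde C^\bullet$. -/

import Mathlib

open scoped TensorProduct

set_option maxSynthPendingDepth 3

noncomputable section

namespace LieConformal

/-! Throughout, the space `M[x₁, …, x_q]` of polynomials with coefficients in a vector space `M`
is `R ⊗[F] M`, where `R` is the polynomial ring in the variables `x₁, …, x_q`. -/

section Substitution

variable {F : Type*} [Field F] {R : Type*} [CommRing R] [Algebra F R]
  {A : Type*} [AddCommGroup A] [Module F A] {M : Type*} [AddCommGroup M] [Module F M]

/-- The substitution `λ = t` from `M[λ]` to `R ⊗ M`, where `t ∈ R`. -/
def evalAt (t : R) : Polynomial F ⊗[F] M →ₗ[F] R ⊗[F] M :=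
  (Polynomial.aeval t).toLinearMap.rTensor M

@[simp] theorem evalAt_tmul (t : R) (p : Polynomial F) (m : M) :
    evalAt t (p ⊗ₜ[F] m) = Polynomial.aeval t p ⊗ₜ[F] m := rfl

/-- The `R`-bilinear extension to `R ⊗ A` and `R ⊗ M` of a `λ`-action `a_λ m`, taken at
`λ = t ∈ R`. -/
def actAt (β : A →ₗ[F] M →ₗ[F] Polynomial F ⊗[F] M) (t : R) :
    R ⊗[F] A →ₗ[R] R ⊗[F] M →ₗ[R] R ⊗[F] M :=
  LinearMap.liftBaseChange R
    (((LinearMap.liftBaseChangeEquiv (R := F) (M := M) (N := R ⊗[F] M) R).toLinearMap.restrictScalars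
      F) ∘ₗ (β.compr₂ (evalAt t)))

@[simp] theorem actAt_tmul (β : A →ₗ[F] M →ₗ[F] Polynomial F ⊗[F] M) (t r s : R) (a : A) (m : M) :
    actAt β t (r ⊗ₜ[F] a) (s ⊗ₜ[F] m) = r • s • evalAt t (β a m) := rfl

/-- The operator `∂ + t` on `R ⊗ M`, where `∂` acts on the coefficients and `t ∈ R` acts by
multiplication. -/
def dAdd (D : M →ₗ[F] M) (t : R) : R ⊗[F] M →ₗ[F] R ⊗[F] M :=
  D.lTensor R + Algebra.lsmul F F (R ⊗[F] M) t

@[simp] theorem dAdd_tmul (D : M →ₗ[F] M) (t r : R) (m : M) :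
    dAdd D t (r ⊗ₜ[F] m) = r ⊗ₜ[F] D m + t • (r ⊗ₜ[F] m) := rfl

/-- The substitution `λ ↦ -λ - ∂` on `M[λ]`, that is `∑ λʲ mⱼ ↦ ∑ (-λ - ∂)ʲ mⱼ`. -/
def skewSubst (D : M →ₗ[F] M) : Polynomial F ⊗[F] M →ₗ[F] Polynomial F ⊗[F] M :=
  TensorProduct.lift
    ((Polynomial.aeval (R := F) (A := Module.End F (Polynomial F ⊗[F] M))
        (-dAdd D (Polynomial.X : Polynomial F))).toLinearMap.compl₂ (TensorProduct.mk F (Polynomial F) M 1))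

@[simp] theorem skewSubst_tmul (D : M →ₗ[F] M) (p : Polynomial F) (m : M) :
    skewSubst D (p ⊗ₜ[F] m) =
      Polynomial.aeval (R := F) (A := Module.End F (Polynomial F ⊗[F] M))
        (-dAdd D (Polynomial.X : Polynomial F)) p (1 ⊗ₜ[F] m) := rfl

theorem dAdd_smul (D : M →ₗ[F] M) (t s : R) (x : R ⊗[F] M) :
    dAdd D t (s • x) = s • dAdd D t x := by
  induction x with
  | zero => simp
  | tmul r m => simp [TensorProduct.smul_tmul', mul_left_comm]
  | add x y hx hy => simp [smul_add, hx, hy]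

theorem dAdd_eq (D : M →ₗ[F] M) (t : R) (x : R ⊗[F] M) :
    dAdd D t x = dAdd D 0 x + t • x := by
  simp [dAdd]

theorem commute_aeval {E : Type*} [Ring E] [Algebra F E] {S T : E} (h : Commute S T)
    (p : Polynomial F) : Commute (Polynomial.aeval S p) T := by
  induction p using Polynomial.induction_on' with
  | add p q hp hq => rw [map_add]; exact hp.add_left hq
  | monomial n a =>
    rw [Polynomial.aeval_monomial]
    exact Commute.mul_left (Algebra.commutes a T) (h.pow_left n)

theorem evalAt_smul (t : R) (p : Polynomial F) (x : Polynomial F ⊗[F] M) :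
    evalAt t (p • x) = Polynomial.aeval t p • evalAt t x := by
  induction x with
  | zero => simp
  | tmul r m => simp [TensorProduct.smul_tmul']
  | add x y hx hy => simp [smul_add, hx, hy]

theorem evalAt_dAdd (D : M →ₗ[F] M) (t : R) (p : Polynomial F) (x : Polynomial F ⊗[F] M) :
    evalAt t (dAdd D p x) = dAdd D (Polynomial.aeval t p) (evalAt t x) := by
  induction x with
  | zero => simp
  | tmul r m => simp [evalAt_smul]
  | add x y hx hy => simp [hx, hy]

theorem actAt_D_left {β : A →ₗ[F] M →ₗ[F] Polynomial F ⊗[F] M} {D : A →ₗ[F] A}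
    (h : ∀ a m, β (D a) m = -((Polynomial.X : Polynomial F) • β a m)) (t : R) (x : R ⊗[F] A)
    (y : R ⊗[F] M) : actAt β t (dAdd D 0 x) y = -(t • actAt β t x y) := by
  induction x with
  | zero => simp
  | add x x' hx hx' => simp [hx, hx', add_comm]
  | tmul r a =>
    induction y with
    | zero => simp
    | add y y' hy hy' => simp only [map_add, hy, hy', smul_add, neg_add]
    | tmul s m => simp [h, evalAt_smul, smul_comm t]

theorem actAt_D_right {β : A →ₗ[F] M →ₗ[F] Polynomial F ⊗[F] M} {D : M →ₗ[F] M}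
    (h : ∀ a m, β a (D m) = dAdd D (Polynomial.X : Polynomial F) (β a m)) (t : R) (x : R ⊗[F] A)
    (y : R ⊗[F] M) : actAt β t x (dAdd D 0 y) = dAdd D t (actAt β t x y) := by
  induction x with
  | zero => simp
  | add x x' hx hx' => simp [hx, hx']
  | tmul r a =>
    induction y with
    | zero => simp
    | add y y' hy hy' => simp only [map_add, hy, hy']
    | tmul s m => simp [h, evalAt_dAdd, dAdd_smul]

theorem skewSubst_smul (D : M →ₗ[F] M) (x : Polynomial F ⊗[F] M) :
    skewSubst D ((Polynomial.X : Polynomial F) • x) =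
      -dAdd D (Polynomial.X : Polynomial F) (skewSubst D x) := by
  induction x with
  | zero => simp
  | tmul r m => simp [TensorProduct.smul_tmul']
  | add x y hx hy => simp [smul_add, hx, hy, add_comm]

theorem skewSubst_dAdd (D : M →ₗ[F] M) (x : Polynomial F ⊗[F] M) :
    skewSubst D (dAdd D (Polynomial.X : Polynomial F) x) =
      -((Polynomial.X : Polynomial F) • skewSubst D x) := by
  have key : skewSubst D (dAdd D 0 x) = dAdd D 0 (skewSubst D x) := by
    induction x with
    | zero => simp
    | add x y hx hy => simp only [map_add, hx, hy]
    | tmul p m =>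
      have h : Commute (Polynomial.aeval (R := F) (A := Module.End F (Polynomial F ⊗[F] M))
          (-dAdd D (Polynomial.X : Polynomial F)) p)
          (dAdd D (0 : Polynomial F) : Module.End F (Polynomial F ⊗[F] M)) := by
        apply commute_aeval
        apply Commute.neg_left
        refine LinearMap.ext fun y => ?_
        change dAdd D (Polynomial.X : Polynomial F) (dAdd D 0 y) =
          dAdd D 0 (dAdd D (Polynomial.X : Polynomial F) y)
        rw [dAdd_eq D Polynomial.X y, dAdd_eq D Polynomial.X, map_add, dAdd_smul]
      have h' := congrArg (fun φ : Module.End F (Polynomial F ⊗[F] M) => φ (1 ⊗ₜ m)) h.eq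
      simpa using h'
  rw [dAdd_eq, map_add, key, skewSubst_smul, dAdd_eq D Polynomial.X]
  abel

end Substitution

/-- A Lie conformal algebra over the field `F`: the `F[∂]`-module structure of the vector space `A`
is given by the operator `D = ∂`, and `bracket a b = [a_λ b] ∈ A[λ]`. In the Jacobi identity the
two variables `λ, μ` are the variables `X 0, X 1` of `MvPolynomial (Fin 2) F`. -/
structure LieConformalAlgebra (F : Type*) [Field F] (A : Type*) [AddCommGroup A] [Module F A] where
  /-- the action of `∂` -/
  D : A →ₗ[F] A
  /-- the `λ`-bracket -/
  bracket : A →ₗ[F] A →ₗ[F] Polynomial F ⊗[F] A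
  bracket_D_left : ∀ a b, bracket (D a) b = -((Polynomial.X : Polynomial F) • bracket a b)
  bracket_D_right : ∀ a b, bracket a (D b) = dAdd D (Polynomial.X : Polynomial F) (bracket a b)
  skew : ∀ a b, bracket a b = -skewSubst D (bracket b a)
  jacobi : ∀ a b c,
    actAt bracket (MvPolynomial.X 0 : MvPolynomial (Fin 2) F) (1 ⊗ₜ a)
        (evalAt (MvPolynomial.X 1) (bracket b c)) =
      actAt bracket (MvPolynomial.X 0 + MvPolynomial.X 1)
        (evalAt (MvPolynomial.X 0 : MvPolynomial (Fin 2) F) (bracket a b)) (1 ⊗ₜ c) +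
      actAt bracket (MvPolynomial.X 1 : MvPolynomial (Fin 2) F) (1 ⊗ₜ b)
        (evalAt (MvPolynomial.X 0) (bracket a c))

/-- A module `M` over a Lie conformal algebra `𝓐`, with `act a m = a_λ m ∈ M[λ]`. -/
structure LieConformalModule {F : Type*} [Field F] {A : Type*} [AddCommGroup A] [Module F A]
    (𝓐 : LieConformalAlgebra F A) (M : Type*) [AddCommGroup M] [Module F M] where
  /-- the action of `∂` on `M` -/
  D : M →ₗ[F] M
  /-- the `λ`-action -/
  act : A →ₗ[F] M →ₗ[F] Polynomial F ⊗[F] M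
  act_D_left : ∀ a m, act (𝓐.D a) m = -((Polynomial.X : Polynomial F) • act a m)
  act_D_right : ∀ a m, act a (D m) = dAdd D (Polynomial.X : Polynomial F) (act a m)
  act_act : ∀ a b m,
    actAt act (MvPolynomial.X 0 : MvPolynomial (Fin 2) F) (1 ⊗ₜ a)
        (evalAt (MvPolynomial.X 1) (act b m)) -
      actAt act (MvPolynomial.X 1 : MvPolynomial (Fin 2) F) (1 ⊗ₜ b)
        (evalAt (MvPolynomial.X 0) (act a m)) =
      actAt act (MvPolynomial.X 0 + MvPolynomial.X 1)
        (evalAt (MvPolynomial.X 0 : MvPolynomial (Fin 2) F) (𝓐.bracket a b)) (1 ⊗ₜ m)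

/-- The adjoint module of a Lie conformal algebra. -/
def LieConformalAlgebra.adjoint {F : Type*} [Field F] {A : Type*} [AddCommGroup A] [Module F A]
    (𝓐 : LieConformalAlgebra F A) : LieConformalModule 𝓐 A where
  D := 𝓐.D
  act := 𝓐.bracket
  act_D_left := 𝓐.bracket_D_left
  act_D_right := 𝓐.bracket_D_right
  act_act a b m := by rw [𝓐.jacobi a b m, add_sub_cancel_right]

section Cohomology

variable {F : Type*} [Field F] {A : Type*} [AddCommGroup A] [Module F A]
  {M : Type*} [AddCommGroup M] [Module F M]

/-- The `F`-multilinear maps `(a₁, …, a_q) ↦ f_{λ₁, …, λ_q}(a₁, …, a_q)` from `A × ⋯ × A` to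
`M[λ₁, …, λ_q]`, that is the linear maps from `A ⊗ ⋯ ⊗ A` to `M[λ₁, …, λ_q]`. The variables
`λ₁, …, λ_q` are `X 0, …, X (q - 1)`. -/
abbrev PolyMap (F : Type*) [Field F] (A : Type*) [AddCommGroup A] [Module F A]
    (M : Type*) [AddCommGroup M] [Module F M] (q : ℕ) :=
  MultilinearMap F (fun _ : Fin q => A) (MvPolynomial (Fin q) F ⊗[F] M)

/-- The space of `q`-cochains of the basic complex: the conformally antilinear and
skew-symmetric `f`. For `q = 0` this is `M`. -/
def basicCochains (𝓐 : LieConformalAlgebra F A) (M : Type*) [AddCommGroup M] [Module F M] (q : ℕ) :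
    Submodule F (PolyMap F A M q) where
  carrier := {f |
    (∀ (a : Fin q → A) (i : Fin q),
      f (Function.update a i (𝓐.D (a i))) = -((MvPolynomial.X i : MvPolynomial (Fin q) F) • f a)) ∧
    (∀ (σ : Equiv.Perm (Fin q)) (a : Fin q → A),
      (MvPolynomial.rename σ).toLinearMap.rTensor M (f (a ∘ σ)) =
        (Equiv.Perm.sign σ : ℤ) • f a)}
  zero_mem' := by constructor <;> intros <;> simp
  add_mem' := by
    rintro f g ⟨hf, hf'⟩ ⟨hg, hg'⟩
    refine ⟨fun a i => ?_, fun σ a => ?_⟩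
    · simp only [add_apply, hf, hg, smul_add, neg_add]
    · simp only [add_apply, map_add, hf', hg', smul_add]
  smul_mem' := by
    rintro c f ⟨hf, hf'⟩
    refine ⟨fun a i => ?_, fun σ a => ?_⟩
    · simp only [smul_apply, hf, smul_neg, smul_comm c]
    · simp only [smul_apply, map_smul, hf']
      exact smul_comm _ _ _

variable {𝓐 : LieConformalAlgebra F A} (𝓜 : LieConformalModule 𝓐 M)

/-- The term `a_{k λ_k} f_{λ₁, …, λ̂_k, …, λ_{q+1}}(a₁, …, â_k, …, a_{q+1})` of the differential. -/
def actTerm (q : ℕ) (k : Fin (q + 1)) : PolyMap F A M q →ₗ[F] PolyMap F A M (q + 1) where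
  toFun f := LinearMap.uncurryMid k
    { toFun := fun a =>
        (((actAt 𝓜.act (MvPolynomial.X k) (1 ⊗ₜ a)).restrictScalars F).comp
          ((MvPolynomial.rename k.succAbove).toLinearMap.rTensor M)).compMultilinearMap f
      map_add' := fun a b => by ext v; simp [TensorProduct.tmul_add]
      map_smul' := fun c a => by ext v; simp }
  map_add' f g := by ext v; simp
  map_smul' c f := by ext v; simp

theorem actTerm_apply (q : ℕ) (k : Fin (q + 1)) (f : PolyMap F A M q) (a : Fin (q + 1) → A) :
    actTerm 𝓜 q k f a =
      actAt 𝓜.act (MvPolynomial.X k) (1 ⊗ₜ a k)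
        ((MvPolynomial.rename k.succAbove).toLinearMap.rTensor M
          (f fun i => a (k.succAbove i))) := rfl

instance {R : Type*} [CommRing R] [Algebra F R] (q : ℕ) :
    IsScalarTower F R (MultilinearMap F (fun _ : Fin q => A) (R ⊗[F] M)) :=
  ⟨fun x y f => by ext v; exact smul_assoc x y (f v)⟩

/-- Extension of a `PolyMap` in its first argument: after the substitution `φ` of the variables, the
first argument may be taken in `R ⊗ A`, by `r ⊗ a ↦ r • φ (f (a, …))`. -/
def extendFirst {R : Type*} [CommRing R] [Algebra F R] {n : ℕ}
    (φ : MvPolynomial (Fin (n + 1)) F →ₐ[F] R) : PolyMap F A M (n + 1) →ₗ[F]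
      R ⊗[F] A →ₗ[R] MultilinearMap F (fun _ : Fin n => A) (R ⊗[F] M) where
  toFun f := LinearMap.liftBaseChange R
    ((LinearMap.compMultilinearMapₗ F (φ.toLinearMap.rTensor M)) ∘ₗ f.curryLeft)
  map_add' f g := by ext a v; simp
  map_smul' c f := by ext a v; simp

theorem extendFirst_tmul_apply {R : Type*} [CommRing R] [Algebra F R] {n : ℕ}
    (φ : MvPolynomial (Fin (n + 1)) F →ₐ[F] R) (f : PolyMap F A M (n + 1)) (r : R) (a : A)
    (v : Fin n → A) :
    extendFirst φ f (r ⊗ₜ[F] a) v = r • φ.toLinearMap.rTensor M (f (Fin.cons a v)) := rfl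

/-- The substitution `λ₁, λ₂, … ↦ λ_k + λ_l, λ₁, …, λ̂_k, …, λ̂_l, …`, where the first removed
index `k` is written as `l.succAbove k`. -/
def mergeVars (F : Type*) [Field F] (n : ℕ) (k : Fin (n + 1)) (l : Fin (n + 2)) :
    MvPolynomial (Fin (n + 1)) F →ₐ[F] MvPolynomial (Fin (n + 2)) F :=
  MvPolynomial.aeval (Fin.cons (MvPolynomial.X (l.succAbove k) + MvPolynomial.X l)
    (fun i => MvPolynomial.X (l.succAbove (k.succAbove i))))

/-- The term `f_{λ_k + λ_l, λ₁, …, λ̂_k, …, λ̂_l, …}([a_{k λ_k} a_l], a₁, …, â_k, …, â_l, …)` of the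
differential, where the first removed index `k` is written as `l.succAbove k`. -/
def bracketTerm (𝓐 : LieConformalAlgebra F A) (M : Type*) [AddCommGroup M] [Module F M] (n : ℕ)
    (k : Fin (n + 1)) (l : Fin (n + 2)) : PolyMap F A M (n + 1) →ₗ[F] PolyMap F A M (n + 2) where
  toFun f := LinearMap.uncurryMid l
    { toFun := fun b => LinearMap.uncurryMid k
        (((extendFirst (mergeVars F n k l) f).restrictScalars F) ∘ₗ
          (evalAt (MvPolynomial.X (l.succAbove k))) ∘ₗ (𝓐.bracket.flip b))
      map_add' := fun b c => by ext v; simp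
      map_smul' := fun r b => by ext v; simp }
  map_add' f g := by ext v; simp
  map_smul' c f := by ext v; simp

theorem bracketTerm_apply (𝓐 : LieConformalAlgebra F A) (n : ℕ)
    (k : Fin (n + 1)) (l : Fin (n + 2)) (f : PolyMap F A M (n + 1)) (a : Fin (n + 2) → A) :
    bracketTerm 𝓐 M n k l f a =
      extendFirst (mergeVars F n k l) f
        (evalAt (MvPolynomial.X (l.succAbove k)) (𝓐.bracket (a (l.succAbove k)) (a l)))
        (fun i => a (l.succAbove (k.succAbove i))) := rfl

/-- The differential of the basic complex. With indices starting at `0`, the signs are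
`(-1) ^ k` and `(-1) ^ (k + l)`; the second sum runs over the pairs `k < l`. -/
def d : (q : ℕ) → PolyMap F A M q →ₗ[F] PolyMap F A M (q + 1)
  | 0 => actTerm 𝓜 0 0
  | n + 1 =>
      ∑ k : Fin (n + 2), (-1 : F) ^ (k : ℕ) • actTerm 𝓜 (n + 1) k +
      ∑ l : Fin (n + 2), ∑ k : Fin (n + 1), if k.castSucc < l then
        (-1 : F) ^ (k + l : ℕ) • bracketTerm 𝓐 M n k l else 0

/-- The operator `∂` on the basic complex, `(∂ f)(a) = (∂ + λ₁ + ⋯ + λ_q) f(a)`. -/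
def partialOp (q : ℕ) : PolyMap F A M q →ₗ[F] PolyMap F A M q :=
  LinearMap.compMultilinearMapₗ F
    (dAdd 𝓜.D (∑ k : Fin q, MvPolynomial.X k : MvPolynomial (Fin q) F))

/-- The `q`-cocycles of the basic complex. -/
def basicCocycles (q : ℕ) : Submodule F (PolyMap F A M q) :=
  basicCochains 𝓐 M q ⊓ LinearMap.ker (d 𝓜 q)

/-- The `q`-coboundaries of the basic complex. -/
def basicCoboundaries : (q : ℕ) → Submodule F (PolyMap F A M q)
  | 0 => ⊥
  | q + 1 => (basicCochains 𝓐 M q).map (d 𝓜 q)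

/-- The `q`-cochains whose class in the reduced complex, the quotient of the basic complex `C` by
its subcomplex `∂ C`, is a cocycle. -/
def reducedCocycles (q : ℕ) : Submodule F (PolyMap F A M q) :=
  basicCochains 𝓐 M q ⊓
    ((basicCochains 𝓐 M (q + 1)).map (partialOp 𝓜 (q + 1))).comap (d 𝓜 q)

/-- The `q`-cochains whose class in the reduced complex is a coboundary. -/
def reducedCoboundaries (q : ℕ) : Submodule F (PolyMap F A M q) :=
  basicCoboundaries 𝓜 q ⊔ (basicCochains 𝓐 M q).map (partialOp 𝓜 q)

/-- The basic cohomology, cocycles modulo coboundaries. -/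
abbrev BasicCohomology (q : ℕ) :=
  basicCocycles 𝓜 q ⧸ (basicCoboundaries 𝓜 q).submoduleOf (basicCocycles 𝓜 q)

/-- The (reduced) cohomology, the cohomology of the quotient complex `C / ∂ C`. The cocycles and
the coboundaries of the quotient complex are replaced by their preimages in `C`. -/
abbrev ReducedCohomology (q : ℕ) :=
  reducedCocycles 𝓜 q ⧸ (reducedCoboundaries 𝓜 q).submoduleOf (reducedCocycles 𝓜 q)

/-- The cochains `f₁, …, f_n` are cocycles of the basic complex whose classes form a basis of the
basic cohomology. -/
def IsBasicBasis {q n : ℕ} (f : Fin n → PolyMap F A M q) : Prop :=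
  ∃ h : ∀ i, f i ∈ basicCocycles 𝓜 q, ∃ e : Module.Basis (Fin n) F (BasicCohomology 𝓜 q),
    ∀ i, e i = Submodule.Quotient.mk ⟨f i, h i⟩

/-- The cochains `f₁, …, f_n` represent cocycles of the reduced complex whose classes form a basis
of the (reduced) cohomology. -/
def IsReducedBasis {q n : ℕ} (f : Fin n → PolyMap F A M q) : Prop :=
  ∃ h : ∀ i, f i ∈ reducedCocycles 𝓜 q, ∃ e : Module.Basis (Fin n) F (ReducedCohomology 𝓜 q),
    ∀ i, e i = Submodule.Quotient.mk ⟨f i, h i⟩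

end Cohomology

section W

variable (F : Type*) [Field F]

/-- The free `F[∂]`-module with basis `L, H`; here `∂` is the variable of `Polynomial F`. -/
abbrev WSpace := Polynomial F × Polynomial F

namespace W

/-- The generator `L`. -/
def L : WSpace F := (1, 0)

/-- The generator `H`. -/
def H : WSpace F := (0, 1)

/-- The multiplication by `∂`. -/
def D : WSpace F →ₗ[F] WSpace F := Algebra.lsmul F F (WSpace F) (Polynomial.X : Polynomial F)

variable {F}

/-- `sesqui x p q` is `p(-λ) q(∂ + λ) x`. -/
def sesqui (x : Polynomial F ⊗[F] WSpace F) :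
    Polynomial F →ₗ[F] Polynomial F →ₗ[F] Polynomial F ⊗[F] WSpace F :=
  ((LinearMap.mul F (Module.End F (Polynomial F ⊗[F] WSpace F))).compl₁₂
    (Polynomial.aeval
      (-Algebra.lsmul F F (Polynomial F ⊗[F] WSpace F) (Polynomial.X : Polynomial F))).toLinearMap
    (Polynomial.aeval (R := F) (A := Module.End F (Polynomial F ⊗[F] WSpace F))
      (dAdd (D F) (Polynomial.X : Polynomial F))).toLinearMap).compr₂ (LinearMap.applyₗ x)

/-- The sesquilinear map determined by `[L_λ L] = (∂ + 2λ) L`, `[L_λ H] = (∂ + (1 - b)λ) H`,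
`[H_λ L] = (-b∂ + (1 - b)λ) H` and `[H_λ H] = 0`. -/
def bracket (b : F) : WSpace F →ₗ[F] WSpace F →ₗ[F] Polynomial F ⊗[F] WSpace F :=
  (sesqui (1 ⊗ₜ D F (L F) + (2 : F) • Polynomial.X ⊗ₜ L F)).compl₁₂
      (LinearMap.fst F _ _) (LinearMap.fst F _ _) +
    (sesqui (1 ⊗ₜ D F (H F) + (1 - b) • Polynomial.X ⊗ₜ H F)).compl₁₂
      (LinearMap.fst F _ _) (LinearMap.snd F _ _) +
    (sesqui (-b • 1 ⊗ₜ D F (H F) + (1 - b) • Polynomial.X ⊗ₜ H F)).compl₁₂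
      (LinearMap.snd F _ _) (LinearMap.fst F _ _)

theorem bracket_LL (b : F) :
    bracket b (L F) (L F) = 1 ⊗ₜ D F (L F) + (2 : F) • Polynomial.X ⊗ₜ L F := by
  simp [bracket, L, sesqui]

theorem bracket_LH (b : F) :
    bracket b (L F) (H F) = 1 ⊗ₜ D F (H F) + (1 - b) • Polynomial.X ⊗ₜ H F := by
  simp [bracket, L, H, sesqui]

theorem bracket_HL (b : F) :
    bracket b (H F) (L F) = -b • 1 ⊗ₜ D F (H F) + (1 - b) • Polynomial.X ⊗ₜ H F := by
  simp [bracket, L, H, sesqui]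

theorem bracket_HH (b : F) : bracket b (H F) (H F) = 0 := by
  simp [bracket, H, sesqui]

theorem sesqui_X_left (x : Polynomial F ⊗[F] WSpace F) (p q : Polynomial F) :
    sesqui x (Polynomial.X * p) q = -((Polynomial.X : Polynomial F) • sesqui x p q) := by
  simp [sesqui]

theorem sesqui_X_right (x : Polynomial F ⊗[F] WSpace F) (p q : Polynomial F) :
    sesqui x p (Polynomial.X * q) =
      dAdd (D F) (Polynomial.X : Polynomial F) (sesqui x p q) := by
  have h : Commute (Polynomial.aeval
      (-Algebra.lsmul F F (Polynomial F ⊗[F] WSpace F) (Polynomial.X : Polynomial F)) p)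
      (dAdd (D F) (Polynomial.X : Polynomial F) : Module.End F (Polynomial F ⊗[F] WSpace F)) := by
    apply commute_aeval
    apply Commute.neg_left
    refine LinearMap.ext fun y => ?_
    exact (dAdd_smul (D F) _ (Polynomial.X : Polynomial F) y).symm
  have h' := congrArg (fun φ : Module.End F (Polynomial F ⊗[F] WSpace F) =>
    φ (Polynomial.aeval (R := F) (A := Module.End F (Polynomial F ⊗[F] WSpace F))
      (dAdd (D F) (Polynomial.X : Polynomial F)) q x)) h.eq
  simpa [sesqui] using h'

theorem bracket_D_left (b : F) (x y : WSpace F) :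
    bracket b (D F x) y = -((Polynomial.X : Polynomial F) • bracket b x y) := by
  simp [bracket, D, sesqui_X_left]
  abel

theorem bracket_D_right (b : F) (x y : WSpace F) :
    bracket b x (D F y) = dAdd (D F) (Polynomial.X : Polynomial F) (bracket b x y) := by
  simp [bracket, D, sesqui_X_right]

theorem induction {P : WSpace F → Prop} (add : ∀ x y, P x → P y → P (x + y))
    (smul : ∀ (c : F) x, P x → P (c • x)) (hD : ∀ x, P x → P (D F x)) (hL : P (L F))
    (hH : P (H F)) (x : WSpace F) : P x := by
  have h1 : ∀ (g : WSpace F), P g → ∀ p : Polynomial F, P (p • g) := by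
    intro g hg p
    induction p using Polynomial.induction_on' with
    | add p q hp hq => rw [add_smul]; exact add _ _ hp hq
    | monomial n a =>
      induction n generalizing a with
      | zero =>
        have := smul a _ hg
        convert this using 1
        ext <;> simp
      | succ n ih =>
        have := hD _ (ih a)
        convert this using 1
        change _ = (Polynomial.X : Polynomial F) • (Polynomial.monomial n a • g)
        rw [smul_smul, Polynomial.X_mul_monomial]
  have h2 : x = x.1 • L F + x.2 • H F := by ext <;> simp [L, H]
  rw [h2]
  exact add _ _ (h1 _ hL _) (h1 _ hH _)

theorem bracket_skew (b : F) (x y : WSpace F) :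
    bracket b x y = -skewSubst (D F) (bracket b y x) := by
  revert y
  induction x using induction with
  | add x x' hx hx' => intro y; simp [hx y, hx' y, add_comm]
  | smul c x hx => intro y; simp [hx y]
  | hD x hx =>
    intro y
    rw [bracket_D_left, hx, bracket_D_right, skewSubst_dAdd, smul_neg]
  | hL =>
    intro y
    induction y using induction with
    | add x x' hx hx' => simp [hx, hx', add_comm]
    | smul c x hx => simp [hx]
    | hD x hx => rw [bracket_D_right, hx, bracket_D_left, map_neg, map_neg, skewSubst_smul, neg_neg]
    | hL => 
      simp only [bracket_LL, map_add, map_smul, skewSubst_tmul, map_one, Polynomial.aeval_X,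
        LinearMap.neg_apply, dAdd_tmul, Module.End.one_apply]
      simp only [TensorProduct.smul_tmul', smul_eq_mul, mul_one]
      simp only [← TensorProduct.smul_tmul']
      module
    | hH =>
      simp only [bracket_LH, bracket_HL, map_add, map_smul, skewSubst_tmul, map_one,
        Polynomial.aeval_X, LinearMap.neg_apply, dAdd_tmul, Module.End.one_apply]
      simp only [TensorProduct.smul_tmul', smul_eq_mul, mul_one]
      simp only [← TensorProduct.smul_tmul']
      module
  | hH =>
    intro y
    induction y using induction with
    | add x x' hx hx' => simp [hx, hx', add_comm]
    | smul c x hx => simp [hx]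
    | hD x hx => rw [bracket_D_right, hx, bracket_D_left, map_neg, map_neg, skewSubst_smul, neg_neg]
    | hL => 
      simp only [bracket_LH, bracket_HL, map_add, map_smul, skewSubst_tmul, map_one,
        Polynomial.aeval_X, LinearMap.neg_apply, dAdd_tmul, Module.End.one_apply]
      simp only [TensorProduct.smul_tmul', smul_eq_mul, mul_one]
      simp only [← TensorProduct.smul_tmul']
      module
    | hH => simp [bracket_HH]

theorem bracket_jacobi (b : F) {R : Type*} [CommRing R] [Algebra F R] (s t : R)
    (x y z : WSpace F) :
    actAt (bracket b) s (1 ⊗ₜ x) (evalAt t (bracket b y z)) =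
      actAt (bracket b) (s + t) (evalAt s (bracket b x y)) (1 ⊗ₜ z) +
      actAt (bracket b) t (1 ⊗ₜ y) (evalAt s (bracket b x z)) := by
  let P (x y z : WSpace F) : Prop :=
    actAt (bracket b) s (1 ⊗ₜ x) (evalAt t (bracket b y z)) =
      actAt (bracket b) (s + t) (evalAt s (bracket b x y)) (1 ⊗ₜ z) +
      actAt (bracket b) t (1 ⊗ₜ y) (evalAt s (bracket b x z))
  have tD : ∀ x : WSpace F, (1 : R) ⊗ₜ[F] D F x = dAdd (D F) 0 ((1 : R) ⊗ₜ[F] x) := by simp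
  have e1 : ∀ (t : R) (x y : WSpace F),
      evalAt t (bracket b (D F x) y) = -(t • evalAt t (bracket b x y)) := by
    intro t x y
    rw [bracket_D_left, map_neg, evalAt_smul, Polynomial.aeval_X]
  have e2 : ∀ (t : R) (x y : WSpace F),
      evalAt t (bracket b x (D F y)) = dAdd (D F) t (evalAt t (bracket b x y)) := by
    intro t x y
    rw [bracket_D_right, evalAt_dAdd, Polynomial.aeval_X]
  have a1 := fun (t : R) x y => actAt_D_left (bracket_D_left b) t x y
  have a2 := fun (t : R) x y => actAt_D_right (bracket_D_right b) t x y
  have zInd : ∀ x y, P x y (L F) → P x y (H F) → ∀ z, P x y z := by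
    intro x y hL hH z
    induction z using induction with
    | add z z' hz hz' =>
      simp only [P, TensorProduct.tmul_add, map_add] at hz hz' ⊢
      rw [hz, hz']
      abel
    | smul c z hz =>
      simp only [P, TensorProduct.tmul_smul, map_smul, LinearMap.map_smul_of_tower] at hz ⊢
      rw [hz, smul_add]
    | hD z hz =>
      have hz' := congrArg (fun u => dAdd (D F) 0 u + (s + t) • u) hz
      simp only [map_add, smul_add] at hz'
      simp only [P, tD, a2, e2]
      simp only [dAdd_eq (D F) s, dAdd_eq (D F) t, dAdd_eq (D F) (s + t), map_add, map_smul, a2]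
        at hz' ⊢
      simp only [add_smul] at hz' ⊢
      linear_combination (norm := module) hz'
    | hL => exact hL
    | hH => exact hH
  have yInd : ∀ x, (∀ z, P x (L F) z) → (∀ z, P x (H F) z) → ∀ y z, P x y z := by
    intro x hL hH y z
    induction y using induction with
    | add y y' hy hy' =>
      simp only [P, TensorProduct.tmul_add, map_add, LinearMap.add_apply] at hy hy' ⊢
      rw [hy, hy']
      abel
    | smul c y hy =>
      simp only [P, TensorProduct.tmul_smul, map_smul, LinearMap.map_smul_of_tower,
        LinearMap.smul_apply] at hy ⊢
      rw [hy, smul_add]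
    | hD y hy =>
      simp only [P, tD, a1, e1, e2, map_neg, map_smul] at hy ⊢
      rw [hy, dAdd_eq (D F) s, map_add, map_smul, LinearMap.add_apply, LinearMap.smul_apply, a1]
      module
    | hL => exact hL z
    | hH => exact hH z
  have xInd : (∀ y z, P (L F) y z) → (∀ y z, P (H F) y z) → ∀ x y z, P x y z := by
    intro hL hH x y z
    induction x using induction with
    | add x x' hx hx' =>
      simp only [P, TensorProduct.tmul_add, map_add, LinearMap.add_apply] at hx hx' ⊢
      rw [hx, hx']
      abel
    | smul c x hx =>
      simp only [P, TensorProduct.tmul_smul, map_smul, LinearMap.map_smul_of_tower,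
        LinearMap.smul_apply] at hx ⊢
      rw [hx, smul_add]
    | hD x hx =>
      simp only [P, tD, a1, e1, map_neg, map_smul, LinearMap.neg_apply,
        LinearMap.smul_apply] at hx ⊢
      rw [hx]
      module
    | hL => exact hL y z
    | hH => exact hH y z
  have aD : ∀ (t r : R) (x y : WSpace F), actAt (bracket b) t (1 ⊗ₜ x) (r ⊗ₜ D F y) =
      r • dAdd (D F) t (evalAt t (bracket b x y)) := by
    intro t r x y
    rw [actAt_tmul, one_smul, e2]
  have aD' : ∀ (t r : R) (x y : WSpace F), actAt (bracket b) t (r ⊗ₜ D F x) (1 ⊗ₜ y) =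
      -(r • t • (evalAt t (bracket b x y))) := by
    intro t r x y
    rw [actAt_tmul, one_smul, e1, smul_neg]
  have fin' : ∀ (r : R) (x : WSpace F), r ⊗ₜ[F] x = r • ((1 : R) ⊗ₜ[F] x) := by
    intro r x
    rw [TensorProduct.smul_tmul', smul_eq_mul, mul_one]
  have sm : ∀ (c : F) (u : R ⊗[F] WSpace F), c • u = algebraMap F R c • u := by
    intro c u
    rw [algebraMap_smul]
  refine xInd (yInd _ (zInd _ _ ?_ ?_) (zInd _ _ ?_ ?_))
    (yInd _ (zInd _ _ ?_ ?_) (zInd _ _ ?_ ?_)) x y z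
  all_goals
    simp only [P, bracket_LL, bracket_LH, bracket_HL, bracket_HH, map_add, map_smul, evalAt_tmul,
      map_one, Polynomial.aeval_X, LinearMap.map_smul_of_tower, LinearMap.add_apply,
      LinearMap.smul_apply, aD, aD', actAt_tmul, one_smul, dAdd_tmul, map_zero, LinearMap.zero_apply]
    try simp only [sm, fin' s, fin' t, fin' (s + t), map_sub, map_one, map_neg, map_ofNat]
    try module

end W

variable {F} in
/-- The Lie conformal algebra `W(b)`, free over `F[∂]` on `L, H`, with `[L_λ L] = (∂ + 2λ) L`,
`[L_λ H] = (∂ + (1 - b)λ) H`, `[H_λ L] = (-b∂ + (1 - b)λ) H` and `[H_λ H] = 0`. -/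
def W (b : F) : LieConformalAlgebra F (WSpace F) where
  D := W.D F
  bracket := W.bracket b
  bracket_D_left := W.bracket_D_left b
  bracket_D_right := W.bracket_D_right b
  skew := W.bracket_skew b
  jacobi := W.bracket_jacobi b (MvPolynomial.X 0 : MvPolynomial (Fin 2) F) (MvPolynomial.X 1)

/-- The basis elements `L, H` are numbered by `0, 1`. -/
def W.gen : Fin 2 → WSpace F := ![W.L F, W.H F]

variable {F} in
/-- `f` is the `q`-cochain of `W(b)` with coefficients in the adjoint module denoted by
`f : g_{s 1} ⊗ ⋯ ⊗ g_{s q} ↦ v`: it has the value `v` on this tuple, and the value `0` on all other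
tuples of the form `(L, …, L, H, …, H)`. By antilinearity and skew-symmetry it is determined by
these values. -/
def W.IsGivenBy (b : F) {q : ℕ} (f : PolyMap F (WSpace F) (WSpace F) q) (s : Fin q → Fin 2)
    (v : MvPolynomial (Fin q) F ⊗[F] WSpace F) : Prop :=
  f ∈ basicCochains (W b) (WSpace F) q ∧ f (fun i => W.gen F (s i)) = v ∧
    ∀ s' : Fin q → Fin 2, Monotone s' → s' ≠ s → f (fun i => W.gen F (s' i)) = 0

end W

end LieConformal
end

open LieConformal

noncomputable section

/-! ### Cartan calculus and the Chevalley–Eilenberg complex of a Lie algebra given by a basis -/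

namespace LieConformal

/-! An antilinear cochain is determined by its values on tuples of generators, and these values are
polynomials in `λ₁, …, λ_q, ∂`. Over an infinite field the polynomials may be replaced by their
values at points. If the pair `(λ, g)` is read as `e^{λ∂} g`, the λ-bracket becomes `[(λ, g), (μ,
h)] = (λ - μ) (λ + μ, g·h)` with `L·L = L`, `L·H = H`, `H·H = 0`, and the conformal differential
becomes the Chevalley–Eilenberg differential with values in functions of `∂` (`ev_d`). Everything
then rests on Cartan's formula `ι_y d + d ι_y = 𝓛_y`, where `ι_y` inserts `y` as first argument.

The basic complex. On polynomial cochains that are homogeneous of degree `n` in all the variables,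
the coefficient of `t` in `𝓛_{(t, L)}` is an Euler operator, equal to the scalar `n + 2 - q`
(`exists_lie_polynomial`). Hence the coefficient of `t` in `ι_{(t, L)}` is a contracting homotopy
outside degree `q - 2` (`diff_insData`, `exists_eq_hasWeightZero_add_diff`). In degree `q - 2`,
skew-symmetry forces the pairs (generator, exponent) in a monomial to be distinct. Only two pairs
are available for each exponent, so `2 ≤ q ≤ 4`, the exponents are `0` and `1`, and `∂` does not
occur. What remains is a complex of dimensions 2, 4, 2 with bases `u2 j`; `u3 j`, `v3 j`; `u4 j` for
`j = 0, 1`. Its differential sends `u2 0` to `2 v3 1` and `u3 0` to `-2 u4 1` and kills the other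
basis elements. The classes that survive are `u2 1`; `v3 0`, `u3 1`; `u4 0`.

The reduced complex. The operator `∂` is injective and equals `𝓛_{(0, L)}`, so it is zero on basic
cohomology, with `ι_{(0, L)}` as homotopy. The long exact sequence of the quotient by `∂` breaks
into short ones, and the reduced cohomology in degree `q` is the sum of the basic ones in degrees
`q` and `q + 1`. The second summand is represented by `ι_{(0, L)}` of cocycles
(`isRelBasis_reduced`). In this way `f11`, `f22`, `f33` arise from `f21`, `f31`, `f41`, and `f23` is
the cochain arising from `f32` corrected by `∂ f21`. -/

/-- A Lie algebra action on `V`, in terms of a basis `Y` of the Lie algebra for which the bracket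
`[y, z]` is the multiple `c y z` of the basis element `m y z`. -/
structure BasisAction (F Y V : Type*) [Field F] [AddCommGroup V] [Module F V] where
  /-- the structure constants -/
  c : Y → Y → F
  /-- the basis element to which `[y, z]` is proportional -/
  m : Y → Y → Y
  /-- the action on the module -/
  ρ : Y → V →ₗ[F] V
  c_swap : ∀ y z, c z y = -c y z
  m_comm : ∀ y z, m y z = m z y
  m_assoc : ∀ x y z, m (m x y) z = m x (m y z)
  jacobi : ∀ x y z, c x y * c (m x y) z + c y z * c (m y z) x + c z x * c (m z x) y = 0
  ρ_comm : ∀ y z v, ρ y (ρ z v) - ρ z (ρ y v) = c y z • ρ (m y z) v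

/-- Cochains as functions of basis elements. -/
abbrev FunCochain (Y V : Type*) (q : ℕ) := (Fin q → Y) → V

namespace FunCochain

variable {F Y V : Type*} [Field F] [AddCommGroup V] [Module F V] {q : ℕ}

variable (F V) in
/-- Insertion of `y` as the first argument. -/
def ins (y : Y) : FunCochain Y V (q + 1) →ₗ[F] FunCochain Y V q where
  toFun Φ a := Φ (Fin.cons y a)
  map_add' _ _ := rfl
  map_smul' _ _ := rfl

@[simp] theorem ins_apply (y : Y) (Φ : FunCochain Y V (q + 1)) (a : Fin q → Y) :
    ins F V y Φ a = Φ (Fin.cons y a) := rfl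

variable (F) in
theorem ext_ins {Φ Ψ : FunCochain Y V (q + 1)} (h : ∀ y, ins F V y Φ = ins F V y Ψ) : Φ = Ψ := by
  funext a
  rw [← Fin.cons_self_tail a]
  exact congrFun (h (a 0)) (Fin.tail a)

variable (F Y V q) in
/-- The skew-symmetric cochains. -/
def skew : Submodule F (FunCochain Y V q) where
  carrier := {Φ | ∀ (σ : Equiv.Perm (Fin q)) a, Φ (a ∘ σ) = (Equiv.Perm.sign σ : ℤ) • Φ a}
  zero_mem' := by intro σ a; simp
  add_mem' := by
    intro Φ Ψ h h' σ a
    simp only [Pi.add_apply, h σ a, h' σ a, smul_add]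
  smul_mem' := by
    intro r Φ h σ a
    simp only [Pi.smul_apply, h σ a]
    exact smul_comm _ _ _

theorem ins_mem_skew {Φ : FunCochain Y V (q + 1)} (h : Φ ∈ skew F Y V (q + 1)) (y : Y) :
    ins F V y Φ ∈ skew F Y V q := by
  intro σ a
  have := h (Equiv.Perm.decomposeFin.symm (0, σ)) (Fin.cons y a)
  rw [Equiv.Perm.decomposeFin.symm_sign, if_pos rfl, one_mul] at this
  rw [ins_apply, ins_apply, ← this]
  congr 1
  funext i
  refine Fin.cases ?_ (fun i => ?_) i <;> simp

/-- Adjacent transpositions generate the symmetric group, and the sign is multiplicative. -/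
theorem mem_skew_of_adjacent {Φ : FunCochain Y V (q + 1)}
    (h : ∀ (i : Fin q) a, Φ (a ∘ Equiv.swap i.castSucc i.succ) = -Φ a) :
    Φ ∈ skew F Y V (q + 1) := by
  intro σ
  have hσ : σ ∈ Submonoid.closure (Set.range fun i : Fin q ↦ Equiv.swap i.castSucc i.succ) := by
    rw [Equiv.Perm.mclosure_swap_castSucc_succ]; trivial
  induction hσ using Submonoid.closure_induction with
  | mem σ hσ =>
    obtain ⟨i, rfl⟩ := hσ
    intro a
    rw [h, Equiv.Perm.sign_swap (Fin.castSucc_lt_succ).ne]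
    simp
  | one => intro a; simp
  | mul σ τ _ _ hσ hτ =>
    intro a
    rw [Equiv.Perm.coe_mul, ← Function.comp_assoc, hτ, hσ, Equiv.Perm.sign_mul]
    simp only [Units.val_mul, mul_smul]
    exact smul_comm _ _ _

theorem apply_swap_of_mem_skew {Φ : FunCochain Y V (q + 2)} (h : Φ ∈ skew F Y V (q + 2)) (y z : Y)
    (a : Fin q → Y) : Φ (Fin.cons y (Fin.cons z a)) = -Φ (Fin.cons z (Fin.cons y a)) := by
  have := h (Equiv.swap 0 1) (Fin.cons z (Fin.cons y a))
  rw [Equiv.Perm.sign_swap (by simp)] at this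
  simp only [Units.val_neg, Units.val_one, neg_smul, one_smul] at this
  rw [← this]
  congr 1
  funext i
  refine Fin.cases ?_ (fun i => Fin.cases ?_ (fun i => ?_) i) i
  · simp only [Fin.cons_zero, Function.comp_apply, Equiv.swap_apply_left]; rfl
  · change z = _
    simp only [Function.comp_apply, Fin.succ_zero_eq_one, Equiv.swap_apply_right, Fin.cons_zero]
  · rw [Function.comp_apply, Equiv.swap_apply_of_ne_of_ne]
    · rfl
    · exact Fin.succ_ne_zero _
    · exact fun h => Fin.succ_ne_zero _ (Fin.succ_injective _ h)

/-- Moving the argument in position `l` to the front is a cycle of length `l + 1`, whose sign is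
`(-1) ^ l`. -/
theorem apply_cons_removeNth {Φ : FunCochain Y V (q + 1)} (h : Φ ∈ skew F Y V (q + 1)) (y : Y)
    (a : Fin (q + 1) → Y) (l : Fin (q + 1)) :
    Φ (Fin.cons y fun i => a (l.succAbove i)) = (-1 : F) ^ (l : ℕ) • Φ (Function.update a l y) := by
  have e : (Fin.cons y (fun i => a (l.succAbove i)) : Fin (q + 1) → Y) =
      Function.update a l y ∘ l.cycleRange.symm := by
    have := Fin.insertNth_comp_cycleRange_symm l y (fun i => a (l.succAbove i))
    rw [← this]
    congr 1
    funext i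
    refine Fin.succAboveCases l ?_ (fun i => ?_) i <;> simp
  rw [e, h, Equiv.Perm.sign_symm, Fin.sign_cycleRange]
  rcases Nat.even_or_odd (l : ℕ) with hl | hl <;> simp [hl.neg_one_pow]

end FunCochain

namespace BasisAction

open FunCochain

variable {F Y V : Type*} [Field F] [AddCommGroup V] [Module F V] (𝔤 : BasisAction F Y V) {q : ℕ}

/-- The Lie derivative. -/
def lie (y : Y) : FunCochain Y V q →ₗ[F] FunCochain Y V q where
  toFun Φ a := 𝔤.ρ y (Φ a) - ∑ l, 𝔤.c y (a l) • Φ (Function.update a l (𝔤.m y (a l)))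
  map_add' Φ Ψ := by
    funext a
    simp only [Pi.add_apply, map_add, smul_add, Finset.sum_add_distrib]
    abel
  map_smul' r Φ := by
    funext a
    simp only [Pi.smul_apply, map_smul, RingHom.id_apply, smul_sub, Finset.smul_sum]
    simp only [smul_comm r]

theorem lie_apply (y : Y) (Φ : FunCochain Y V q) (a : Fin q → Y) :
    𝔤.lie y Φ a =
      𝔤.ρ y (Φ a) - ∑ l, 𝔤.c y (a l) • Φ (Function.update a l (𝔤.m y (a l))) := rfl

/-- The differential, defined by Cartan's formula. -/
def diff : (q : ℕ) → FunCochain Y V q →ₗ[F] FunCochain Y V (q + 1)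
  | 0 =>
    { toFun := fun Φ a => 𝔤.lie (a 0) Φ (Fin.tail a)
      map_add' := fun Φ Ψ => by funext a; simp
      map_smul' := fun r Φ => by funext a; simp }
  | q + 1 =>
    { toFun := fun Φ a =>
        𝔤.lie (a 0) Φ (Fin.tail a) - diff q (ins F V (a 0) Φ) (Fin.tail a)
      map_add' := fun Φ Ψ => by funext a; simp only [map_add, Pi.add_apply]; abel
      map_smul' := fun r Φ => by
        funext a; simp only [map_smul, Pi.smul_apply, smul_sub, RingHom.id_apply] }

theorem ins_diff_zero (y : Y) (Φ : FunCochain Y V 0) : ins F V y (𝔤.diff 0 Φ) = 𝔤.lie y Φ := rfl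

theorem ins_diff (y : Y) (Φ : FunCochain Y V (q + 1)) :
    ins F V y (𝔤.diff (q + 1) Φ) = 𝔤.lie y Φ - 𝔤.diff q (ins F V y Φ) := rfl

/-- The identity `[𝓛_y, ι_z] = ι_{[y, z]}`: the extra term is the one where `y` is bracketed with
the first argument. Together with Cartan's formula it lets every identity below be proved by
induction on `q`, by comparing insertions. -/
theorem ins_lie (y z : Y) (Φ : FunCochain Y V (q + 1)) :
    ins F V z (𝔤.lie y Φ) = 𝔤.lie y (ins F V z Φ) - 𝔤.c y z • ins F V (𝔤.m y z) Φ := by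
  funext a
  simp only [ins_apply, lie_apply, Fin.sum_univ_succ, Fin.cons_zero, Fin.cons_succ, Pi.sub_apply,
    Pi.smul_apply, Fin.update_cons_zero, ← Fin.cons_update]
  abel

/-- After an insertion, the terms that the induction hypothesis does not cover are multiples of the
insertion of one basis element, because `m` is commutative and associative. Their scalars cancel by
the Jacobi identity for `c`. -/
theorem lie_lie (y z : Y) (Φ : FunCochain Y V q) :
    𝔤.lie y (𝔤.lie z Φ) - 𝔤.lie z (𝔤.lie y Φ) = 𝔤.c y z • 𝔤.lie (𝔤.m y z) Φ := by
  induction q with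
  | zero => funext a; simpa [lie_apply] using 𝔤.ρ_comm y z (Φ a)
  | succ q ih =>
    refine ext_ins F fun w => ?_
    have j := 𝔤.jacobi y z w
    have e1 : 𝔤.m z (𝔤.m y w) = 𝔤.m (𝔤.m y z) w := by
      rw [← 𝔤.m_assoc, 𝔤.m_comm z y]
    have e2 : 𝔤.m y (𝔤.m z w) = 𝔤.m (𝔤.m y z) w := (𝔤.m_assoc _ _ _).symm
    rw [𝔤.c_swap y w, 𝔤.m_comm w y, 𝔤.c_swap z (𝔤.m y w), 𝔤.c_swap y (𝔤.m z w)] at j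
    simp only [map_sub, map_smul, ins_lie, e1, e2]
    have := ih (ins F V w Φ)
    have j' := congrArg (fun r => r • ins F V (𝔤.m (𝔤.m y z) w) Φ) j
    linear_combination (norm := module) this + j'

theorem lie_diff (y : Y) (Φ : FunCochain Y V q) :
    𝔤.lie y (𝔤.diff q Φ) = 𝔤.diff q (𝔤.lie y Φ) := by
  induction q with
  | zero =>
    refine ext_ins F fun z => ?_
    rw [ins_lie, ins_diff_zero, ins_diff_zero, ins_diff_zero, ← 𝔤.lie_lie y z]
    abel
  | succ q ih =>
    refine ext_ins F fun z => ?_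
    rw [ins_lie, ins_diff, ins_diff, ins_diff, map_sub, smul_sub, ← 𝔤.lie_lie y z, ih, ins_lie,
      map_sub, map_smul]
    abel

/-- Inserting `y` gives `𝓛_y d Φ - d (𝓛_y Φ - d ι_y Φ)`, which vanishes since `𝓛_y` commutes with
`d` and `d² = 0` holds one degree lower. Skew-symmetry plays no role. -/
theorem diff_diff (Φ : FunCochain Y V q) : 𝔤.diff (q + 1) (𝔤.diff q Φ) = 0 := by
  induction q with
  | zero =>
    refine ext_ins F fun y => ?_
    rw [ins_diff, ins_diff_zero, lie_diff, sub_self, map_zero]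
  | succ q ih =>
    refine ext_ins F fun y => ?_
    rw [ins_diff, ins_diff, map_sub, ih, lie_diff, sub_zero, sub_self, map_zero]

theorem lie_mem_skew {Φ : FunCochain Y V q} (h : Φ ∈ skew F Y V q) (y : Y) :
    𝔤.lie y Φ ∈ skew F Y V q := by
  intro σ a
  have e : ∀ (l : Fin q) (z : Y), Function.update (a ∘ σ) l z = Function.update a (σ l) z ∘ σ := by
    intro l z
    rw [Function.update_comp_equiv]
    simp
  simp only [lie_apply, h σ a, e, h σ, Function.comp_apply]
  rw [smul_sub, Finset.smul_sum, map_zsmul]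
  congr 1
  rw [Equiv.sum_comp σ fun l =>
    𝔤.c y (a l) • (Equiv.Perm.sign σ : ℤ) • Φ (Function.update a l (𝔤.m y (a l)))]
  exact Finset.sum_congr rfl fun l _ => smul_comm _ _ _

/-- For a transposition away from the first argument, insert that argument and use induction on
Cartan's formula. For the first two arguments, `ι_y ι_z d Φ` is expanded twice and the result is
antisymmetric in `y` and `z`. -/
theorem diff_mem_skew {Φ : FunCochain Y V q} (h : Φ ∈ skew F Y V q) :
    𝔤.diff q Φ ∈ skew F Y V (q + 1) := by
  induction q with
  | zero => exact mem_skew_of_adjacent fun i => i.elim0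
  | succ q ih =>
    refine mem_skew_of_adjacent fun i a => ?_
    obtain ⟨y, a, rfl⟩ : ∃ y b, a = Fin.cons y b := ⟨a 0, Fin.tail a, (Fin.cons_self_tail a).symm⟩
    refine Fin.cases ?_ (fun i => ?_) i
    · obtain ⟨z, a, rfl⟩ : ∃ y b, a = Fin.cons y b :=
        ⟨a 0, Fin.tail a, (Fin.cons_self_tail a).symm⟩
      have e : (Fin.cons y (Fin.cons z a) : Fin (q + 2) → Y) ∘
          Equiv.swap (0 : Fin (q + 1)).castSucc (0 : Fin (q + 1)).succ =
          Fin.cons z (Fin.cons y a) := by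
        funext i
        refine Fin.cases ?_ (fun i => Fin.cases ?_ (fun i => ?_) i) i
        · simp only [Function.comp_apply, Fin.castSucc_zero, Equiv.swap_apply_left]; rfl
        · simp only [Function.comp_apply, Equiv.swap_apply_right]; rfl
        · rw [Function.comp_apply, Equiv.swap_apply_of_ne_of_ne]
          · rfl
          · exact Fin.succ_ne_zero _
          · exact fun h => Fin.succ_ne_zero _ (Fin.succ_injective _ h)
      rw [e]
      have key : ins F V y (ins F V z (𝔤.diff (q + 1) Φ)) =
          -ins F V z (ins F V y (𝔤.diff (q + 1) Φ)) := by
        rw [ins_diff, ins_diff]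
        cases q with
        | zero =>
          simp only [map_sub, ins_lie, ins_diff_zero]
          rw [𝔤.c_swap y z, 𝔤.m_comm z y]
          module
        | succ q =>
          have hs : ins F V y (ins F V z Φ) = - ins F V z (ins F V y Φ) := by
            funext a
            exact apply_swap_of_mem_skew h z y a
          simp only [map_sub, ins_lie, ins_diff]
          rw [𝔤.c_swap y z, 𝔤.m_comm z y, hs, map_neg]
          module
      exact congrFun key a
    · have e : (Fin.cons y a : Fin (q + 2) → Y) ∘ Equiv.swap i.succ.castSucc i.succ.succ =
          Fin.cons y (a ∘ Equiv.swap i.castSucc i.succ) := by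
        funext k
        refine Fin.cases ?_ (fun k => ?_) k
        · rw [Function.comp_apply, Equiv.swap_apply_of_ne_of_ne]
          · rfl
          · exact (Fin.succ_ne_zero i.castSucc).symm
          · exact (Fin.succ_ne_zero _).symm
        · rw [Function.comp_apply, Fin.cons_succ, Function.comp_apply, ← Fin.succ_castSucc,
            (Fin.succ_injective (q + 1)).swap_apply i.castSucc i.succ k, Fin.cons_succ]
      have hs : ins F V y (𝔤.diff (q + 1) Φ) ∈ skew F Y V (q + 1) := by
        rw [ins_diff]
        exact Submodule.sub_mem _ (𝔤.lie_mem_skew h y) (ih (ins_mem_skew h y))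
      have := hs (Equiv.swap i.castSucc i.succ) a
      rw [Equiv.Perm.sign_swap (Fin.castSucc_lt_succ).ne] at this
      rw [e]
      simpa using this

/-- The alternating sum of the actions in the differential. -/
def actSum (Φ : FunCochain Y V q) : FunCochain Y V (q + 1) := fun a =>
  ∑ k : Fin (q + 1), (-1 : F) ^ (k : ℕ) • 𝔤.ρ (a k) (Φ fun i => a (k.succAbove i))

/-- The alternating sum of the brackets in the differential. -/
def bracketSum : (q : ℕ) → FunCochain Y V q → FunCochain Y V (q + 1)
  | 0, _ => 0
  | n + 1, Φ => fun a =>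
      ∑ l : Fin (n + 2), ∑ k : Fin (n + 1), if k.castSucc < l then
        (-1 : F) ^ (k + l : ℕ) • 𝔤.c (a (l.succAbove k)) (a l) •
          Φ (Fin.cons (𝔤.m (a (l.succAbove k)) (a l)) fun i => a (l.succAbove (k.succAbove i)))
        else 0

theorem bracketSum_apply (Φ : FunCochain Y V (q + 1)) (a : Fin (q + 2) → Y) :
    𝔤.bracketSum (q + 1) Φ a =
      ∑ l : Fin (q + 2), ∑ k : Fin (q + 1), if k.castSucc < l then
        (-1 : F) ^ (k + l : ℕ) • 𝔤.c (a (l.succAbove k)) (a l) •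
          Φ (Fin.cons (𝔤.m (a (l.succAbove k)) (a l)) fun i => a (l.succAbove (k.succAbove i)))
        else 0 := rfl

theorem actSum_cons (y : Y) (Φ : FunCochain Y V (q + 1)) (a : Fin (q + 1) → Y) :
    𝔤.actSum Φ (Fin.cons y a) = 𝔤.ρ y (Φ a) - 𝔤.actSum (ins F V y Φ) a := by
  rw [actSum, Fin.sum_univ_succ, actSum, sub_eq_add_neg, ← Finset.sum_neg_distrib]
  congr 1
  · simp
  · refine Finset.sum_congr rfl fun k _ => ?_
    rw [Fin.cons_succ, ins_apply, Fin.val_succ, pow_succ, mul_neg_one, neg_smul]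
    congr 4
    funext i
    refine Fin.cases ?_ (fun i => ?_) i <;> simp

/-- These are the brackets of the new first argument with the others. Moving each bracket back to
its slot turns them into the bracket part of the Lie derivative. -/
theorem sum_first_bracket {Φ : FunCochain Y V (q + 1)} (h : Φ ∈ skew F Y V (q + 1)) (y : Y)
    (a : Fin (q + 1) → Y) :
    ∑ l : Fin (q + 1), (-1 : F) ^ (l + 1 : ℕ) • 𝔤.c y (a l) •
        Φ (Fin.cons (𝔤.m y (a l)) fun i => a (l.succAbove i)) =
      -∑ l : Fin (q + 1), 𝔤.c y (a l) • Φ (Function.update a l (𝔤.m y (a l))) := by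
  rw [← Finset.sum_neg_distrib]
  refine Finset.sum_congr rfl fun l _ => ?_
  rw [apply_cons_removeNth h, smul_smul, smul_smul, mul_right_comm, ← pow_add, ← neg_smul]
  congr 1
  rw [show (l + 1 + l : ℕ) = 2 * l + 1 by ring, pow_succ, pow_mul]
  simp

theorem bracketSum_cons {Φ : FunCochain Y V (q + 1)} (h : Φ ∈ skew F Y V (q + 1)) (y : Y)
    (a : Fin (q + 1) → Y) :
    𝔤.bracketSum (q + 1) Φ (Fin.cons y a) =
      -∑ l : Fin (q + 1), 𝔤.c y (a l) • Φ (Function.update a l (𝔤.m y (a l))) -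
        𝔤.bracketSum q (ins F V y Φ) a := by
  have e0 : ∀ (l : Fin (q + 1)), (fun i => (Fin.cons y a : Fin (q + 2) → Y)
      (l.succ.succAbove ((0 : Fin (q + 1)).succAbove i))) = fun i => a (l.succAbove i) := by
    intro l
    funext i
    rw [Fin.succAbove_zero, Fin.succ_succAbove_succ, Fin.cons_succ]
  rw [← 𝔤.sum_first_bracket h, bracketSum_apply, Fin.sum_univ_succ (n := q + 1)]
  simp only [Fin.not_lt_zero, if_false, Finset.sum_const_zero, zero_add]
  cases q with
  | zero =>
    simp only [bracketSum, Fin.sum_univ_succ, Finset.univ_eq_empty, Finset.sum_empty, e0]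
    simp
  | succ q =>
    rw [bracketSum_apply, sub_eq_add_neg, ← Finset.sum_neg_distrib, ← Finset.sum_add_distrib]
    refine Finset.sum_congr rfl fun l _ => ?_
    rw [Fin.sum_univ_succ]
    congr 1
    · rw [if_pos (by simp), e0]
      simp
    · rw [← Finset.sum_neg_distrib]
      refine Finset.sum_congr rfl fun k _ => ?_
      have hk : (k.succ.castSucc < l.succ) ↔ k.castSucc < l := by
        rw [← Fin.succ_castSucc, Fin.succ_lt_succ_iff]
      have e1 : ∀ z : Y, (Fin.cons z fun i => (Fin.cons y a : Fin (q + 3) → Y)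
          (l.succ.succAbove (k.succ.succAbove i)) : Fin (q + 2) → Y) =
          Fin.cons z (Fin.cons y fun i => a (l.succAbove (k.succAbove i))) := by
        intro z
        congr 1
        funext i
        refine Fin.cases ?_ (fun i => ?_) i <;> simp
      simp only [hk, e1]
      split_ifs
      · rw [apply_swap_of_mem_skew h, ins_apply]
        simp only [Fin.succ_succAbove_succ, Fin.cons_succ, Fin.val_succ, smul_neg]
        rw [show (k + 1 + (l + 1) : ℕ) = k + l + 2 by ring, pow_add]
        simp
      · simp

/-- On skew cochains the usual alternating sums satisfy the recursion `ι_y d = 𝓛_y - d ι_y` that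
defines `diff`: the terms that involve the first argument form `𝓛_y`, and the others form the
differential of `ι_y Φ` with the opposite sign. -/
theorem actSum_add_bracketSum {Φ : FunCochain Y V q} (h : Φ ∈ skew F Y V q) :
    𝔤.actSum Φ + 𝔤.bracketSum q Φ = 𝔤.diff q Φ := by
  induction q with
  | zero =>
    funext a
    change 𝔤.actSum Φ a + 0 = 𝔤.lie (a 0) Φ _
    rw [lie_apply, actSum, Fin.sum_univ_one]
    simp only [Fin.val_zero, pow_zero, one_smul, Finset.univ_eq_empty, Finset.sum_empty, sub_zero,
      add_zero]
    congr 2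
  | succ q ih =>
    refine ext_ins F fun y => ?_
    rw [ins_diff, ← ih (ins_mem_skew h y)]
    funext a
    simp only [ins_apply, Pi.add_apply, Pi.sub_apply, actSum_cons, 𝔤.bracketSum_cons h, lie_apply]
    abel

end BasisAction

/-! ### The adjoint module evaluated at points -/

namespace W

open FunCochain

variable {F : Type*} [Field F]

/-- The component of an element of `WSpace F` at a generator. -/
def component : Fin 2 → WSpace F →ₗ[F] Polynomial F :=
  ![LinearMap.fst F _ _, LinearMap.snd F _ _]

@[simp] theorem component_zero (m : WSpace F) : component 0 m = m.1 := rfl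

@[simp] theorem component_one (m : WSpace F) : component 1 m = m.2 := rfl

theorem component_smul (j : Fin 2) (p : Polynomial F) (m : WSpace F) :
    component j (p • m) = p * component j m := by
  fin_cases j <;> rfl

@[simp] theorem gen_zero : gen F 0 = L F := rfl

@[simp] theorem gen_one : gen F 1 = H F := rfl

theorem component_gen (j s : Fin 2) : component j (gen F s) = if s = j then 1 else 0 := by
  fin_cases j <;> fin_cases s <;> simp [gen, L, H]

/-- The action of the annihilation algebra of `W(-1)`, with the basis `e^{λ ∂} g`, on the adjoint
module, in terms of functions of the value of `∂`. -/
def expAction (F : Type*) [Field F] : BasisAction F (F × Fin 2) (Fin 2 → F → F) where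
  -- In a slot with variable `λ + μ`, antilinearity turns `(∂ + 2λ) g` into `(-(λ + μ) + 2λ) g = (λ
  -- - μ) g`. The product of generators is `max`; its value on the pair `H, H` is harmless because
  -- the coefficient is zero there. The action below is `g_λ (p(∂) h) = p(∂ + λ) [g_λ h]`.
  c y z := if y.2 = 1 ∧ z.2 = 1 then 0 else y.1 - z.1
  m y z := (y.1 + z.1, max y.2 z.2)
  ρ y :=
    { toFun := fun v j x => if y.2 = 0 then (x + 2 * y.1) * v j (x + y.1) else
        if j = 1 then (x + 2 * y.1) * v 0 (x + y.1) else 0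
      map_add' := fun v w => by
        funext j x
        simp only [Pi.add_apply]
        split_ifs <;> ring
      map_smul' := fun r v => by
        funext j x
        simp only [Pi.smul_apply, smul_eq_mul, RingHom.id_apply]
        split_ifs <;> ring }
  c_swap y z := by simp only [and_comm]; split_ifs <;> ring
  m_comm y z := by rw [add_comm, max_comm]
  m_assoc x y z := by simp only [add_assoc, max_assoc]
  jacobi x y z := by
    obtain ⟨x, i⟩ := x
    obtain ⟨y, j⟩ := y
    obtain ⟨z, k⟩ := z
    fin_cases i <;> fin_cases j <;> fin_cases k <;> simp <;> ring
  ρ_comm y z v := by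
    obtain ⟨y, i⟩ := y
    obtain ⟨z, k⟩ := z
    funext j x
    fin_cases i <;> fin_cases j <;> fin_cases k <;>
      simp [add_assoc, add_comm z y] <;> ring

section Eval

variable {R S : Type*} [CommRing R] [Algebra F R] [CommRing S] [Algebra F S]

/-- The `j`-th component of the value at `∂ = x`, and at the point `φ` of `R`. -/
def evR (φ : R →ₐ[F] F) (j : Fin 2) (x : F) : R ⊗[F] WSpace F →ₗ[F] F :=
  LinearMap.mul' F F ∘ₗ
    TensorProduct.map φ.toLinearMap ((Polynomial.aeval x).toLinearMap ∘ₗ component j)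

@[simp] theorem evR_tmul (φ : R →ₐ[F] F) (j : Fin 2) (x : F) (r : R) (m : WSpace F) :
    evR φ j x (r ⊗ₜ m) = φ r * (component j m).eval x := by
  simp [evR, Polynomial.coe_aeval_eq_eval]

theorem evR_smul (φ : R →ₐ[F] F) (j : Fin 2) (x : F) (r : R) (w : R ⊗[F] WSpace F) :
    evR φ j x (r • w) = φ r * evR φ j x w := by
  induction w with
  | zero => simp
  | tmul s m => simp [TensorProduct.smul_tmul', mul_assoc]
  | add u v hu hv => simp only [smul_add, map_add, hu, hv, mul_add]

theorem evR_dAdd (φ : R →ₐ[F] F) (j : Fin 2) (x : F) (t : R) (w : R ⊗[F] WSpace F) :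
    evR φ j x (dAdd (D F) t w) = (x + φ t) * evR φ j x w := by
  induction w with
  | zero => simp
  | tmul s m => simp [D, evR_smul, component_smul]; ring
  | add u v hu hv => simp only [map_add, hu, hv, mul_add]

theorem evR_rTensor (φ : S →ₐ[F] F) (ψ : R →ₐ[F] S) (j : Fin 2) (x : F) (w : R ⊗[F] WSpace F) :
    evR φ j x (ψ.toLinearMap.rTensor _ w) = evR (φ.comp ψ) j x w := by
  induction w with
  | zero => simp
  | tmul s m => simp
  | add u v hu hv => simp only [map_add, hu, hv]

theorem evR_evalAt (φ : R →ₐ[F] F) (t : R) (j : Fin 2) (x : F)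
    (w : Polynomial F ⊗[F] WSpace F) :
    evR φ j x (evalAt t w) = evR (Polynomial.aeval (φ t)) j x w := by
  rw [evalAt, evR_rTensor]
  rw [show φ.comp (Polynomial.aeval t) = Polynomial.aeval (φ t) from
    Polynomial.algHom_ext (by simp)]

/-- By sesquilinearity, `∂` on the argument multiplies both sides by `x + l`, so it suffices to
compare on `L` and `H`. -/
theorem evR_bracket (l : F) (s : Fin 2) (m : WSpace F) (j : Fin 2) (x : F) :
    evR (Polynomial.aeval l) j x (bracket (-1) (gen F s) m) =
      (expAction F).ρ (l, s) (fun j x => (component j m).eval x) j x := by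
  induction m using induction generalizing x with
  | add m m' h h' =>
    simp only [map_add, h, h', Polynomial.eval_add]
    exact congrFun (congrFun (((expAction F).ρ (l, s)).map_add _ _).symm j) x
  | smul c m h =>
    simp only [map_smul, h, Polynomial.eval_smul]
    exact congrFun (congrFun (((expAction F).ρ (l, s)).map_smul c _).symm j) x
  | hD m h =>
    rw [bracket_D_right, evR_dAdd, h]
    simp only [expAction, D, LinearMap.coe_mk, AddHom.coe_mk, Algebra.lsmul_coe, component_smul,
      Polynomial.eval_mul, Polynomial.eval_X, Polynomial.aeval_X]
    split_ifs <;> ring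
  | hL =>
    fin_cases s <;>
      simp only [Fin.zero_eta, Fin.mk_one, gen_zero, gen_one, bracket_LL, bracket_HL] <;>
      fin_cases j <;> (simp [expAction, D, L, H]; try norm_num)
  | hH =>
    fin_cases s <;>
      simp only [Fin.zero_eta, Fin.mk_one, gen_zero, gen_one, bracket_LH, bracket_HH] <;>
      fin_cases j <;> (simp [expAction, D, H]; try norm_num)

theorem evR_actAt (φ : R →ₐ[F] F) (t : R) (s : Fin 2) (w : R ⊗[F] WSpace F) (j : Fin 2) (x : F) :
    evR φ j x (actAt (bracket (-1)) t (1 ⊗ₜ gen F s) w) =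
      (expAction F).ρ (φ t, s) (fun j x => evR φ j x w) j x := by
  induction w with
  | zero =>
    simp only [map_zero]
    exact congrFun (congrFun ((expAction F).ρ (φ t, s)).map_zero.symm j) x
  | tmul r m =>
    rw [actAt_tmul, one_smul, evR_smul, evR_evalAt, evR_bracket]
    simp only [evR_tmul]
    exact congrFun (congrFun (((expAction F).ρ (φ t, s)).map_smul (φ r) _).symm j) x
  | add u v hu hv =>
    simp only [map_add, hu, hv]
    exact congrFun (congrFun (((expAction F).ρ (φ t, s)).map_add _ _).symm j) x

end Eval

section Poly

variable {q : ℕ}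

/-- `F[λ₁, …, λ_q] ⊗ F[∂]` as a polynomial ring, with `∂` as the last variable. -/
def tensorPolyEquiv (F : Type*) [Field F] (q : ℕ) :
    MvPolynomial (Fin q) F ⊗[F] Polynomial F ≃ₐ[F] MvPolynomial (Fin (q + 1)) F :=
  AlgEquiv.ofAlgHom
    (Algebra.TensorProduct.productMap (MvPolynomial.rename Fin.castSucc)
      (Polynomial.aeval (MvPolynomial.X (Fin.last q))))
    (MvPolynomial.aeval (Fin.snoc (fun i => MvPolynomial.X i ⊗ₜ 1) (1 ⊗ₜ Polynomial.X)))
    (by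
      ext i
      refine Fin.lastCases ?_ (fun i => ?_) i <;> simp)
    (by ext <;> simp)

theorem tensorPolyEquiv_tmul (p : MvPolynomial (Fin q) F) (r : Polynomial F) :
    tensorPolyEquiv F q (p ⊗ₜ r) =
      MvPolynomial.rename Fin.castSucc p * Polynomial.aeval (MvPolynomial.X (Fin.last q)) r := by
  simp [tensorPolyEquiv]

/-- `M[λ₁, …, λ_q]` for `M = W(b)`, as a space of pairs of polynomials. -/
def valueEquiv (F : Type*) [Field F] (q : ℕ) :
    MvPolynomial (Fin q) F ⊗[F] WSpace F ≃ₗ[F] (Fin 2 → MvPolynomial (Fin (q + 1)) F) where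
  toFun w j := tensorPolyEquiv F q ((component j).lTensor _ w)
  map_add' u v := by funext j; simp
  map_smul' r u := by funext j; simp
  invFun c :=
    (LinearMap.inl F (Polynomial F) (Polynomial F)).lTensor _ ((tensorPolyEquiv F q).symm (c 0)) +
      (LinearMap.inr F (Polynomial F) (Polynomial F)).lTensor _ ((tensorPolyEquiv F q).symm (c 1))
  left_inv w := by
    simp only [AlgEquiv.symm_apply_apply]
    rw [← LinearMap.lTensor_comp_apply, ← LinearMap.lTensor_comp_apply, ← LinearMap.add_apply,
      ← LinearMap.lTensor_add]
    have : LinearMap.inl F (Polynomial F) (Polynomial F) ∘ₗ component 0 +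
        LinearMap.inr F (Polynomial F) (Polynomial F) ∘ₗ component 1 = LinearMap.id :=
      LinearMap.ext fun m => by ext <;> simp
    rw [this, LinearMap.lTensor_id, LinearMap.id_apply]
  right_inv c := by
    funext j
    have h00 : component 0 ∘ₗ LinearMap.inl F (Polynomial F) (Polynomial F) = LinearMap.id := rfl
    have h01 : component 0 ∘ₗ LinearMap.inr F (Polynomial F) (Polynomial F) = 0 := rfl
    have h10 : component 1 ∘ₗ LinearMap.inl F (Polynomial F) (Polynomial F) = 0 := rfl
    have h11 : component 1 ∘ₗ LinearMap.inr F (Polynomial F) (Polynomial F) = LinearMap.id := rfl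
    fin_cases j <;>
      simp [← LinearMap.lTensor_comp_apply, h00, h01, h10, h11]

theorem valueEquiv_tmul (p : MvPolynomial (Fin q) F) (m : WSpace F) (j : Fin 2) :
    valueEquiv F q (p ⊗ₜ m) j = MvPolynomial.rename Fin.castSucc p *
      Polynomial.aeval (MvPolynomial.X (Fin.last q)) (component j m) := by
  rw [← tensorPolyEquiv_tmul]; rfl

theorem eval_valueEquiv (w : MvPolynomial (Fin q) F ⊗[F] WSpace F) (j : Fin 2) (l : Fin q → F)
    (x : F) : MvPolynomial.eval (Fin.snoc l x : Fin (q + 1) → F) (valueEquiv F q w j) =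
      evR (MvPolynomial.aeval l) j x w := by
  induction w with
  | zero => simp
  | tmul p m =>
    rw [valueEquiv_tmul, evR_tmul, map_mul, MvPolynomial.eval_rename]
    congr 1
    · rw [← MvPolynomial.aeval_eq_eval]
      congr 2
      funext i
      simp
    · rw [← MvPolynomial.aeval_eq_eval, ← Polynomial.aeval_algHom_apply]
      simp [Polynomial.coe_aeval_eq_eval]
  | add u v hu hv => simp only [map_add, Pi.add_apply, hu, hv]

theorem evR_injective [Infinite F] {u v : MvPolynomial (Fin q) F ⊗[F] WSpace F}
    (h : ∀ l j x, evR (MvPolynomial.aeval l) j x u = evR (MvPolynomial.aeval l) j x v) : u = v := by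
  apply (valueEquiv F q).injective
  funext j
  refine MvPolynomial.funext fun y => ?_
  rw [← Fin.snoc_init_self y, eval_valueEquiv, eval_valueEquiv, h]

end Poly

end W

/-! ### Conformal cochains and their differential as functions of points -/

namespace W

open FunCochain

variable {F : Type*} [Field F] {q : ℕ}

/-- Conformal antilinearity. -/
def IsAntilinear (f : PolyMap F (WSpace F) (WSpace F) q) : Prop :=
  ∀ (a : Fin q → WSpace F) (i : Fin q),
    f (Function.update a i (D F (a i))) = -((MvPolynomial.X i : MvPolynomial (Fin q) F) • f a)

/-- Induction on a set of slots outside which the arguments are generators. One slot is freed at a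
time, since `L` and `H` generate over `F[∂]` and antilinearity prescribes the effect of `∂`. -/
theorem IsAntilinear.ext {f g : PolyMap F (WSpace F) (WSpace F) q} (hf : IsAntilinear f)
    (hg : IsAntilinear g)
    (h : ∀ s : Fin q → Fin 2, f (fun i => gen F (s i)) = g (fun i => gen F (s i))) : f = g := by
  have key : ∀ (S : Finset (Fin q)) (a : Fin q → WSpace F),
      (∀ i ∉ S, ∃ s, a i = gen F s) → f a = g a := by
    intro S
    induction S using Finset.induction_on with
    | empty =>
      intro a ha
      choose s hs using fun i => ha i (Finset.notMem_empty i)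
      rw [funext hs, h]
    | insert i S _ ih =>
      intro a ha
      have hx : ∀ x : WSpace F, f (Function.update a i x) = g (Function.update a i x) := by
        intro x
        have hgen : ∀ s, f (Function.update a i (gen F s)) = g (Function.update a i (gen F s)) := by
          intro s
          refine ih _ fun k hk => ?_
          rcases eq_or_ne k i with rfl | hki
          · exact ⟨s, by simp⟩
          · rw [Function.update_of_ne hki]
            exact ha k (by simp [hki, hk])
        induction x using induction with
        | add x y hx hy => rw [f.map_update_add, g.map_update_add, hx, hy]
        | smul c x hx => rw [f.map_update_smul, g.map_update_smul, hx]
        | hD x hx =>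
          have hf' := hf (Function.update a i x) i
          have hg' := hg (Function.update a i x) i
          rw [Function.update_idem, Function.update_self] at hf' hg'
          rw [hf', hg', hx]
        | hL => exact hgen 0
        | hH => exact hgen 1
      simpa using hx (a i)
  exact MultilinearMap.ext fun a => key Finset.univ a (by simp)

variable (F q) in
/-- The value of a polynomial map at generators, as a function of `λ` and `∂`. -/
def ev : PolyMap F (WSpace F) (WSpace F) q →ₗ[F] FunCochain (F × Fin 2) (Fin 2 → F → F) q where
  toFun f a j x := evR (MvPolynomial.aeval fun i => (a i).1) j x (f fun i => gen F (a i).2)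
  map_add' f g := by funext a j x; simp
  map_smul' r f := by funext a j x; simp

theorem ev_apply (f : PolyMap F (WSpace F) (WSpace F) q) (a : Fin q → F × Fin 2) (j : Fin 2)
    (x : F) : ev F q f a j x =
      evR (MvPolynomial.aeval fun i => (a i).1) j x (f fun i => gen F (a i).2) := rfl

theorem IsAntilinear.ext_ev [Infinite F] {f g : PolyMap F (WSpace F) (WSpace F) q}
    (hf : IsAntilinear f) (hg : IsAntilinear g) (h : ev F q f = ev F q g) : f = g := by
  refine hf.ext hg fun s => evR_injective fun l j x => ?_
  exact congrFun (congrFun (congrFun h fun i => (l i, s i)) j) x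

theorem rTensor_smul {R S : Type*} [CommRing R] [Algebra F R] [CommRing S] [Algebra F S]
    (φ : R →ₐ[F] S) (p : R) (w : R ⊗[F] WSpace F) :
    φ.toLinearMap.rTensor (WSpace F) (p • w) = φ p • φ.toLinearMap.rTensor (WSpace F) w := by
  induction w with
  | zero => simp
  | tmul s m => simp [TensorProduct.smul_tmul']
  | add u v hu hv => simp only [smul_add, map_add, hu, hv]

/-- Skew-symmetry has to be checked at generators only: both the permuted map and the signed map are
antilinear, so they agree once their values at points do. -/
theorem mem_basicCochains_iff [Infinite F] {b : F} {f : PolyMap F (WSpace F) (WSpace F) q} :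
    f ∈ basicCochains (W b) (WSpace F) q ↔
      IsAntilinear f ∧ ev F q f ∈ skew F (F × Fin 2) (Fin 2 → F → F) q := by
  constructor
  · refine fun h => ⟨h.1, fun σ a => ?_⟩
    funext j x
    have := congrArg (evR (MvPolynomial.aeval fun i => (a i).1) j x)
      (h.2 σ fun i => gen F (a i).2)
    rw [evR_rTensor, MvPolynomial.algHom_ext (f := (MvPolynomial.aeval fun i => (a i).1).comp
      (MvPolynomial.rename σ)) (g := MvPolynomial.aeval fun i => (a (σ i)).1) (by simp),
      map_zsmul] at this
    exact this
  · rintro ⟨h, h'⟩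
    refine ⟨h, fun σ => ?_⟩
    let g : PolyMap F (WSpace F) (WSpace F) q :=
      ((MvPolynomial.rename σ).toLinearMap.rTensor (WSpace F)).compMultilinearMap
        (f.domDomCongr σ)
    have hg : IsAntilinear g := by
      intro a i
      have := congrArg ((MvPolynomial.rename σ).toLinearMap.rTensor (WSpace F))
        (h (a ∘ σ) (σ.symm i))
      rw [map_neg, rTensor_smul] at this
      simp only [Function.comp_apply, MvPolynomial.rename_X, Equiv.apply_symm_apply] at this
      have e : Function.update (a ∘ σ) (σ.symm i) (D F (a i)) =
          Function.update a i (D F (a i)) ∘ σ := by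
        rw [Function.update_comp_equiv]
      rw [e] at this
      exact this
    have hf : IsAntilinear ((Equiv.Perm.sign σ : ℤ) • f) := by
      intro a i
      rw [smul_apply, smul_apply, h, smul_neg]
      congr 1
      exact (smul_comm _ _ _)
    have key : g = (Equiv.Perm.sign σ : ℤ) • f := by
      refine hg.ext_ev hf ?_
      rw [map_zsmul]
      funext a j x
      have := congrFun (congrFun (h' σ a) j) x
      simp only [ev_apply, Function.comp_apply] at this
      rw [Pi.smul_apply, ← h' σ a, ev_apply, ev_apply]
      change evR _ j x ((MvPolynomial.rename σ).toLinearMap.rTensor _ _) = _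
      rw [evR_rTensor, MvPolynomial.algHom_ext (f := (MvPolynomial.aeval fun i => (a i).1).comp
        (MvPolynomial.rename σ)) (g := MvPolynomial.aeval fun i => (a (σ i)).1) (by simp)]
      rfl
    exact fun a => congrArg (fun f => f a) key

section OfData

/-- The monomial multilinear map `(a₁, …, a_q) ↦ ∏ aᵢ,ₛᵢ(-λᵢ)`. -/
def coordProd (s : Fin q → Fin 2) :
    MultilinearMap F (fun _ : Fin q => WSpace F) (MvPolynomial (Fin q) F) :=
  (MultilinearMap.mkPiAlgebra F (Fin q) (MvPolynomial (Fin q) F)).compLinearMap fun i =>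
    (Polynomial.aeval (-MvPolynomial.X i : MvPolynomial (Fin q) F)).toLinearMap ∘ₗ component (s i)

theorem coordProd_apply (s : Fin q → Fin 2) (a : Fin q → WSpace F) :
    coordProd s a = ∏ i, Polynomial.aeval (-MvPolynomial.X i : MvPolynomial (Fin q) F)
      (component (s i) (a i)) := rfl

/-- The antilinear map with given values at the generators. -/
def ofData (v : (Fin q → Fin 2) → MvPolynomial (Fin q) F ⊗[F] WSpace F) :
    PolyMap F (WSpace F) (WSpace F) q :=
  ∑ s, ((LinearMap.toSpanSingleton (MvPolynomial (Fin q) F) _ (v s)).restrictScalars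
    F).compMultilinearMap (coordProd s)

theorem ofData_apply (v : (Fin q → Fin 2) → MvPolynomial (Fin q) F ⊗[F] WSpace F)
    (a : Fin q → WSpace F) : ofData v a = ∑ s, coordProd s a • v s := by
  simp [ofData]

theorem ofData_gen (v : (Fin q → Fin 2) → MvPolynomial (Fin q) F ⊗[F] WSpace F)
    (s : Fin q → Fin 2) : ofData v (fun i => gen F (s i)) = v s := by
  rw [ofData_apply, Finset.sum_eq_single s]
  · simp [coordProd_apply, component_gen]
  · intro t _ hts
    obtain ⟨i, hi⟩ := Function.ne_iff.1 hts
    rw [coordProd_apply, Finset.prod_eq_zero (Finset.mem_univ i), zero_smul]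
    rw [component_gen, if_neg (Ne.symm hi), map_zero]
  · simp

theorem isAntilinear_ofData (v : (Fin q → Fin 2) → MvPolynomial (Fin q) F ⊗[F] WSpace F) :
    IsAntilinear (ofData v) := by
  intro a i
  rw [ofData_apply, ofData_apply, Finset.smul_sum, ← Finset.sum_neg_distrib]
  refine Finset.sum_congr rfl fun s _ => ?_
  rw [smul_smul, ← neg_smul]
  congr 1
  rw [coordProd_apply, coordProd_apply, ← Finset.mul_prod_erase _ _ (Finset.mem_univ i),
    ← Finset.mul_prod_erase (a := i) (f := fun i => Polynomial.aeval _ (component (s i) (a i)))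
    _ (Finset.mem_univ i), Function.update_self, D, Algebra.lsmul_coe, component_smul, map_mul,
    Polynomial.aeval_X]
  rw [Finset.prod_congr rfl fun k hk => by rw [Function.update_of_ne (Finset.ne_of_mem_erase hk)]]
  ring

end OfData

section Differential

theorem ev_actTerm (k : Fin (q + 1)) (f : PolyMap F (WSpace F) (WSpace F) q)
    (a : Fin (q + 1) → F × Fin 2) :
    ev F (q + 1) (actTerm (W (-1)).adjoint q k f) a =
      (expAction F).ρ (a k) (ev F q f fun i => a (k.succAbove i)) := by
  funext j x
  rw [ev_apply, actTerm_apply]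
  change evR _ j x (actAt (bracket (-1)) _ _ _) = _
  rw [evR_actAt]
  simp only [MvPolynomial.aeval_X, evR_rTensor]
  rw [MvPolynomial.algHom_ext (f := (MvPolynomial.aeval fun i => (a i).1).comp
      (MvPolynomial.rename k.succAbove)) (g := MvPolynomial.aeval fun i => (a (k.succAbove i)).1)
      (by simp)]
  rfl

theorem bracket_gen (s t : Fin 2) : bracket (-1) (gen F s) (gen F t) = if s = 1 ∧ t = 1 then 0 else
    dAdd (D F) (2 * Polynomial.X) (1 ⊗ₜ gen F (max s t)) := by
  rw [dAdd_tmul, TensorProduct.smul_tmul', smul_eq_mul, mul_one,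
    show (2 * Polynomial.X : Polynomial F) = (2 : F) • Polynomial.X by
      rw [Polynomial.smul_eq_C_mul, map_ofNat], ← TensorProduct.smul_tmul']
  fin_cases s <;> fin_cases t <;>
    simp only [Fin.zero_eta, Fin.mk_one, gen_zero, gen_one, bracket_LL, bracket_HL, bracket_LH,
      bracket_HH] <;> norm_num

/-- In the first slot `∂` acts as minus the variable of that slot. With `t = 2 λ_k` and the variable
`λ_k + λ_l`, this produces the structure constant `λ_k - λ_l`. -/
theorem extendFirst_dAdd {R : Type*} [CommRing R] [Algebra F R] {n : ℕ}
    (φ : MvPolynomial (Fin (n + 1)) F →ₐ[F] R) {f : PolyMap F (WSpace F) (WSpace F) (n + 1)}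
    (hf : IsAntilinear f) (t : R) (w : R ⊗[F] WSpace F) (v : Fin n → WSpace F) :
    extendFirst φ f (dAdd (D F) t w) v =
      (t - φ (MvPolynomial.X 0)) • extendFirst φ f w v := by
  have hD : ∀ m, f (Fin.cons (D F m) v) =
      -((MvPolynomial.X 0 : MvPolynomial (Fin (n + 1)) F) • f (Fin.cons m v)) := by
    intro m
    rw [← hf]
    simp
  induction w with
  | zero => simp
  | tmul r m =>
    rw [dAdd_tmul, map_add, add_apply, extendFirst_tmul_apply, hD, map_neg, rTensor_smul,
      TensorProduct.smul_tmul', extendFirst_tmul_apply, extendFirst_tmul_apply, smul_eq_mul]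
    module
  | add u v hu hv => simp only [map_add, add_apply, hu, hv, smul_add]

theorem extendFirst_update {R : Type*} [CommRing R] [Algebra F R] {n : ℕ}
    (φ : MvPolynomial (Fin (n + 1)) F →ₐ[F] R) {f : PolyMap F (WSpace F) (WSpace F) (n + 1)}
    (hf : IsAntilinear f) (w : R ⊗[F] WSpace F) (v : Fin n → WSpace F) (i : Fin n) :
    extendFirst φ f w (Function.update v i (D F (v i))) =
      -(φ (MvPolynomial.X i.succ) • extendFirst φ f w v) := by
  induction w with
  | zero => simp
  | tmul r m =>
    have := hf (Fin.cons m v) i.succ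
    rw [Fin.cons_succ, ← Fin.cons_update] at this
    rw [extendFirst_tmul_apply, this, map_neg, rTensor_smul, extendFirst_tmul_apply]
    module
  | add u v hu hv =>
    simp only [map_add, add_apply, hu, hv]
    module

theorem ev_bracketTerm {n : ℕ} (k : Fin (n + 1)) (l : Fin (n + 2))
    {f : PolyMap F (WSpace F) (WSpace F) (n + 1)} (hf : IsAntilinear f)
    (a : Fin (n + 2) → F × Fin 2) :
    ev F (n + 2) (bracketTerm (W (-1)) (WSpace F) n k l f) a =
      (expAction F).c (a (l.succAbove k)) (a l) • ev F (n + 1) f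
        (Fin.cons ((expAction F).m (a (l.succAbove k)) (a l))
          fun i => a (l.succAbove (k.succAbove i))) := by
  funext j x
  rw [ev_apply, bracketTerm_apply]
  change evR _ j x (extendFirst _ f (evalAt _ (bracket (-1) _ _)) _) = _
  rw [bracket_gen]
  split_ifs with h
  · simp [expAction, h]
  · have key : ∀ w : MvPolynomial (Fin (n + 1)) F ⊗[F] WSpace F,
        evR (MvPolynomial.aeval fun i => (a i).1) j x
          ((mergeVars F n k l).toLinearMap.rTensor _ w) =
        evR (MvPolynomial.aeval (Fin.cons ((a (l.succAbove k)).1 + (a l).1)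
          fun i => (a (l.succAbove (k.succAbove i))).1)) j x w := by
      intro w
      rw [evR_rTensor]
      congr 2
      refine MvPolynomial.algHom_ext fun i => ?_
      refine Fin.cases ?_ (fun i => ?_) i <;> simp [mergeVars]
    rw [evalAt_dAdd, extendFirst_dAdd _ hf, evR_smul, evalAt_tmul, map_one,
      extendFirst_tmul_apply, one_smul, key]
    simp only [Pi.smul_apply, smul_eq_mul, ev_apply]
    have e1 : (fun i => ((Fin.cons ((expAction F).m (a (l.succAbove k)) (a l))
        fun i => a (l.succAbove (k.succAbove i)) : Fin (n + 1) → F × Fin 2) i).1) =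
        Fin.cons ((a (l.succAbove k)).1 + (a l).1)
          fun i => (a (l.succAbove (k.succAbove i))).1 := by
      funext i
      refine Fin.cases ?_ (fun i => ?_) i <;> simp [expAction]
    have e2 : (fun i => gen F ((Fin.cons ((expAction F).m (a (l.succAbove k)) (a l))
        fun i => a (l.succAbove (k.succAbove i)) : Fin (n + 1) → F × Fin 2) i).2) =
        Fin.cons (gen F (max (a (l.succAbove k)).2 (a l).2))
          fun i => gen F (a (l.succAbove (k.succAbove i))).2 := by
      funext i
      refine Fin.cases ?_ (fun i => ?_) i <;> simp [expAction]
    rw [e1, e2]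
    simp only [expAction, h, if_false, mergeVars, map_sub, map_mul, map_ofNat, map_add,
      MvPolynomial.aeval_X, Polynomial.aeval_X, Fin.cons_zero]
    ring

/-- The bridge between the two complexes: each summand of the conformal differential evaluates to
the corresponding summand of the alternating sums, and these agree with Cartan's recursive
differential on skew cochains. -/
theorem ev_d [Infinite F] {f : PolyMap F (WSpace F) (WSpace F) q}
    (hf : f ∈ basicCochains (W (-1 : F)) (WSpace F) q) :
    ev F (q + 1) (d (W (-1)).adjoint q f) = (expAction F).diff q (ev F q f) := by
  rw [mem_basicCochains_iff] at hf
  rw [← (expAction F).actSum_add_bracketSum hf.2]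
  funext a
  cases q with
  | zero =>
    change ev F 1 (actTerm _ 0 0 f) a = _ + 0
    rw [ev_actTerm, BasisAction.actSum, Fin.sum_univ_one, add_zero]
    simp
  | succ n =>
    simp only [d, LinearMap.add_apply, LinearMap.sum_apply, map_add, map_sum, Pi.add_apply,
      Finset.sum_apply, LinearMap.smul_apply, map_smul, Pi.smul_apply, ev_actTerm]
    congr 1
    rw [BasisAction.bracketSum_apply]
    refine Finset.sum_congr rfl fun l _ => Finset.sum_congr rfl fun k _ => ?_
    split_ifs
    · rw [LinearMap.smul_apply, map_smul, Pi.smul_apply, ev_bracketTerm k l hf.1]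
    · rw [LinearMap.zero_apply, map_zero]; rfl

variable (F q) in
/-- The antilinear polynomial maps. -/
def antilinear : Submodule F (PolyMap F (WSpace F) (WSpace F) q) where
  carrier := {f | IsAntilinear f}
  zero_mem' := by intro a i; simp
  add_mem' := by
    intro f g hf hg a i
    simp only [add_apply, hf a i, hg a i, smul_add, neg_add]
  smul_mem' := by
    intro c f hf a i
    simp only [smul_apply, hf a i, smul_neg, smul_comm c]

theorem isAntilinear_actTerm (k : Fin (q + 1)) {f : PolyMap F (WSpace F) (WSpace F) q}
    (hf : IsAntilinear f) : IsAntilinear (actTerm (W (-1)).adjoint q k f) := by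
  intro a i
  rw [actTerm_apply, actTerm_apply]
  refine Fin.succAboveCases k ?_ (fun i => ?_) i
  · have h1 : (1 : MvPolynomial (Fin (q + 1)) F) ⊗ₜ[F] D F (a k) = dAdd (D F) 0 (1 ⊗ₜ a k) := by
      simp
    have h2 : (fun i => Function.update a k (D F (a k)) (k.succAbove i)) =
        fun i => a (k.succAbove i) := by
      funext i
      rw [Function.update_of_ne (Fin.succAbove_ne k i)]
    rw [Function.update_self, h1, h2]
    exact actAt_D_left (bracket_D_left (-1)) _ _ _
  · have h2 : (fun i' => Function.update a (k.succAbove i) (D F (a (k.succAbove i)))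
        (k.succAbove i')) = Function.update (fun i => a (k.succAbove i)) i
          (D F (a (k.succAbove i))) :=
      Function.update_comp_eq_of_injective _ Fin.succAbove_right_injective _ _
    rw [Function.update_of_ne (Fin.succAbove_ne k i).symm, h2, hf fun i => a (k.succAbove i),
      map_neg, rTensor_smul, map_neg, map_smul, MvPolynomial.rename_X]

theorem isAntilinear_bracketTerm {n : ℕ} (k : Fin (n + 1)) (l : Fin (n + 2))
    {f : PolyMap F (WSpace F) (WSpace F) (n + 1)} (hf : IsAntilinear f) :
    IsAntilinear (bracketTerm (W (-1)) (WSpace F) n k l f) := by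
  intro a i
  rw [bracketTerm_apply, bracketTerm_apply]
  change extendFirst _ f (evalAt _ (bracket (-1) _ _)) _ =
    -(_ • extendFirst _ f (evalAt _ (bracket (-1) _ _)) _)
  refine Fin.succAboveCases l ?_ (fun i => Fin.succAboveCases k ?_ (fun i => ?_) i) i
  · simp only [Function.update_self, Function.update_of_ne (Fin.succAbove_ne l _)]
    rw [bracket_D_right, evalAt_dAdd, extendFirst_dAdd _ hf, ← neg_smul]
    congr 1
    simp [mergeVars]
  · have h2 : ∀ i, l.succAbove (k.succAbove i) ≠ l.succAbove k := fun i h =>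
      Fin.succAbove_ne k i (Fin.succAbove_right_injective h)
    simp only [Function.update_self, Function.update_of_ne (Fin.succAbove_ne l k).symm,
      Function.update_of_ne (h2 _)]
    rw [bracket_D_left, map_neg, evalAt_smul, map_neg, map_smul, Polynomial.aeval_X]
    rfl
  · have h1 : l.succAbove k ≠ l.succAbove (k.succAbove i) := fun h =>
      Fin.succAbove_ne k i (Fin.succAbove_right_injective h).symm
    have h2 : (fun i' => Function.update a (l.succAbove (k.succAbove i))
        (D F (a (l.succAbove (k.succAbove i)))) (l.succAbove (k.succAbove i'))) =
        Function.update (fun i => a (l.succAbove (k.succAbove i))) i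
          (D F (a (l.succAbove (k.succAbove i)))) :=
      Function.update_comp_eq_of_injective _
        (Fin.succAbove_right_injective.comp Fin.succAbove_right_injective) _ _
    rw [Function.update_of_ne (Fin.succAbove_ne l _).symm, Function.update_of_ne h1, h2,
      extendFirst_update _ hf _ fun i => a (l.succAbove (k.succAbove i))]
    simp [mergeVars]

/-- Needed to lift identities from points: `IsAntilinear.ext_ev` compares only antilinear maps. -/
theorem isAntilinear_d {f : PolyMap F (WSpace F) (WSpace F) q} (hf : IsAntilinear f) :
    IsAntilinear (d (W (-1)).adjoint q f) := by
  cases q with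
  | zero => exact isAntilinear_actTerm 0 hf
  | succ n =>
    change d (W (-1)).adjoint (n + 1) f ∈ antilinear F (n + 2)
    simp only [d, LinearMap.add_apply, LinearMap.sum_apply, LinearMap.smul_apply]
    refine Submodule.add_mem _ (Submodule.sum_mem _ fun k _ => Submodule.smul_mem _ _
      (isAntilinear_actTerm k hf)) (Submodule.sum_mem _ fun l _ => Submodule.sum_mem _ fun k _ => ?_)
    split_ifs
    · exact Submodule.smul_mem _ _ (isAntilinear_bracketTerm k l hf)
    · exact Submodule.zero_mem _

theorem isAntilinear_partialOp {f : PolyMap F (WSpace F) (WSpace F) q} (hf : IsAntilinear f) :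
    IsAntilinear (partialOp (W (-1 : F)).adjoint q f) := by
  intro a i
  change dAdd (D F) _ (f _) = -(_ • dAdd (D F) _ (f a))
  rw [hf, map_neg, dAdd_smul]

/-- Bracketing `(0, L)` with `(μ, h)` multiplies it by `-μ`, and `(0, L)` acts on values as
multiplication by `∂`. So its Lie derivative is multiplication by `∂ + λ₁ + ⋯ + λ_q`, and Cartan's
formula applies to the operator `∂`. -/
theorem ev_partialOp (f : PolyMap F (WSpace F) (WSpace F) q) :
    ev F q (partialOp (W (-1 : F)).adjoint q f) = (expAction F).lie (0, 0) (ev F q f) := by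
  funext a j x
  change evR _ j x (dAdd (D F) _ (f _)) = _
  rw [evR_dAdd, BasisAction.lie_apply]
  simp [expAction, ← ev_apply, add_mul, Finset.sum_mul]

end Differential

end W

/-! ### Extraction of coefficients, homogeneous polynomials and restriction to lines -/

/-- Modulo `S`, every linear functional turns the sum into a polynomial in `t` with too many roots,
so all its coefficients vanish. -/
theorem mem_of_sum_pow_smul_mem {F : Type*} [Field F] [Infinite F] {U : Type*} [AddCommGroup U]
    [Module F U] (S : Submodule F U) (N : ℕ) (u : ℕ → U)
    (h : ∀ t : F, t ≠ 0 → ∑ n ∈ Finset.range N, t ^ n • u n ∈ S) {n : ℕ} (hn : n < N) : u n ∈ S := by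
  rw [← Submodule.Quotient.mk_eq_zero S, ← Module.forall_dual_apply_eq_zero_iff F]
  intro φ
  let p : Polynomial F :=
    ∑ n ∈ Finset.range N, Polynomial.C (φ (Submodule.Quotient.mk (u n))) * Polynomial.X ^ n
  -- The hypothesis says nothing at `t = 0`; the factor `X` supplies that root.
  have hp : Polynomial.X * p = 0 := by
    refine Polynomial.funext fun t => ?_
    rw [Polynomial.eval_mul, Polynomial.eval_X, Polynomial.eval_zero]
    by_cases ht : t = 0
    · rw [ht, zero_mul]
    · have := congrArg φ ((Submodule.Quotient.mk_eq_zero S).2 (h t ht))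
      rw [← Submodule.mkQ_apply, map_sum, map_sum, map_zero] at this
      rw [mul_eq_zero]
      right
      rw [← this, Polynomial.eval_finsetSum]
      refine Finset.sum_congr rfl fun n _ => ?_
      rw [Polynomial.eval_mul, Polynomial.eval_C, Polynomial.eval_pow, Polynomial.eval_X, map_smul,
        map_smul, smul_eq_mul, mul_comm, Submodule.mkQ_apply]
  have hp0 : p = 0 := by simpa using hp
  have := congrArg (fun p => p.coeff n) hp0
  simpa [p, Polynomial.coeff_X_pow, hn] using this

theorem eval_smul_of_isHomogeneous {F σ : Type*} [Field F] [Fintype σ] {p : MvPolynomial σ F} {n : ℕ}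
    (h : p.IsHomogeneous n) (t : F) (y : σ → F) :
    MvPolynomial.eval (t • y) p = t ^ n * MvPolynomial.eval y p := by
  rw [MvPolynomial.eval_eq', MvPolynomial.eval_eq', Finset.mul_sum]
  refine Finset.sum_congr rfl fun e he => ?_
  have hd : ∑ i, e i = n := by
    rw [← Finsupp.degree_eq_sum]
    by_contra hne
    exact (MvPolynomial.mem_support_iff.1 he) (h.coeff_eq_zero hne)
  simp only [Pi.smul_apply, smul_eq_mul, mul_pow, Finset.prod_mul_distrib, Finset.prod_pow_eq_pow_sum,
    hd]
  ring

/-- The restriction of `p` to the line through `y` in the direction of the `i`-th coordinate. -/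
def lineRestrict {F σ : Type*} [Field F] [DecidableEq σ] (y : σ → F) (i : σ) :
    MvPolynomial σ F →ₐ[F] Polynomial F :=
  MvPolynomial.aeval fun k => Polynomial.C (y k) + if k = i then Polynomial.X else 0

section

variable {F σ : Type*} [Field F] [DecidableEq σ] (y : σ → F) (i : σ) (p : MvPolynomial σ F)

theorem eval_lineRestrict (t : F) :
    (lineRestrict y i p).eval t = MvPolynomial.eval (Function.update y i (y i + t)) p := by
  rw [← MvPolynomial.aeval_eq_eval, ← Polynomial.coe_aeval_eq_eval]
  change ((Polynomial.aeval t).comp (lineRestrict y i)) p = _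
  congr 1
  refine MvPolynomial.algHom_ext fun k => ?_
  by_cases hk : k = i
  · subst hk; simp [lineRestrict]
  · simp [lineRestrict, hk]

theorem lineRestrict_coeff_zero : (lineRestrict y i p).coeff 0 = MvPolynomial.eval y p := by
  rw [Polynomial.coeff_zero_eq_eval_zero, eval_lineRestrict, add_zero, Function.update_eq_self]

theorem lineRestrict_coeff_one :
    (lineRestrict y i p).coeff 1 = MvPolynomial.eval y (MvPolynomial.pderiv i p) := by
  induction p using MvPolynomial.induction_on with
  | C a => simp [lineRestrict]
  | add p q hp hq => simp [hp, hq]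
  | mul_X p k hp =>
    have h1 : (lineRestrict y i (MvPolynomial.X k)).coeff 1 = if k = i then 1 else 0 := by
      simp only [lineRestrict, MvPolynomial.aeval_X]
      split_ifs <;> simp
    have h0 : (lineRestrict y i (MvPolynomial.X k)).coeff 0 = y k := by
      rw [lineRestrict_coeff_zero, MvPolynomial.eval_X]
    rw [map_mul, Polynomial.mul_coeff_one, hp, lineRestrict_coeff_zero, h0, h1,
      MvPolynomial.pderiv_mul, map_add, map_mul, map_mul, MvPolynomial.eval_X,
      MvPolynomial.pderiv_X, Pi.single_apply]
    simp only [eq_comm (a := k) (b := i)]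
    split_ifs <;> simp [add_comm]

end

/-! ### Scaling, homogeneous components and the Euler homotopy -/

namespace W

open FunCochain

variable {F : Type*} [Field F] {q : ℕ}

/-- The values of an antilinear map at the generators, as polynomials in `λ₁, …, λ_q, ∂`. -/
abbrev CochainData (F : Type*) [Field F] (q : ℕ) :=
  (Fin q → Fin 2) → Fin 2 → MvPolynomial (Fin (q + 1)) F

variable (F q) in
/-- Polynomial data as a function. -/
def evData : CochainData F q →ₗ[F] FunCochain (F × Fin 2) (Fin 2 → F → F) q where
  toFun c a j x := MvPolynomial.eval (Fin.snoc (fun i => (a i).1) x : Fin (q + 1) → F)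
    (c (fun i => (a i).2) j)
  map_add' c c' := by funext a j x; simp
  map_smul' r c := by funext a j x; simp

theorem evData_apply (c : CochainData F q) (a : Fin q → F × Fin 2) (j : Fin 2) (x : F) :
    evData F q c a j x = MvPolynomial.eval (Fin.snoc (fun i => (a i).1) x : Fin (q + 1) → F)
      (c (fun i => (a i).2) j) := rfl

theorem evData_injective [Infinite F] : Function.Injective (evData F q) := by
  intro c c' h
  funext s j
  refine MvPolynomial.funext fun y => ?_
  rw [← Fin.snoc_init_self y]
  exact congrFun (congrFun (congrFun h fun i => (Fin.init y i, s i)) j) (y (Fin.last q))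

/-- The data of a polynomial map. -/
def data (f : PolyMap F (WSpace F) (WSpace F) q) : CochainData F q :=
  fun s => valueEquiv F q (f fun i => gen F (s i))

theorem evData_data (f : PolyMap F (WSpace F) (WSpace F) q) : evData F q (data f) = ev F q f := by
  funext a j x
  exact eval_valueEquiv _ _ _ _

/-- The antilinear map with given data. -/
def ofPoly (c : CochainData F q) : PolyMap F (WSpace F) (WSpace F) q :=
  ofData fun s => (valueEquiv F q).symm (c s)

theorem ev_ofPoly (c : CochainData F q) : ev F q (ofPoly c) = evData F q c := by
  rw [← evData_data]
  congr 1
  funext s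
  rw [data, ofPoly, ofData_gen, LinearEquiv.apply_symm_apply]

theorem ofPoly_mem_basicCochains [Infinite F] {b : F} {c : CochainData F q}
    (h : evData F q c ∈ skew F (F × Fin 2) (Fin 2 → F → F) q) :
    ofPoly c ∈ basicCochains (W b) (WSpace F) q := by
  rw [mem_basicCochains_iff, ev_ofPoly]
  exact ⟨isAntilinear_ofData _, h⟩

section Scaling

variable (F q) in
/-- The substitution `λᵢ ↦ t λᵢ`, `∂ ↦ t ∂`. -/
def scale (t : F) : FunCochain (F × Fin 2) (Fin 2 → F → F) q →ₗ[F]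
    FunCochain (F × Fin 2) (Fin 2 → F → F) q where
  toFun Φ a j x := Φ (fun i => (t * (a i).1, (a i).2)) j (t * x)
  map_add' _ _ := rfl
  map_smul' _ _ := rfl

theorem scale_apply (t : F) (Φ : FunCochain (F × Fin 2) (Fin 2 → F → F) q) (a : Fin q → F × Fin 2)
    (j : Fin 2) (x : F) :
    scale F q t Φ a j x = Φ (fun i => (t * (a i).1, (a i).2)) j (t * x) := rfl

theorem scale_mem_skew (t : F) {Φ : FunCochain (F × Fin 2) (Fin 2 → F → F) q}
    (h : Φ ∈ skew F (F × Fin 2) (Fin 2 → F → F) q) :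
    scale F q t Φ ∈ skew F (F × Fin 2) (Fin 2 → F → F) q := by
  intro σ a
  funext j x
  exact congrFun (congrFun (h σ fun i => (t * (a i).1, (a i).2)) j) (t * x)

theorem ins_scale (t : F) (y : F × Fin 2)
    (Φ : FunCochain (F × Fin 2) (Fin 2 → F → F) (q + 1)) :
    ins F (Fin 2 → F → F) y (scale F (q + 1) t Φ) =
      scale F q t (ins F (Fin 2 → F → F) (t * y.1, y.2) Φ) := by
  funext a j x
  rw [ins_apply, scale_apply, scale_apply, ins_apply]
  congr 2
  funext i
  refine Fin.cases ?_ (fun i => ?_) i <;> simp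

theorem lie_scale (t : F) (y : F × Fin 2) (Φ : FunCochain (F × Fin 2) (Fin 2 → F → F) q) :
    t • (expAction F).lie y (scale F q t Φ) =
      scale F q t ((expAction F).lie (t * y.1, y.2) Φ) := by
  funext a j x
  rw [scale_apply, BasisAction.lie_apply]
  simp only [Pi.smul_apply, BasisAction.lie_apply, Pi.sub_apply, Finset.sum_apply, smul_eq_mul,
    mul_sub, Finset.mul_sum]
  congr 1
  · simp only [expAction, LinearMap.coe_mk, AddHom.coe_mk, scale_apply, mul_add]
    split_ifs <;> ring
  · refine Finset.sum_congr rfl fun l _ => ?_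
    have e : (fun i => (t * (Function.update a l ((expAction F).m y (a l)) i).1,
        (Function.update a l ((expAction F).m y (a l)) i).2)) =
        Function.update (fun i => (t * (a i).1, (a i).2)) l
          ((expAction F).m (t * y.1, y.2) (t * (a l).1, (a l).2)) := by
      funext i
      by_cases hi : i = l
      · subst hi; simp [expAction, mul_add]
      · simp [hi]
    rw [scale_apply, e]
    simp only [expAction]
    split_ifs <;> ring

/-- Structure constants and action are homogeneous of degree one in `λ` and `∂`, so the differential
raises the polynomial degree by one. -/
theorem diff_scale (t : F) (Φ : FunCochain (F × Fin 2) (Fin 2 → F → F) q) :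
    t • (expAction F).diff q (scale F q t Φ) = scale F (q + 1) t ((expAction F).diff q Φ) := by
  induction q with
  | zero =>
    refine ext_ins F fun y => ?_
    rw [ins_scale, BasisAction.ins_diff_zero, map_smul, BasisAction.ins_diff_zero, lie_scale]
  | succ q ih =>
    refine ext_ins F fun y => ?_
    rw [ins_scale, BasisAction.ins_diff, map_smul, BasisAction.ins_diff, smul_sub, lie_scale,
      ins_scale, ih, map_sub]

/-- The homogeneous component of degree `n`. -/
def homComponent (n : ℕ) (c : CochainData F q) : CochainData F q :=
  fun s j => MvPolynomial.homogeneousComponent n (c s j)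

theorem exists_degree_bound (c : CochainData F q) : ∃ N, ∀ s j, (c s j).totalDegree < N := by
  obtain ⟨N, hN⟩ := (Set.finite_range fun p : (Fin q → Fin 2) × Fin 2 =>
    (c p.1 p.2).totalDegree).bddAbove
  exact ⟨N + 1, fun s j => Nat.lt_succ_of_le (hN ⟨(s, j), rfl⟩)⟩

theorem sum_homComponent {c : CochainData F q} {N : ℕ} (hN : ∀ s j, (c s j).totalDegree < N) :
    ∑ n ∈ Finset.range N, homComponent n c = c := by
  funext s j
  rw [Finset.sum_apply, Finset.sum_apply]
  conv_rhs => rw [← MvPolynomial.sum_homogeneousComponent (c s j)]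
  symm
  refine Finset.sum_subset (fun n hn => ?_) fun n _ hn => ?_
  · have := hN s j
    simp only [Finset.mem_range] at hn ⊢
    omega
  · refine MvPolynomial.homogeneousComponent_eq_zero _ _ ?_
    simp only [Finset.mem_range] at hn
    omega

theorem scale_evData_of_isHomogeneous {n : ℕ} {c : CochainData F q}
    (h : ∀ s j, (c s j).IsHomogeneous n) (t : F) :
    scale F q t (evData F q c) = t ^ n • evData F q c := by
  funext a j x
  simp only [scale_apply, evData_apply, Pi.smul_apply, smul_eq_mul]
  rw [← eval_smul_of_isHomogeneous (h _ _)]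
  congr 2
  funext i
  refine Fin.lastCases ?_ (fun i => ?_) i <;> simp

theorem scale_evData {c : CochainData F q} {N : ℕ} (hN : ∀ s j, (c s j).totalDegree < N) (t : F) :
    scale F q t (evData F q c) =
      ∑ n ∈ Finset.range N, t ^ n • evData F q (homComponent n c) := by
  conv_lhs => rw [← sum_homComponent hN, map_sum, map_sum]
  exact Finset.sum_congr rfl fun n _ => scale_evData_of_isHomogeneous
    (fun s j => MvPolynomial.homogeneousComponent_isHomogeneous _ _) t

theorem homComponent_eq_zero {c : CochainData F q} {N n : ℕ}
    (hN : ∀ s j, (c s j).totalDegree < N) (hn : N ≤ n) : homComponent n c = 0 := by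
  funext s j
  exact MvPolynomial.homogeneousComponent_eq_zero _ _ ((hN s j).trans_le hn)

/-- The scalings of `c` are the sums `∑ tⁿ cₙ` of its homogeneous components, from which each `cₙ`
is extracted by letting `t` vary. -/
theorem homComponent_mem [Infinite F]
    (S : Submodule F (FunCochain (F × Fin 2) (Fin 2 → F → F) q)) {c : CochainData F q}
    (h : ∀ t : F, t ≠ 0 → scale F q t (evData F q c) ∈ S) (n : ℕ) :
    evData F q (homComponent n c) ∈ S := by
  obtain ⟨N, hN⟩ := exists_degree_bound c
  rcases lt_or_ge n N with hn | hn
  · exact mem_of_sum_pow_smul_mem S N (fun n => evData F q (homComponent n c))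
      (fun t ht => by rw [← scale_evData hN]; exact h t ht) hn
  · rw [homComponent_eq_zero hN hn, map_zero]
    exact S.zero_mem

variable (F q) in
/-- The skew-symmetric cocycles. -/
def funCocycles : Submodule F (FunCochain (F × Fin 2) (Fin 2 → F → F) q) :=
  skew F (F × Fin 2) (Fin 2 → F → F) q ⊓ LinearMap.ker ((expAction F).diff q)

theorem homComponent_mem_funCocycles [Infinite F] {c : CochainData F q}
    (h : evData F q c ∈ funCocycles F q) (n : ℕ) :
    evData F q (homComponent n c) ∈ funCocycles F q := by
  refine homComponent_mem _ (fun t ht => Submodule.mem_inf.2 ⟨scale_mem_skew t h.1, ?_⟩) n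
  have := diff_scale t (evData F q c)
  rw [LinearMap.mem_ker.1 h.2, map_zero, smul_eq_zero] at this
  exact this.resolve_left ht

/-- Compare the coefficients of `tᵏ` in `∑ tᵏ cₖ = tⁿ c`. For `k = n` this identifies `c` with its
component of degree `n`. -/
theorem isHomogeneous_of_scale [Infinite F] {c : CochainData F q} {n : ℕ}
    (h : ∀ t : F, t ≠ 0 → scale F q t (evData F q c) = t ^ n • evData F q c) (s : Fin q → Fin 2)
    (j : Fin 2) : (c s j).IsHomogeneous n := by
  obtain ⟨N, hN⟩ := exists_degree_bound c
  have hN' : ∀ s j, (c s j).totalDegree < N + n + 1 := fun s j => by have := hN s j; omega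
  have key : ∀ k < N + n + 1, evData F q (homComponent k c) -
      (if k = n then evData F q c else 0) ∈
        (⊥ : Submodule F (FunCochain (F × Fin 2) (Fin 2 → F → F) q)) := by
    intro k hk
    refine mem_of_sum_pow_smul_mem ⊥ (N + n + 1)
      (fun k => evData F q (homComponent k c) - (if k = n then evData F q c else 0))
      (fun t ht => ?_) hk
    rw [Submodule.mem_bot]
    simp only [smul_sub, Finset.sum_sub_distrib, ← scale_evData hN', h t ht, smul_ite, smul_zero]
    rw [Finset.sum_ite_eq', if_pos (by simp), sub_self]
  have := key n (by omega)
  rw [if_pos rfl, Submodule.mem_bot, sub_eq_zero] at this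
  rw [← evData_injective this]
  exact MvPolynomial.homogeneousComponent_isHomogeneous _ _

end Scaling

section Homotopy

/-- The coefficient of `λᵏ` of the insertion of `L` with the variable `λ`. -/
def insData (k : ℕ) (c : CochainData F (q + 1)) : CochainData F q :=
  fun s j => (MvPolynomial.finSuccEquiv F (q + 1) (c (Fin.cons 0 s) j)).coeff k

theorem ins_evData {c : CochainData F (q + 1)} {N : ℕ} (hN : ∀ s j, (c s j).totalDegree < N)
    (t : F) : ins F (Fin 2 → F → F) (t, 0) (evData F (q + 1) c) =
      ∑ k ∈ Finset.range N, t ^ k • evData F q (insData k c) := by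
  funext a j x
  rw [ins_apply, evData_apply]
  have e1 : (Fin.snoc (fun i => ((Fin.cons (t, 0) a : Fin (q + 1) → F × Fin 2) i).1) x :
      Fin (q + 2) → F) = Fin.cons t (Fin.snoc (fun i => (a i).1) x : Fin (q + 1) → F) := by
    rw [Fin.cons_snoc_eq_snoc_cons]
    congr 1
    funext i
    refine Fin.cases ?_ (fun i => ?_) i <;> simp
  have e2 : (fun i => ((Fin.cons (t, 0) a : Fin (q + 1) → F × Fin 2) i).2) =
      Fin.cons 0 fun i => (a i).2 := by
    funext i
    refine Fin.cases ?_ (fun i => ?_) i <;> simp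
  rw [e1, e2, MvPolynomial.eval_eq_eval_mv_eval',
    Polynomial.eval_eq_sum_range' (n := N)]
  · simp [insData, evData_apply, mul_comm]
  · refine (Polynomial.natDegree_map_le).trans_lt ?_
    rw [MvPolynomial.natDegree_finSuccEquiv]
    exact (MvPolynomial.degreeOf_le_totalDegree _ _).trans_lt (hN _ _)

theorem insData_mem_skew [Infinite F] {c : CochainData F (q + 1)}
    (h : evData F (q + 1) c ∈ skew F (F × Fin 2) (Fin 2 → F → F) (q + 1)) (k : ℕ) :
    evData F q (insData k c) ∈ skew F (F × Fin 2) (Fin 2 → F → F) q := by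
  obtain ⟨N, hN⟩ := exists_degree_bound c
  have hN' : ∀ s j, (c s j).totalDegree < N + k + 1 := fun s j => by have := hN s j; omega
  refine mem_of_sum_pow_smul_mem (skew F (F × Fin 2) (Fin 2 → F → F) q) (N + k + 1)
    (fun k => evData F q (insData k c)) (fun t _ => ?_) (by omega : k < N + k + 1)
  rw [← ins_evData hN']
  exact ins_mem_skew h _

/-- In `(x + 2t) p(…, x + t) - ∑ (t - λ_l) p(…, λ_l + t, …)` the linear coefficient is `2p + x ∂ₓp -
q p + ∑ λ_l ∂_l p`, and Euler's identity turns the derivatives into `n p`. -/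
theorem exists_lie_polynomial {n : ℕ} {c : CochainData F q} (h : ∀ s j, (c s j).IsHomogeneous n)
    (a : Fin q → F × Fin 2) (j : Fin 2) (x : F) : ∃ Q : Polynomial F,
      (∀ t, Q.eval t = (expAction F).lie (t, 0) (evData F q c) a j x) ∧
      Q.coeff 1 = ((n : F) + 2 - q) * evData F q c a j x := by
  set y : Fin (q + 1) → F := Fin.snoc (fun i => (a i).1) x with hy
  set p := c (fun i => (a i).2) j with hp
  refine ⟨(Polynomial.C x + Polynomial.C 2 * Polynomial.X) * lineRestrict y (Fin.last q) p -
    ∑ l : Fin q, (Polynomial.X - Polynomial.C (a l).1) * lineRestrict y l.castSucc p,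
    fun t => ?_, ?_⟩
  · rw [BasisAction.lie_apply]
    simp only [Polynomial.eval_sub, Polynomial.eval_mul, Polynomial.eval_add, Polynomial.eval_C,
      Polynomial.eval_X, Polynomial.eval_finsetSum, eval_lineRestrict, Pi.sub_apply,
      Finset.sum_apply, Pi.smul_apply, smul_eq_mul]
    congr 1
    · simp [expAction, evData_apply, hy, hp, Fin.snoc_last, Fin.update_snoc_last]
    · refine Finset.sum_congr rfl fun l _ => ?_
      have e1 : (fun i => (Function.update a l ((expAction F).m (t, 0) (a l)) i).1) =
          Function.update (fun i => (a i).1) l ((a l).1 + t) := by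
        funext i
        by_cases hi : i = l
        · subst hi; simp [expAction, add_comm]
        · simp [hi]
      have e2 : (fun i => (Function.update a l ((expAction F).m (t, 0) (a l)) i).2) =
          fun i => (a i).2 := by
        funext i
        by_cases hi : i = l
        · subst hi; simp [expAction]
        · simp [hi]
      rw [evData_apply, e1, e2, Fin.snoc_update]
      simp [expAction, hy, hp]
  · have euler : ∑ i, y i * MvPolynomial.eval y (MvPolynomial.pderiv i p) =
        n * MvPolynomial.eval y p := by
      have := congrArg (MvPolynomial.eval y) (h (fun i => (a i).2) j).sum_X_mul_pderiv
      simpa using this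
    rw [Fin.sum_univ_castSucc] at euler
    simp only [Polynomial.coeff_sub, Polynomial.finsetSum_coeff, Polynomial.mul_coeff_one,
      lineRestrict_coeff_zero, lineRestrict_coeff_one, evData_apply, ← hy, ← hp]
    simp only [hy, Fin.snoc_castSucc, Fin.snoc_last] at euler
    simp [Polynomial.coeff_X, Polynomial.coeff_C, Finset.sum_add_distrib, hy]
    linear_combination euler

/-- For a cocycle, Cartan's formula reads `d ι_{(t, L)} = 𝓛_{(t, L)}`. Both sides are polynomial in
`t`, and this is the equality of the coefficients of `t`. -/
theorem diff_insData [Infinite F] {n : ℕ} {c : CochainData F (q + 1)}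
    (h : ∀ s j, (c s j).IsHomogeneous n) (hc : (expAction F).diff (q + 1) (evData F (q + 1) c) = 0) :
    (expAction F).diff q (evData F q (insData 1 c)) =
      ((n : F) + 2 - (q + 1 : ℕ)) • evData F (q + 1) c := by
  obtain ⟨N, hN⟩ := exists_degree_bound c
  have hN' : ∀ s j, (c s j).totalDegree < N + 2 := fun s j => by have := hN s j; omega
  have hlie : ∀ t, (expAction F).lie (t, 0) (evData F (q + 1) c) =
      ∑ k ∈ Finset.range (N + 2), t ^ k • (expAction F).diff q (evData F q (insData k c)) := by
    intro t
    have := congrArg (ins F (Fin 2 → F → F) (t, 0)) hc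
    rw [BasisAction.ins_diff, map_zero, sub_eq_zero, ins_evData hN', map_sum] at this
    rw [this]
    exact Finset.sum_congr rfl fun k _ => map_smul _ _ _
  funext a j x
  obtain ⟨Q, hQ, hQ1⟩ := exists_lie_polynomial h a j x
  have hQ' : Q = ∑ k ∈ Finset.range (N + 2), Polynomial.C
      ((expAction F).diff q (evData F q (insData k c)) a j x) * Polynomial.X ^ k := by
    refine Polynomial.funext fun t => ?_
    rw [hQ, hlie, Polynomial.eval_finsetSum, Finset.sum_apply, Finset.sum_apply, Finset.sum_apply]
    refine Finset.sum_congr rfl fun k _ => ?_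
    rw [Polynomial.eval_mul, Polynomial.eval_C, Polynomial.eval_pow, Polynomial.eval_X, mul_comm]
    rfl
  have := congrArg (fun Q => Q.coeff 1) hQ'
  simp only [Polynomial.finsetSum_coeff, Polynomial.coeff_C_mul, Polynomial.coeff_X_pow, mul_ite,
    mul_one, mul_zero, Finset.sum_ite_eq, Finset.mem_range] at this
  rw [if_pos (by omega), hQ1] at this
  exact this.symm

/-- The polynomials are homogeneous of degree `q - 2`. -/
def HasWeightZero (c : CochainData F q) : Prop :=
  ∀ s j e, (c s j).coeff e ≠ 0 → e.degree + 2 = q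

theorem exists_eq_hasWeightZero_add_diff [CharZero F] {c : CochainData F (q + 1)}
    (h : evData F (q + 1) c ∈ funCocycles F (q + 1)) :
    ∃ (c₀ : CochainData F (q + 1)) (b : CochainData F q), HasWeightZero c₀ ∧
      evData F (q + 1) c₀ ∈ funCocycles F (q + 1) ∧
      evData F q b ∈ skew F (F × Fin 2) (Fin 2 → F → F) q ∧
      evData F (q + 1) c = evData F (q + 1) c₀ + (expAction F).diff q (evData F q b) := by
  obtain ⟨N, hN⟩ := exists_degree_bound c
  have hom : ∀ n s j, (homComponent n c s j).IsHomogeneous n := fun n s j =>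
    MvPolynomial.homogeneousComponent_isHomogeneous _ _
  have hcomp := homComponent_mem_funCocycles h
  -- The homogeneous components of a cocycle are cocycles. Each one whose Euler scalar is nonzero is
  -- the differential of its homotopy divided by that scalar; characteristic zero leaves only `n + 2
  -- = q + 1` aside.
  refine ⟨∑ n ∈ (Finset.range N).filter fun n => n + 2 = q + 1, homComponent n c,
    ∑ n ∈ (Finset.range N).filter fun n => ¬n + 2 = q + 1,
      ((n : F) + 2 - (q + 1 : ℕ))⁻¹ • insData 1 (homComponent n c), ?_, ?_, ?_, ?_⟩
  · intro s j e he
    rw [Finset.sum_apply, Finset.sum_apply, MvPolynomial.coeff_sum] at he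
    obtain ⟨n, hn, hne⟩ := Finset.exists_ne_zero_of_sum_ne_zero he
    refine Eq.trans ?_ (Finset.mem_filter.1 hn).2
    rw [Nat.add_right_cancel_iff]
    by_contra hd
    exact hne ((hom n s j).coeff_eq_zero hd)
  · rw [map_sum]
    exact Submodule.sum_mem _ fun n _ => hcomp n
  · rw [map_sum]
    refine Submodule.sum_mem _ fun n _ => ?_
    rw [map_smul]
    exact Submodule.smul_mem _ _ (insData_mem_skew (hcomp n).1 1)
  · conv_lhs => rw [← sum_homComponent hN, ← Finset.sum_filter_add_sum_filter_not (Finset.range N)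
      (fun n => n + 2 = q + 1), map_add]
    congr 1
    simp only [map_sum, map_smul]
    refine Finset.sum_congr rfl fun n hn => ?_
    rw [diff_insData (hom n) (LinearMap.mem_ker.1 (hcomp n).2), smul_smul, inv_mul_cancel₀,
      one_smul]
    have := (Finset.mem_filter.1 hn).2
    rw [sub_ne_zero]
    exact_mod_cast this

/-- There is nothing to insert into, so a 0-cocycle is annihilated by `𝓛_{(t, L)}` itself, and the
Euler scalar `n + 2` is never zero. -/
theorem eq_zero_of_mem_funCocycles_zero [CharZero F] {c : CochainData F 0}
    (h : evData F 0 c ∈ funCocycles F 0) : evData F 0 c = 0 := by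
  obtain ⟨N, hN⟩ := exists_degree_bound c
  conv_lhs => rw [← sum_homComponent hN]
  rw [map_sum]
  refine Finset.sum_eq_zero fun n _ => ?_
  funext a j x
  obtain ⟨Q, hQ, hQ1⟩ := exists_lie_polynomial (c := homComponent n c)
    (fun s j => MvPolynomial.homogeneousComponent_isHomogeneous n (c s j)) a j x
  have hQ' : Q = 0 := by
    refine Polynomial.funext fun t => ?_
    have := congrArg (ins F (Fin 2 → F → F) (t, 0))
      (LinearMap.mem_ker.1 (homComponent_mem_funCocycles h n).2)
    rw [hQ, ← BasisAction.ins_diff_zero, this]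
    simp
  rw [hQ', Polynomial.coeff_zero, eq_comm, mul_eq_zero] at hQ1
  refine hQ1.resolve_left ?_
  simp only [Nat.cast_zero, sub_zero]
  exact_mod_cast (by omega : n + 2 ≠ 0)

end Homotopy

end W

/-! ### Classification of the skew cochains of weight zero -/

namespace W

open FunCochain

variable {F : Type*} [Field F] {q : ℕ}

section Classification

/-- The exponents `e` of `λ₁, …, λ_q` and `k` of `∂`. -/
def exponent (e : Fin q → ℕ) (k : ℕ) : Fin (q + 1) →₀ ℕ :=
  Finsupp.equivFunOnFinite.symm (Fin.snoc e k)

@[simp] theorem exponent_castSucc (e : Fin q → ℕ) (k : ℕ) (i : Fin q) :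
    exponent e k i.castSucc = e i := by
  simp [exponent]

@[simp] theorem exponent_last (e : Fin q → ℕ) (k : ℕ) : exponent e k (Fin.last q) = k := by
  simp [exponent]

theorem exponent_eta (e : Fin (q + 1) →₀ ℕ) :
    exponent (fun i => e i.castSucc) (e (Fin.last q)) = e := by
  ext i
  refine Fin.lastCases ?_ (fun i => ?_) i <;> simp

theorem degree_exponent (e : Fin q → ℕ) (k : ℕ) : (exponent e k).degree = ∑ i, e i + k := by
  rw [Finsupp.degree_eq_sum, Fin.sum_univ_castSucc]
  simp

/-- The coefficient of the value at the generators numbered by `(y i).1`, at the monomial with the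
exponents `(y i).2` and `k`. -/
def tupleCoeff (c : CochainData F q) (y : Fin q → Fin 2 × ℕ) (k : ℕ) (j : Fin 2) : F :=
  (c (fun i => (y i).1) j).coeff (exponent (fun i => (y i).2) k)

theorem rename_data_of_skew [Infinite F] {c : CochainData F q}
    (h : evData F q c ∈ skew F (F × Fin 2) (Fin 2 → F → F) q) (σ : Equiv.Perm (Fin q))
    (s : Fin q → Fin 2) (j : Fin 2) :
    MvPolynomial.rename (Fin.snoc (fun i => (σ i).castSucc) (Fin.last q) :
      Fin (q + 1) → Fin (q + 1)) (c (s ∘ σ) j) = (Equiv.Perm.sign σ : ℤ) • c s j := by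
  refine MvPolynomial.funext fun y => ?_
  rw [MvPolynomial.eval_rename, map_zsmul, ← Fin.snoc_init_self y]
  have := congrFun (congrFun (h σ fun i => (Fin.init y i, s i)) j) (y (Fin.last q))
  rw [Pi.smul_apply, Pi.smul_apply, evData_apply, evData_apply] at this
  rw [← this]
  congr 2
  funext i
  refine Fin.lastCases ?_ (fun i => ?_) i
  · simp
  · simp [Fin.init]

theorem tupleCoeff_comp [Infinite F] {c : CochainData F q}
    (h : evData F q c ∈ skew F (F × Fin 2) (Fin 2 → F → F) q) (σ : Equiv.Perm (Fin q))
    (y : Fin q → Fin 2 × ℕ) (k : ℕ) (j : Fin 2) :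
    tupleCoeff c (y ∘ σ) k j = (Equiv.Perm.sign σ : ℤ) • tupleCoeff c y k j := by
  set τ : Fin (q + 1) → Fin (q + 1) := Fin.snoc (fun i => (σ i).castSucc) (Fin.last q) with hτ
  have hinj : Function.Injective τ := by
    intro i i'
    refine Fin.lastCases ?_ (fun i => ?_) i <;> refine Fin.lastCases ?_ (fun i' => ?_) i' <;>
      simp [hτ, (Fin.castSucc_lt_last _).ne, (Fin.castSucc_lt_last _).ne']
  have hsurj : Function.Surjective τ := Finite.injective_iff_surjective.1 hinj
  have he : (exponent (fun i => ((y ∘ σ) i).2) k).mapDomain τ = exponent (fun i => (y i).2) k := by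
    ext i
    obtain ⟨i, rfl⟩ := hsurj i
    rw [Finsupp.mapDomain_apply hinj]
    refine Fin.lastCases ?_ (fun i => ?_) i <;> simp [hτ]
  have := congrArg (MvPolynomial.coeff (exponent (fun i => (y i).2) k))
    (rename_data_of_skew h σ (fun i => (y i).1) j)
  rw [← hτ, ← he, MvPolynomial.coeff_rename_mapDomain _ hinj, he] at this
  rw [tupleCoeff, tupleCoeff]
  refine this.trans ?_
  exact MvPolynomial.coeff_smul _ _ _

/-- If a pair (generator, exponent) occurs twice, the transposition of the two places fixes the
tuple but negates the coefficient. -/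
theorem injective_of_tupleCoeff_ne_zero [CharZero F] {c : CochainData F q}
    (h : evData F q c ∈ skew F (F × Fin 2) (Fin 2 → F → F) q) {y : Fin q → Fin 2 × ℕ} {k : ℕ}
    {j : Fin 2} (hy : tupleCoeff c y k j ≠ 0) : Function.Injective y := by
  intro i i' hii
  by_contra hne
  have e : y ∘ Equiv.swap i i' = y := by
    funext l
    rw [Function.comp_apply, Equiv.swap_apply_def]
    split_ifs with h1 h2
    · rw [h1, hii]
    · rw [h2, hii]
    · rfl
  have := tupleCoeff_comp h (Equiv.swap i i') y k j
  rw [e, Equiv.Perm.sign_swap hne] at this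
  simp only [Units.val_neg, Units.val_one, neg_smul, one_smul] at this
  exact hy (self_eq_neg.1 this)

theorem HasWeightZero.sum_eq {c : CochainData F q} (hc : HasWeightZero c)
    {y : Fin q → Fin 2 × ℕ} {k : ℕ} {j : Fin 2} (hy : tupleCoeff c y k j ≠ 0) :
    ∑ i, (y i).2 + k + 2 = q := by
  rw [← degree_exponent]
  exact hc _ _ _ hy

/-- Distinct pairs soon have large exponents, while the weight condition keeps the average exponent
below one. -/
theorem le_four_of_injective {y : Fin q → Fin 2 × ℕ} (hy : Function.Injective y) {k : ℕ}
    (hk : ∑ i, (y i).2 + k + 2 = q) : q ≤ 4 := by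
  -- The subtraction is truncated, so only exponents `0` and `1` count, and the two generators
  -- contribute at most `2 · (2 + 1)`.
  have h1 : ∑ i, (2 - (y i).2) ≤ 6 := by
    rw [← Finset.sum_image (f := fun z : Fin 2 × ℕ => 2 - z.2) (g := y) (s := Finset.univ)
      (fun i _ i' _ h => hy h)]
    refine (Finset.sum_le_sum_of_ne_zero (t := Finset.univ ×ˢ Finset.range 2)
      fun z _ hz => ?_).trans (by decide)
    simp only [Finset.mem_product, Finset.mem_univ, Finset.mem_range, true_and]
    omega
  have h2 : ∑ i : Fin q, 2 ≤ ∑ i, (2 - (y i).2) + ∑ i, (y i).2 := by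
    rw [← Finset.sum_add_distrib]
    exact Finset.sum_le_sum fun i _ => by omega
  simp at h2
  omega

theorem tuple_two {y : Fin 2 → Fin 2 × ℕ} (hy : StrictMono (toLex ∘ y)) {k : ℕ}
    (hk : ∑ i, (y i).2 + k + 2 = 2) : k = 0 ∧ y = ![(0, 0), (1, 0)] := by
  have h01 := hy (show (0 : Fin 2) < 1 by decide)
  simp only [Function.comp_apply, Prod.Lex.toLex_lt_toLex, Fin.lt_def, Fin.ext_iff] at h01
  simp only [Fin.sum_univ_two] at hk
  refine ⟨by omega, ?_⟩
  have := (y 0).1.isLt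
  have := (y 1).1.isLt
  funext i
  fin_cases i <;> refine Prod.ext (Fin.ext ?_) ?_ <;> simp <;> omega

theorem tuple_three {y : Fin 3 → Fin 2 × ℕ} (hy : StrictMono (toLex ∘ y)) {k : ℕ}
    (hk : ∑ i, (y i).2 + k + 2 = 3) :
    k = 0 ∧ (y = ![(0, 0), (0, 1), (1, 0)] ∨ y = ![(0, 0), (1, 0), (1, 1)]) := by
  have h01 := hy (show (0 : Fin 3) < 1 by decide)
  have h12 := hy (show (1 : Fin 3) < 2 by decide)
  simp only [Function.comp_apply, Prod.Lex.toLex_lt_toLex, Fin.lt_def, Fin.ext_iff] at h01 h12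
  simp only [Fin.sum_univ_three] at hk
  have := (y 0).1.isLt
  have := (y 1).1.isLt
  have := (y 2).1.isLt
  refine ⟨by omega, ?_⟩
  by_cases h : ((y 1).1 : ℕ) = 0
  · left
    funext i
    fin_cases i <;> refine Prod.ext (Fin.ext ?_) ?_ <;> simp <;> omega
  · right
    funext i
    fin_cases i <;> refine Prod.ext (Fin.ext ?_) ?_ <;> simp <;> omega

theorem tuple_four {y : Fin 4 → Fin 2 × ℕ} (hy : StrictMono (toLex ∘ y)) {k : ℕ}
    (hk : ∑ i, (y i).2 + k + 2 = 4) : k = 0 ∧ y = ![(0, 0), (0, 1), (1, 0), (1, 1)] := by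
  have h01 := hy (show (0 : Fin 4) < 1 by decide)
  have h12 := hy (show (1 : Fin 4) < 2 by decide)
  have h23 := hy (show (2 : Fin 4) < 3 by decide)
  simp only [Function.comp_apply, Prod.Lex.toLex_lt_toLex, Fin.lt_def, Fin.ext_iff] at h01 h12 h23
  simp only [Fin.sum_univ_four] at hk
  have := (y 0).1.isLt
  have := (y 1).1.isLt
  have := (y 2).1.isLt
  have := (y 3).1.isLt
  refine ⟨by omega, ?_⟩
  funext i
  fin_cases i <;> refine Prod.ext (Fin.ext ?_) ?_ <;> simp <;> omega

/-- Up to sign a coefficient depends only on the set of its pairs, so the tuple may be sorted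
lexicographically; nonvanishing makes the sorted tuple strictly increasing. -/
theorem eq_zero_of_tupleCoeff [CharZero F] {c : CochainData F q} (hc : HasWeightZero c)
    (h : evData F q c ∈ skew F (F × Fin 2) (Fin 2 → F → F) q)
    (h0 : ∀ y k j, StrictMono (toLex ∘ y) → ∑ i, (y i).2 + k + 2 = q → tupleCoeff c y k j = 0) :
    c = 0 := by
  funext s j
  ext e
  rw [Pi.zero_apply, Pi.zero_apply, MvPolynomial.coeff_zero]
  by_contra hne
  let y : Fin q → Fin 2 × ℕ := fun i => (s i, e i.castSucc)
  have hy : tupleCoeff c y (e (Fin.last q)) j ≠ 0 := by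
    change (c s j).coeff (exponent _ _) ≠ 0
    rwa [exponent_eta]
  set σ := Tuple.sort (toLex ∘ y)
  have hσ : tupleCoeff c (y ∘ σ) (e (Fin.last q)) j ≠ 0 := by
    rw [tupleCoeff_comp h]
    rcases Int.units_eq_one_or (Equiv.Perm.sign σ) with h1 | h1 <;> simpa [h1] using hy
  refine hσ (h0 _ _ _ ?_ (hc.sum_eq hσ))
  have hm : Monotone (toLex ∘ (y ∘ σ)) := Tuple.monotone_sort (toLex ∘ y)
  exact hm.strictMono_of_injective
    (toLex.injective.comp (injective_of_tupleCoeff_ne_zero h hσ))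

/-- The point with the generators `(y i).1` and the values `λᵢ = (y i).2`. -/
def point (F : Type*) [Field F] (y : Fin q → Fin 2 × ℕ) : Fin q → F × Fin 2 :=
  fun i => ((y i).2, (y i).1)

/-- Use the exponents themselves as the values of the `λᵢ`, and `∂ = 0`. A monomial that survives
there has exponent `0` wherever `λᵢ = 0`. Where `λᵢ = 1` its exponent is positive, since otherwise
it would repeat the pair of a slot with the same generator and exponent `0`. The total degree then
leaves only the monomial with exponents `(y i).2`, whose value is `1`. Thus coefficients are read
off as values. -/
theorem evData_point [CharZero F] {c : CochainData F q} (hc : HasWeightZero c)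
    (h : evData F q c ∈ skew F (F × Fin 2) (Fin 2 → F → F) q) {y : Fin q → Fin 2 × ℕ}
    (hy : ∀ i, (y i).2 = 0 ∨ (y i).2 = 1 ∧ ∃ i', y i' = ((y i).1, 0))
    (hsum : ∑ i, (y i).2 + 2 = q) (j : Fin 2) :
    evData F q c (point F y) j 0 = tupleCoeff c y 0 j := by
  rw [evData_apply, MvPolynomial.eval_eq', Finset.sum_eq_single (exponent (fun i => (y i).2) 0)]
  · rw [tupleCoeff, Fin.prod_univ_castSucc]
    simp only [exponent_castSucc, exponent_last, Fin.snoc_castSucc, Fin.snoc_last, pow_zero,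
      mul_one, point]
    rw [Finset.prod_eq_one, mul_one]
    intro i _
    rcases hy i with h0 | ⟨h1, -⟩
    · simp [h0]
    · simp [h1]
  · intro e he hne
    rw [MvPolynomial.mem_support_iff] at he
    rw [Fin.prod_univ_castSucc]
    simp only [Fin.snoc_castSucc, Fin.snoc_last, point]
    by_contra h0
    apply hne
    have hlast : e (Fin.last q) = 0 := by
      by_contra hl
      rw [zero_pow hl, mul_zero, mul_zero] at h0
      exact h0 rfl
    rw [hlast, pow_zero, mul_one] at h0
    have hprod := right_ne_zero_of_mul h0
    rw [Finset.prod_ne_zero_iff] at hprod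
    let z : Fin q → Fin 2 × ℕ := fun i => ((y i).1, e i.castSucc)
    have hz : tupleCoeff c z 0 j ≠ 0 := by
      change (c _ j).coeff (exponent (fun i => e i.castSucc) 0) ≠ 0
      rw [← hlast, exponent_eta]
      exact he
    have hzero : ∀ i, (y i).2 = 0 → e i.castSucc = 0 := by
      intro i hi
      by_contra hl
      have := hprod i (Finset.mem_univ i)
      rw [hi, Nat.cast_zero, zero_pow hl] at this
      exact this rfl
    have hle : ∀ i ∈ Finset.univ, (y i).2 ≤ e i.castSucc := by
      intro i _
      rcases hy i with h0 | ⟨h1, i', hi'⟩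
      · omega
      · rw [h1, Nat.one_le_iff_ne_zero]
        intro hi
        have hi0 : e i'.castSucc = 0 := hzero i' (by rw [hi'])
        have : z i = z i' := by
          simp only [z, hi, hi0, hi']
        have := injective_of_tupleCoeff_ne_zero h hz this
        rw [← this] at hi'
        rw [hi'] at h1
        exact zero_ne_one h1
    have hs := hc.sum_eq hz
    have : ∑ i, (y i).2 = ∑ i : Fin q, e i.castSucc := by
      have : ∑ i, (z i).2 = ∑ i : Fin q, e i.castSucc := rfl
      omega
    rw [Finset.sum_eq_sum_iff_of_le hle] at this
    rw [← exponent_eta e, hlast]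
    congr 1
    funext i
    exact (this i (Finset.mem_univ i)).symm
  · intro he
    rw [MvPolynomial.notMem_support_iff.1 he, zero_mul]

theorem eq_zero_of_two [CharZero F] {c : CochainData F 2} (hc : HasWeightZero c)
    (h : evData F 2 c ∈ skew F (F × Fin 2) (Fin 2 → F → F) 2)
    (h0 : ∀ j, evData F 2 c ![(0, 0), (0, 1)] j 0 = 0) : evData F 2 c = 0 := by
  rw [eq_zero_of_tupleCoeff hc h, map_zero]
  intro y k j hy hk
  obtain ⟨rfl, rfl⟩ := tuple_two hy hk
  rw [← evData_point hc h]
  · refine Eq.trans ?_ (h0 j)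
    refine congrFun (congrFun (congrArg _ ?_) j) 0
    funext i
    fin_cases i <;> simp [point]
  · intro i
    fin_cases i <;> simp
  · rfl

theorem eq_zero_of_three [CharZero F] {c : CochainData F 3} (hc : HasWeightZero c)
    (h : evData F 3 c ∈ skew F (F × Fin 2) (Fin 2 → F → F) 3)
    (h0 : ∀ j, evData F 3 c ![(0, 0), (1, 0), (0, 1)] j 0 = 0)
    (h1 : ∀ j, evData F 3 c ![(0, 0), (0, 1), (1, 1)] j 0 = 0) : evData F 3 c = 0 := by
  rw [eq_zero_of_tupleCoeff hc h, map_zero]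
  intro y k j hy hk
  obtain ⟨rfl, rfl | rfl⟩ := tuple_three hy hk
  · rw [← evData_point hc h]
    · refine Eq.trans ?_ (h0 j)
      refine congrFun (congrFun (congrArg _ ?_) j) 0
      funext i
      fin_cases i <;> simp [point]
    · intro i
      fin_cases i
      · simp
      · exact Or.inr ⟨rfl, 0, rfl⟩
      · simp
    · rfl
  · rw [← evData_point hc h]
    · refine Eq.trans ?_ (h1 j)
      refine congrFun (congrFun (congrArg _ ?_) j) 0
      funext i
      fin_cases i <;> simp [point]
    · intro i
      fin_cases i
      · simp
      · simp
      · exact Or.inr ⟨rfl, 1, rfl⟩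
    · rfl

theorem eq_zero_of_four [CharZero F] {c : CochainData F 4} (hc : HasWeightZero c)
    (h : evData F 4 c ∈ skew F (F × Fin 2) (Fin 2 → F → F) 4)
    (h0 : ∀ j, evData F 4 c ![(0, 0), (1, 0), (0, 1), (1, 1)] j 0 = 0) : evData F 4 c = 0 := by
  rw [eq_zero_of_tupleCoeff hc h, map_zero]
  intro y k j hy hk
  obtain ⟨rfl, rfl⟩ := tuple_four hy hk
  rw [← evData_point hc h]
  · refine Eq.trans ?_ (h0 j)
    refine congrFun (congrFun (congrArg _ ?_) j) 0
    funext i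
    fin_cases i <;> simp [point]
  · intro i
    fin_cases i
    · simp
    · exact Or.inr ⟨rfl, 0, rfl⟩
    · simp
    · exact Or.inr ⟨rfl, 2, rfl⟩
  · rfl

theorem eq_zero_of_other [CharZero F] {c : CochainData F q} (hc : HasWeightZero c)
    (h : evData F q c ∈ skew F (F × Fin 2) (Fin 2 → F → F) q) (hq : q < 2 ∨ 4 < q) :
    evData F q c = 0 := by
  rw [eq_zero_of_tupleCoeff hc h, map_zero]
  intro y k j hy hk
  have := le_four_of_injective (Function.Injective.of_comp hy.injective) hk
  omega

end Classification

end W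

/-! ### Explicit differentials and the finite weight-zero complex -/

namespace BasisAction

open FunCochain

variable {F Y V : Type*} [Field F] [AddCommGroup V] [Module F V] (𝔤 : BasisAction F Y V)

theorem diff_zero_vec (Φ : FunCochain Y V 0) (x : Y) : 𝔤.diff 0 Φ ![x] = 𝔤.ρ x (Φ ![]) := by
  change 𝔤.lie x Φ _ = _
  rw [lie_apply, Finset.univ_eq_empty, Finset.sum_empty, sub_zero]
  congr 2

theorem diff_one_vec (Φ : FunCochain Y V 1) (x y : Y) : 𝔤.diff 1 Φ ![x, y] =
    𝔤.ρ x (Φ ![y]) - 𝔤.c x y • Φ ![𝔤.m x y] - 𝔤.ρ y (Φ ![x]) := by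
  have h : 𝔤.diff 1 Φ ![x, y] = 𝔤.lie x Φ ![y] - 𝔤.diff 0 (ins F V x Φ) ![y] := rfl
  have h0 : Function.update ![y] 0 (𝔤.m x y) = ![𝔤.m x y] := by
    funext i; fin_cases i; rfl
  rw [h, diff_zero_vec, lie_apply, Fin.sum_univ_one]
  simp only [Matrix.cons_val_zero, h0]
  rfl

theorem diff_two_vec (Φ : FunCochain Y V 2) (x y z : Y) : 𝔤.diff 2 Φ ![x, y, z] =
    𝔤.ρ x (Φ ![y, z]) - (𝔤.c x y • Φ ![𝔤.m x y, z] + 𝔤.c x z • Φ ![y, 𝔤.m x z]) -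
      (𝔤.ρ y (Φ ![x, z]) - 𝔤.c y z • Φ ![x, 𝔤.m y z] - 𝔤.ρ z (Φ ![x, y])) := by
  have h : 𝔤.diff 2 Φ ![x, y, z] = 𝔤.lie x Φ ![y, z] - 𝔤.diff 1 (ins F V x Φ) ![y, z] := rfl
  have h0 : Function.update ![y, z] 0 (𝔤.m x y) = ![𝔤.m x y, z] := by
    funext i; fin_cases i <;> rfl
  have h1 : Function.update ![y, z] 1 (𝔤.m x z) = ![y, 𝔤.m x z] := by
    funext i; fin_cases i <;> rfl
  rw [h, diff_one_vec, lie_apply, Fin.sum_univ_two]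
  simp only [Matrix.cons_val_zero, Matrix.cons_val_one, h0, h1]
  rfl

theorem diff_three_vec (Φ : FunCochain Y V 3) (x y z w : Y) : 𝔤.diff 3 Φ ![x, y, z, w] =
    𝔤.ρ x (Φ ![y, z, w]) - (𝔤.c x y • Φ ![𝔤.m x y, z, w] + 𝔤.c x z • Φ ![y, 𝔤.m x z, w] +
      𝔤.c x w • Φ ![y, z, 𝔤.m x w]) -
    (𝔤.ρ y (Φ ![x, z, w]) - (𝔤.c y z • Φ ![x, 𝔤.m y z, w] + 𝔤.c y w • Φ ![x, z, 𝔤.m y w]) -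
      (𝔤.ρ z (Φ ![x, y, w]) - 𝔤.c z w • Φ ![x, y, 𝔤.m z w] - 𝔤.ρ w (Φ ![x, y, z]))) := by
  have h : 𝔤.diff 3 Φ ![x, y, z, w] =
      𝔤.lie x Φ ![y, z, w] - 𝔤.diff 2 (ins F V x Φ) ![y, z, w] := rfl
  have h0 : Function.update ![y, z, w] 0 (𝔤.m x y) = ![𝔤.m x y, z, w] := by
    funext i; fin_cases i <;> rfl
  have h1 : Function.update ![y, z, w] 1 (𝔤.m x z) = ![y, 𝔤.m x z, w] := by
    funext i; fin_cases i <;> rfl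
  have h2 : Function.update ![y, z, w] 2 (𝔤.m x w) = ![y, z, 𝔤.m x w] := by
    funext i; fin_cases i <;> rfl
  rw [h, diff_two_vec, lie_apply, Fin.sum_univ_three]
  simp only [Matrix.cons_val_zero, Matrix.cons_val_one, Matrix.cons_val_two, Matrix.tail_cons,
    Matrix.head_cons, h0, h1, h2]
  rfl

end BasisAction

namespace W

open FunCochain

variable {F : Type*} [Field F] {q : ℕ}

/-- The determinant of the functions `[s = (z k).1] λ ^ (z k).2`. -/
def detFun (z : Fin q → Fin 2 × ℕ) (a : Fin q → F × Fin 2) : F :=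
  Matrix.det (Matrix.of fun i k => if (a i).2 = (z k).1 then (a i).1 ^ (z k).2 else 0)

variable (F) in
/-- The cochain with the values `detFun z` in the component `j₀`. -/
def detData (z : Fin q → Fin 2 × ℕ) (j₀ : Fin 2) : CochainData F q := fun s j =>
  if j = j₀ then Matrix.det (Matrix.of fun i k =>
    if s i = (z k).1 then (MvPolynomial.X i.castSucc : MvPolynomial (Fin (q + 1)) F) ^ (z k).2
    else 0) else 0

theorem evData_detData (z : Fin q → Fin 2 × ℕ) (j₀ j : Fin 2) (a : Fin q → F × Fin 2) (x : F) :
    evData F q (detData F z j₀) a j x = if j = j₀ then detFun z a else 0 := by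
  rw [evData_apply, detData, detFun]
  split_ifs
  · rw [RingHom.map_det]
    congr 1
    ext i k
    simp only [RingHom.mapMatrix_apply, Matrix.map_apply, Matrix.of_apply]
    split_ifs <;> simp
  · simp

theorem detData_mem_skew (z : Fin q → Fin 2 × ℕ) (j₀ : Fin 2) :
    evData F q (detData F z j₀) ∈ skew F (F × Fin 2) (Fin 2 → F → F) q := by
  intro σ a
  funext j x
  rw [Pi.smul_apply, Pi.smul_apply, evData_detData, evData_detData]
  split_ifs
  · rw [zsmul_eq_mul, detFun, detFun, ← Matrix.det_permute]
    rfl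
  · simp

/-- Scaling by `t` multiplies the column `k` of the determinant by `t ^ (z k).2`. -/
theorem detData_isHomogeneous [Infinite F] (z : Fin q → Fin 2 × ℕ) (j₀ : Fin 2) (s : Fin q → Fin 2)
    (j : Fin 2) : (detData F z j₀ s j).IsHomogeneous (∑ k, (z k).2) := by
  refine isHomogeneous_of_scale (fun t _ => ?_) s j
  funext a j x
  rw [Pi.smul_apply, Pi.smul_apply, Pi.smul_apply, scale_apply, evData_detData, evData_detData]
  split_ifs
  · rw [smul_eq_mul, ← Finset.prod_pow_eq_pow_sum, detFun, detFun, ← Matrix.det_mul_row]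
    congr 1
    ext i k
    simp only [Matrix.of_apply, mul_ite, mul_zero, mul_pow]
  · simp

theorem hasWeightZero_of_isHomogeneous {c : CochainData F q} {n : ℕ}
    (h : ∀ s j, (c s j).IsHomogeneous n) (hn : n + 2 = q) : HasWeightZero c := by
  intro s j e he
  refine Eq.trans ?_ hn
  rw [Nat.add_right_cancel_iff]
  by_contra hd
  exact he ((h s j).coeff_eq_zero hd)

theorem HasWeightZero.isHomogeneous {c : CochainData F q} {n : ℕ}
    (h : HasWeightZero c) (hn : n + 2 = q) (s : Fin q → Fin 2) (j : Fin 2) :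
    (c s j).IsHomogeneous n := by
  intro e he
  have := h s j e he
  have hw : Finsupp.weight 1 e = e.degree := by
    rw [Finsupp.degree_eq_weight_one]; rfl
  rw [hw]
  exact Nat.add_right_cancel (this.trans hn.symm)

theorem HasWeightZero.add {c c' : CochainData F q} (h : HasWeightZero c) (h' : HasWeightZero c') :
    HasWeightZero (c + c') := by
  intro s j e he
  by_contra hd
  have h1 : (c s j).coeff e = 0 := by_contra fun hc => hd (h s j e hc)
  have h2 : (c' s j).coeff e = 0 := by_contra fun hc => hd (h' s j e hc)
  exact he (by rw [Pi.add_apply, Pi.add_apply, MvPolynomial.coeff_add, h1, h2, add_zero])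

theorem HasWeightZero.smul {c : CochainData F q} (h : HasWeightZero c) (r : F) :
    HasWeightZero (r • c) := by
  intro s j e he
  rw [Pi.smul_apply, Pi.smul_apply, MvPolynomial.coeff_smul] at he
  exact h s j e (right_ne_zero_of_smul he)

theorem HasWeightZero.sub {c c' : CochainData F q} (h : HasWeightZero c) (h' : HasWeightZero c') :
    HasWeightZero (c - c') := by
  rw [sub_eq_add_neg, ← neg_one_smul F c']
  exact h.add (h'.smul _)

theorem hasWeightZero_detData [Infinite F] (z : Fin q → Fin 2 × ℕ) (j₀ : Fin 2)
    (hz : ∑ k, (z k).2 + 2 = q) : HasWeightZero (detData F z j₀) :=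
  hasWeightZero_of_isHomogeneous (detData_isHomogeneous z j₀) hz

/-- The data of the differential. -/
def diffData (c : CochainData F q) : CochainData F (q + 1) :=
  data (d (W (-1)).adjoint q (ofPoly c))

theorem evData_diffData [Infinite F] {c : CochainData F q}
    (h : evData F q c ∈ skew F (F × Fin 2) (Fin 2 → F → F) q) :
    evData F (q + 1) (diffData c) = (expAction F).diff q (evData F q c) := by
  rw [diffData, evData_data, ev_d (ofPoly_mem_basicCochains h), ev_ofPoly]

/-- The differential raises both the degree and `q` by one. The bound `2 ≤ q` makes `q - 2` an
honest degree. -/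
theorem hasWeightZero_diffData [Infinite F] {c : CochainData F q}
    (h : evData F q c ∈ skew F (F × Fin 2) (Fin 2 → F → F) q) (hc : HasWeightZero c) (hq : 2 ≤ q) :
    HasWeightZero (diffData c) := by
  obtain ⟨n, rfl⟩ := Nat.exists_eq_add_of_le' hq
  refine hasWeightZero_of_isHomogeneous (n := n + 1) (isHomogeneous_of_scale fun t ht => ?_)
    (by ring)
  rw [evData_diffData h, ← diff_scale, scale_evData_of_isHomogeneous (hc.isHomogeneous rfl),
    map_smul, smul_smul, pow_succ']

theorem evData_diffData_mem_skew [Infinite F] {c : CochainData F q}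
    (h : evData F q c ∈ skew F (F × Fin 2) (Fin 2 → F → F) q) :
    evData F (q + 1) (diffData c) ∈ skew F (F × Fin 2) (Fin 2 → F → F) (q + 1) := by
  rw [evData_diffData h]
  exact BasisAction.diff_mem_skew _ h

section Values

variable (F) in
/-- The cochain `L ⊗ H ↦ g_j`. -/
def u2 (j : Fin 2) : CochainData F 2 := detData F ![(0, 0), (1, 0)] j

variable (F) in
/-- The cochain `L ⊗ L ⊗ H ↦ (λ₂ - λ₁) g_j`. -/
def u3 (j : Fin 2) : CochainData F 3 := detData F ![(0, 0), (0, 1), (1, 0)] j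

variable (F) in
/-- The cochain `L ⊗ H ⊗ H ↦ (λ₃ - λ₂) g_j`. -/
def v3 (j : Fin 2) : CochainData F 3 := detData F ![(0, 0), (1, 0), (1, 1)] j

variable (F) in
/-- The cochain `L ⊗ L ⊗ H ⊗ H ↦ (λ₁ - λ₂) (λ₃ - λ₄) g_j`. -/
def u4 (j : Fin 2) : CochainData F 4 := detData F ![(0, 0), (0, 1), (1, 0), (1, 1)] j

theorem detFun_two (a b : F × Fin 2) : detFun ![(0, 0), (1, 0)] ![a, b] =
    (if a.2 = 0 ∧ b.2 = 1 then 1 else 0) - (if a.2 = 1 ∧ b.2 = 0 then 1 else 0) := by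
  obtain ⟨a, i⟩ := a
  obtain ⟨b, k⟩ := b
  rw [detFun, Matrix.det_fin_two]
  fin_cases i <;> fin_cases k <;> simp

theorem detFun_three (z : Fin 3 → Fin 2 × ℕ) (a b c : F × Fin 2) :
    detFun z ![a, b, c] = Matrix.det
    !![if a.2 = (z 0).1 then a.1 ^ (z 0).2 else 0, if a.2 = (z 1).1 then a.1 ^ (z 1).2 else 0,
        if a.2 = (z 2).1 then a.1 ^ (z 2).2 else 0;
      if b.2 = (z 0).1 then b.1 ^ (z 0).2 else 0, if b.2 = (z 1).1 then b.1 ^ (z 1).2 else 0,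
        if b.2 = (z 2).1 then b.1 ^ (z 2).2 else 0;
      if c.2 = (z 0).1 then c.1 ^ (z 0).2 else 0, if c.2 = (z 1).1 then c.1 ^ (z 1).2 else 0,
        if c.2 = (z 2).1 then c.1 ^ (z 2).2 else 0] := by
  rw [detFun]
  congr 1
  ext i k
  fin_cases i <;> fin_cases k <;> rfl

theorem diff_u2 (j₀ j : Fin 2) :
    (expAction F).diff 2 (evData F 2 (u2 F j₀)) ![(0, 0), (1, 0), (0, 1)] j 0 = 0 := by
  rw [BasisAction.diff_two_vec]
  fin_cases j₀ <;> fin_cases j <;>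
    simp [expAction, evData_detData, u2, detFun_two] <;> norm_num

/-- For `j₀ = 0` and `j = 1`, only the action of an `H` carries a value in the component `L` to the
component `H`. At `∂ = 0` the `H` with `λ = 0` acts by zero there, and the one with `λ = 1`
contributes `∂ + 2λ = 2`. -/
theorem diff_u2' (j₀ j : Fin 2) :
    (expAction F).diff 2 (evData F 2 (u2 F j₀)) ![(0, 0), (0, 1), (1, 1)] j 0 =
      if j₀ = 0 ∧ j = 1 then 2 else 0 := by
  rw [BasisAction.diff_two_vec]
  fin_cases j₀ <;> fin_cases j <;>
    simp [expAction, evData_detData, u2, detFun_two]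

/-- The factor `2` comes again from the last argument `(1, H)`; its action term carries a minus sign
in the fourth place. -/
theorem diff_u3 (j₀ j : Fin 2) :
    (expAction F).diff 3 (evData F 3 (u3 F j₀)) ![(0, 0), (1, 0), (0, 1), (1, 1)] j 0 =
      if j₀ = 0 ∧ j = 1 then -2 else 0 := by
  rw [BasisAction.diff_three_vec]
  fin_cases j₀ <;> fin_cases j <;>
    simp [expAction, evData_detData, u3, detFun_three, Matrix.det_fin_three]

theorem diff_v3 (j₀ j : Fin 2) :
    (expAction F).diff 3 (evData F 3 (v3 F j₀)) ![(0, 0), (1, 0), (0, 1), (1, 1)] j 0 = 0 := by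
  rw [BasisAction.diff_three_vec]
  fin_cases j₀ <;> fin_cases j <;>
    simp [expAction, evData_detData, v3, detFun_three, Matrix.det_fin_three] <;> norm_num

theorem evData_u2_point (j₀ j : Fin 2) :
    evData F 2 (u2 F j₀) ![(0, 0), (0, 1)] j 0 = if j = j₀ then 1 else 0 := by
  rw [u2, evData_detData, detFun_two]
  simp

theorem evData_u3_point (j₀ j : Fin 2) :
    evData F 3 (u3 F j₀) ![(0, 0), (1, 0), (0, 1)] j 0 = if j = j₀ then 1 else 0 := by
  rw [u3, evData_detData, detFun_three, Matrix.det_fin_three]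
  simp

theorem evData_u3_point' (j₀ j : Fin 2) :
    evData F 3 (u3 F j₀) ![(0, 0), (0, 1), (1, 1)] j 0 = 0 := by
  rw [u3, evData_detData, detFun_three, Matrix.det_fin_three]
  simp

theorem evData_v3_point (j₀ j : Fin 2) :
    evData F 3 (v3 F j₀) ![(0, 0), (1, 0), (0, 1)] j 0 = 0 := by
  rw [v3, evData_detData, detFun_three, Matrix.det_fin_three]
  simp

theorem evData_v3_point' (j₀ j : Fin 2) :
    evData F 3 (v3 F j₀) ![(0, 0), (0, 1), (1, 1)] j 0 = if j = j₀ then 1 else 0 := by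
  rw [v3, evData_detData, detFun_three, Matrix.det_fin_three]
  simp

theorem evData_u4_point (j₀ j : Fin 2) :
    evData F 4 (u4 F j₀) ![(0, 0), (1, 0), (0, 1), (1, 1)] j 0 = if j = j₀ then 1 else 0 := by
  rw [u4, evData_detData, detFun]
  simp [Matrix.det_succ_row_zero, Fin.sum_univ_succ, Fin.succAbove]

theorem u2_mem_skew (j₀ : Fin 2) :
    evData F 2 (u2 F j₀) ∈ skew F (F × Fin 2) (Fin 2 → F → F) 2 := detData_mem_skew _ _

theorem u3_mem_skew (j₀ : Fin 2) :
    evData F 3 (u3 F j₀) ∈ skew F (F × Fin 2) (Fin 2 → F → F) 3 := detData_mem_skew _ _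

theorem v3_mem_skew (j₀ : Fin 2) :
    evData F 3 (v3 F j₀) ∈ skew F (F × Fin 2) (Fin 2 → F → F) 3 := detData_mem_skew _ _

theorem u4_mem_skew (j₀ : Fin 2) :
    evData F 4 (u4 F j₀) ∈ skew F (F × Fin 2) (Fin 2 → F → F) 4 := detData_mem_skew _ _

variable [CharZero F]

theorem hasWeightZero_u2 (j₀ : Fin 2) : HasWeightZero (u2 F j₀) := hasWeightZero_detData _ _ rfl

theorem hasWeightZero_u3 (j₀ : Fin 2) : HasWeightZero (u3 F j₀) := hasWeightZero_detData _ _ rfl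

theorem hasWeightZero_v3 (j₀ : Fin 2) : HasWeightZero (v3 F j₀) := hasWeightZero_detData _ _ rfl

theorem hasWeightZero_u4 (j₀ : Fin 2) : HasWeightZero (u4 F j₀) := hasWeightZero_detData _ _ rfl

/-- The differential is again skew of weight zero, so evaluating it at the two distinguished points
of degree three decides the identity. The other differentials of basis elements are found in the
same way. -/
theorem diff_evData_u2_one : (expAction F).diff 2 (evData F 2 (u2 F 1)) = 0 := by
  rw [← evData_diffData (u2_mem_skew 1)]
  refine eq_zero_of_three (hasWeightZero_diffData (u2_mem_skew 1) (hasWeightZero_u2 1) le_rfl)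
    (evData_diffData_mem_skew (u2_mem_skew 1)) (fun j => ?_) (fun j => ?_)
  · rw [evData_diffData (u2_mem_skew 1), diff_u2]
  · rw [evData_diffData (u2_mem_skew 1), diff_u2']
    simp

theorem diff_evData_u2_zero :
    (expAction F).diff 2 (evData F 2 (u2 F 0)) = (2 : F) • evData F 3 (v3 F 1) := by
  rw [← evData_diffData (u2_mem_skew 0), ← map_smul, ← sub_eq_zero, ← map_sub]
  refine eq_zero_of_three
    ((hasWeightZero_diffData (u2_mem_skew 0) (hasWeightZero_u2 0) le_rfl).sub
      ((hasWeightZero_v3 1).smul 2)) ?_ (fun j => ?_) (fun j => ?_)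
  · rw [map_sub, map_smul]
    exact Submodule.sub_mem _ (evData_diffData_mem_skew (u2_mem_skew 0))
      (Submodule.smul_mem _ _ (v3_mem_skew 1))
  · simp [evData_diffData (u2_mem_skew 0), diff_u2, evData_v3_point]
  · simp [evData_diffData (u2_mem_skew 0), diff_u2', evData_v3_point']

theorem diff_evData_u3_one : (expAction F).diff 3 (evData F 3 (u3 F 1)) = 0 := by
  rw [← evData_diffData (u3_mem_skew 1)]
  refine eq_zero_of_four
    (hasWeightZero_diffData (u3_mem_skew 1) (hasWeightZero_u3 1) (by norm_num))
    (evData_diffData_mem_skew (u3_mem_skew 1)) (fun j => ?_)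
  rw [evData_diffData (u3_mem_skew 1), diff_u3]
  simp

theorem diff_evData_v3 (j₀ : Fin 2) : (expAction F).diff 3 (evData F 3 (v3 F j₀)) = 0 := by
  rw [← evData_diffData (v3_mem_skew j₀)]
  refine eq_zero_of_four
    (hasWeightZero_diffData (v3_mem_skew j₀) (hasWeightZero_v3 j₀) (by norm_num))
    (evData_diffData_mem_skew (v3_mem_skew j₀)) (fun j => ?_)
  rw [evData_diffData (v3_mem_skew j₀), diff_v3]

theorem diff_evData_u3_zero :
    (expAction F).diff 3 (evData F 3 (u3 F 0)) = (-2 : F) • evData F 4 (u4 F 1) := by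
  rw [← evData_diffData (u3_mem_skew 0), ← map_smul, ← sub_eq_zero, ← map_sub]
  refine eq_zero_of_four
    ((hasWeightZero_diffData (u3_mem_skew 0) (hasWeightZero_u3 0) (by norm_num)).sub
      ((hasWeightZero_u4 1).smul (-2))) ?_ (fun j => ?_)
  · rw [map_sub, map_smul]
    exact Submodule.sub_mem _ (evData_diffData_mem_skew (u3_mem_skew 0))
      (Submodule.smul_mem _ _ (u4_mem_skew 1))
  · simp [evData_diffData (u3_mem_skew 0), diff_u3, evData_u4_point]
    split_ifs <;> simp

theorem diff_evData_u4 (j₀ : Fin 2) : (expAction F).diff 4 (evData F 4 (u4 F j₀)) = 0 := by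
  rw [← evData_diffData (u4_mem_skew j₀)]
  exact eq_zero_of_other
    (hasWeightZero_diffData (u4_mem_skew j₀) (hasWeightZero_u4 j₀) (by norm_num))
    (evData_diffData_mem_skew (u4_mem_skew j₀)) (Or.inr (by norm_num))

theorem eq_u2_of_hasWeightZero {c : CochainData F 2} (hc : HasWeightZero c)
    (h : evData F 2 c ∈ skew F (F × Fin 2) (Fin 2 → F → F) 2) :
    ∃ r : Fin 2 → F, evData F 2 c = r 0 • evData F 2 (u2 F 0) + r 1 • evData F 2 (u2 F 1) := by
  -- The values at the distinguished point are the coordinates, since `u2 0` and `u2 1` take the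
  -- unit vectors as values there.
  refine ⟨fun j => evData F 2 c ![(0, 0), (0, 1)] j 0, ?_⟩
  rw [← sub_eq_zero, ← map_smul, ← map_smul, ← map_add, ← map_sub]
  refine eq_zero_of_two (hc.sub (((hasWeightZero_u2 0).smul _).add ((hasWeightZero_u2 1).smul _)))
    ?_ fun j => ?_
  · simp only [map_sub, map_add, map_smul]
    exact Submodule.sub_mem _ h (Submodule.add_mem _ (Submodule.smul_mem _ _ (u2_mem_skew 0))
      (Submodule.smul_mem _ _ (u2_mem_skew 1)))
  · simp only [map_sub, map_add, map_smul, Pi.sub_apply, Pi.add_apply, Pi.smul_apply, smul_eq_mul,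
      evData_u2_point]
    fin_cases j <;> simp

theorem eq_u3_v3_of_hasWeightZero {c : CochainData F 3} (hc : HasWeightZero c)
    (h : evData F 3 c ∈ skew F (F × Fin 2) (Fin 2 → F → F) 3) :
    ∃ r r' : Fin 2 → F, evData F 3 c = r 0 • evData F 3 (u3 F 0) + r 1 • evData F 3 (u3 F 1) +
      (r' 0 • evData F 3 (v3 F 0) + r' 1 • evData F 3 (v3 F 1)) := by
  refine ⟨fun j => evData F 3 c ![(0, 0), (1, 0), (0, 1)] j 0,
    fun j => evData F 3 c ![(0, 0), (0, 1), (1, 1)] j 0, ?_⟩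
  rw [← sub_eq_zero]
  simp only [← map_smul, ← map_add, ← map_sub]
  refine eq_zero_of_three
    (hc.sub ((((hasWeightZero_u3 0).smul _).add ((hasWeightZero_u3 1).smul _)).add
      (((hasWeightZero_v3 0).smul _).add ((hasWeightZero_v3 1).smul _))))
    ?_ (fun j => ?_) (fun j => ?_)
  · simp only [map_sub, map_add, map_smul]
    exact Submodule.sub_mem _ h (Submodule.add_mem _
      (Submodule.add_mem _ (Submodule.smul_mem _ _ (u3_mem_skew 0))
        (Submodule.smul_mem _ _ (u3_mem_skew 1)))
      (Submodule.add_mem _ (Submodule.smul_mem _ _ (v3_mem_skew 0))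
        (Submodule.smul_mem _ _ (v3_mem_skew 1))))
  · simp only [map_sub, map_add, map_smul, Pi.sub_apply, Pi.add_apply, Pi.smul_apply, smul_eq_mul,
      evData_u3_point, evData_v3_point]
    fin_cases j <;> simp
  · simp only [map_sub, map_add, map_smul, Pi.sub_apply, Pi.add_apply, Pi.smul_apply, smul_eq_mul,
      evData_u3_point', evData_v3_point']
    fin_cases j <;> simp

theorem eq_u4_of_hasWeightZero {c : CochainData F 4} (hc : HasWeightZero c)
    (h : evData F 4 c ∈ skew F (F × Fin 2) (Fin 2 → F → F) 4) :
    ∃ r : Fin 2 → F, evData F 4 c = r 0 • evData F 4 (u4 F 0) + r 1 • evData F 4 (u4 F 1) := by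
  refine ⟨fun j => evData F 4 c ![(0, 0), (1, 0), (0, 1), (1, 1)] j 0, ?_⟩
  rw [← sub_eq_zero, ← map_smul, ← map_smul, ← map_add, ← map_sub]
  refine eq_zero_of_four (hc.sub (((hasWeightZero_u4 0).smul _).add ((hasWeightZero_u4 1).smul _)))
    ?_ fun j => ?_
  · simp only [map_sub, map_add, map_smul]
    exact Submodule.sub_mem _ h (Submodule.add_mem _ (Submodule.smul_mem _ _ (u4_mem_skew 0))
      (Submodule.smul_mem _ _ (u4_mem_skew 1)))
  · simp only [map_sub, map_add, map_smul, Pi.sub_apply, Pi.add_apply, Pi.smul_apply, smul_eq_mul,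
      evData_u4_point]
    fin_cases j <;> simp

end Values

end W

/-! ### Bases of a subspace modulo another one -/

/-- The elements `e i` of `Z` represent a basis of `Z` modulo `B`. -/
structure IsRelBasis {F U : Type*} [Field F] [AddCommGroup U] [Module F U] (Z B : Submodule F U)
    {n : ℕ} (e : Fin n → U) : Prop where
  mem : ∀ i, e i ∈ Z
  indep : ∀ g : Fin n → F, ∑ i, g i • e i ∈ B → g = 0
  span : ∀ z ∈ Z, ∃ g : Fin n → F, z - ∑ i, g i • e i ∈ B

namespace IsRelBasis

variable {F U U' : Type*} [Field F] [AddCommGroup U] [Module F U] [AddCommGroup U'] [Module F U']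
  {Z B : Submodule F U} {n : ℕ} {e : Fin n → U}

theorem exists_basis (h : IsRelBasis Z B e) : ∃ b : Module.Basis (Fin n) F (Z ⧸ B.submoduleOf Z),
    ∀ i, b i = Submodule.Quotient.mk ⟨e i, h.mem i⟩ := by
  let v : Fin n → Z ⧸ B.submoduleOf Z := fun i => Submodule.Quotient.mk ⟨e i, h.mem i⟩
  have hv : ∀ g : Fin n → F, ∑ i, g i • v i =
      Submodule.Quotient.mk ⟨∑ i, g i • e i,
        Submodule.sum_mem _ fun i _ => Submodule.smul_mem _ _ (h.mem i)⟩ := by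
    intro g
    have : (⟨∑ i, g i • e i, Submodule.sum_mem _ fun i _ => Submodule.smul_mem _ _ (h.mem i)⟩ : Z)
        = ∑ i, g i • ⟨e i, h.mem i⟩ := Subtype.ext (by simp)
    rw [this, ← Submodule.mkQ_apply, map_sum]
    exact Finset.sum_congr rfl fun i _ => (map_smul (B.submoduleOf Z).mkQ (g i) _).symm
  have hli : LinearIndependent F v := by
    rw [Fintype.linearIndependent_iff]
    intro g hg i
    rw [hv, Submodule.Quotient.mk_eq_zero] at hg
    exact congrFun (h.indep g hg) i
  have hsp : ⊤ ≤ Submodule.span F (Set.range v) := by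
    intro x _
    obtain ⟨⟨z, hz⟩, rfl⟩ := Submodule.Quotient.mk_surjective _ x
    obtain ⟨g, hg⟩ := h.span z hz
    have : (Submodule.Quotient.mk ⟨z, hz⟩ : Z ⧸ B.submoduleOf Z) = ∑ i, g i • v i := by
      rw [hv, Submodule.Quotient.eq]
      exact hg
    rw [this]
    exact Submodule.sum_mem _ fun i _ =>
      Submodule.smul_mem _ _ (Submodule.subset_span ⟨i, rfl⟩)
  exact ⟨Module.Basis.mk hli hsp, fun i => by rw [Module.Basis.mk_apply]⟩

/-- Surjectivity of `T` is not needed: the images of the `e i` already span `Z'` modulo `B'`, and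
`B` contains every element of `Z` that is mapped into `B'`. -/
theorem of_map {Z' B' : Submodule F U'} (T : U →ₗ[F] U') (h : IsRelBasis Z' B' fun i => T (e i))
    (hZ : ∀ u ∈ Z, T u ∈ Z') (he : ∀ i, e i ∈ Z) (hB : ∀ u ∈ B, T u ∈ B')
    (hB' : ∀ u ∈ Z, T u ∈ B' → u ∈ B) : IsRelBasis Z B e where
  mem := he
  indep g hg := h.indep g (by simpa using hB _ hg)
  span z hz := by
    obtain ⟨g, hg⟩ := h.span _ (hZ z hz)
    refine ⟨g, hB' _ (Submodule.sub_mem _ hz (Submodule.sum_mem _ fun i _ =>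
      Submodule.smul_mem _ _ (he i))) ?_⟩
    simpa using hg

theorem congr_mod {e' : Fin n → U} (h : IsRelBasis Z B e) (he' : ∀ i, e' i ∈ Z)
    (hB : ∀ i, e' i - e i ∈ B) : IsRelBasis Z B e' where
  mem := he'
  indep g hg := h.indep g (by
    have : ∑ i, g i • e i = ∑ i, g i • e' i - ∑ i, g i • (e' i - e i) := by
      simp [smul_sub]
    rw [this]
    exact Submodule.sub_mem _ hg
      (Submodule.sum_mem _ fun i _ => Submodule.smul_mem _ _ (hB i)))
  span z hz := by
    obtain ⟨g, hg⟩ := h.span z hz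
    refine ⟨g, ?_⟩
    have : z - ∑ i, g i • e' i = z - ∑ i, g i • e i - ∑ i, g i • (e' i - e i) := by
      simp [smul_sub]
    rw [this]
    exact Submodule.sub_mem _ hg
      (Submodule.sum_mem _ fun i _ => Submodule.smul_mem _ _ (hB i))

end IsRelBasis

/-! ### From basic to reduced cohomology, and transfer to conformal cochains -/

namespace W

open FunCochain

variable {F : Type*} [Field F] {q : ℕ}

variable (F q) in
/-- The cochains of the basic complex as functions. -/
def polyCochains : Submodule F (FunCochain (F × Fin 2) (Fin 2 → F → F) q) :=
  LinearMap.range (evData F q) ⊓ skew F (F × Fin 2) (Fin 2 → F → F) q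

variable (F q) in
/-- The operator `∂` on cochains as functions. -/
abbrev partialFun : FunCochain (F × Fin 2) (Fin 2 → F → F) q →ₗ[F]
    FunCochain (F × Fin 2) (Fin 2 → F → F) q := (expAction F).lie (0, 0)

theorem ev_mem_polyCochains [Infinite F] {b : F} {f : PolyMap F (WSpace F) (WSpace F) q}
    (h : f ∈ basicCochains (W b) (WSpace F) q) : ev F q f ∈ polyCochains F q :=
  ⟨⟨data f, evData_data f⟩, (mem_basicCochains_iff.1 h).2⟩

theorem exists_ev_eq [Infinite F] {Φ : FunCochain (F × Fin 2) (Fin 2 → F → F) q}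
    (h : Φ ∈ polyCochains F q) :
    ∃ f ∈ basicCochains (W (-1 : F)) (WSpace F) q, ev F q f = Φ := by
  obtain ⟨⟨c, rfl⟩, hs⟩ := h
  exact ⟨ofPoly c, ofPoly_mem_basicCochains hs, ev_ofPoly c⟩

theorem diff_mem_polyCochains [Infinite F] {Φ : FunCochain (F × Fin 2) (Fin 2 → F → F) q}
    (h : Φ ∈ polyCochains F q) : (expAction F).diff q Φ ∈ polyCochains F (q + 1) := by
  obtain ⟨⟨c, rfl⟩, hs⟩ := h
  exact ⟨⟨diffData c, evData_diffData hs⟩, BasisAction.diff_mem_skew _ hs⟩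

theorem ins_zero_evData (c : CochainData F (q + 1)) :
    ins F (Fin 2 → F → F) (0, 0) (evData F (q + 1) c) = evData F q (insData 0 c) := by
  obtain ⟨N, hN⟩ := exists_degree_bound c
  have hN' : ∀ s j, (c s j).totalDegree < N + 1 := fun s j => by have := hN s j; omega
  rw [ins_evData hN', Finset.sum_range_succ']
  simp

theorem ins_mem_polyCochains {Φ : FunCochain (F × Fin 2) (Fin 2 → F → F) (q + 1)}
    (h : Φ ∈ polyCochains F (q + 1)) :
    ins F (Fin 2 → F → F) (0, 0) Φ ∈ polyCochains F q := by
  obtain ⟨⟨c, rfl⟩, hs⟩ := h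
  exact ⟨⟨insData 0 c, (ins_zero_evData c).symm⟩, ins_mem_skew hs _⟩

theorem partialFun_apply (Φ : FunCochain (F × Fin 2) (Fin 2 → F → F) q) (a : Fin q → F × Fin 2)
    (j : Fin 2) (x : F) : partialFun F q Φ a j x = (x + ∑ i, (a i).1) * Φ a j x := by
  rw [BasisAction.lie_apply]
  simp [expAction, add_mul, Finset.sum_mul]

theorem partialFun_evData (c : CochainData F q) :
    partialFun F q (evData F q c) = evData F q fun s j => (∑ i, MvPolynomial.X i) * c s j := by
  funext a j x
  rw [partialFun_apply, evData_apply, evData_apply, map_mul, map_sum]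
  simp [Fin.sum_univ_castSucc, add_comm]

theorem partialFun_mem_polyCochains {Φ : FunCochain (F × Fin 2) (Fin 2 → F → F) q}
    (h : Φ ∈ polyCochains F q) : partialFun F q Φ ∈ polyCochains F q := by
  obtain ⟨⟨c, rfl⟩, hs⟩ := h
  exact ⟨⟨_, (partialFun_evData c).symm⟩, BasisAction.lie_mem_skew _ hs _⟩

/-- On data, `∂` is multiplication by the nonzero polynomial `λ₁ + ⋯ + λ_q + ∂` in an integral
domain. -/
theorem eq_zero_of_partialFun_eq_zero [Infinite F]
    {Φ : FunCochain (F × Fin 2) (Fin 2 → F → F) q} (h : Φ ∈ polyCochains F q)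
    (h0 : partialFun F q Φ = 0) : Φ = 0 := by
  obtain ⟨⟨c, rfl⟩, hs⟩ := h
  rw [partialFun_evData, ← map_zero (evData F q)] at h0
  have := evData_injective h0
  have hX : (∑ i, MvPolynomial.X i : MvPolynomial (Fin (q + 1)) F) ≠ 0 := by
    intro hX
    have := congrArg (MvPolynomial.eval (Pi.single (Fin.last q) (1 : F))) hX
    simp [Pi.single_apply] at this
  have hc : c = 0 := by
    funext s j
    exact (mul_eq_zero.1 (congrFun (congrFun this s) j)).resolve_left hX
  rw [hc, map_zero]

variable (F) in
/-- The cocycles of the basic complex as functions. -/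
def cocyclesFun (q : ℕ) : Submodule F (FunCochain (F × Fin 2) (Fin 2 → F → F) q) :=
  polyCochains F q ⊓ LinearMap.ker ((expAction F).diff q)

variable (F) in
/-- The coboundaries of the basic complex as functions. -/
def coboundariesFun : (q : ℕ) → Submodule F (FunCochain (F × Fin 2) (Fin 2 → F → F) q)
  | 0 => ⊥
  | q + 1 => (polyCochains F q).map ((expAction F).diff q)

variable (F) in
/-- The representatives of the cocycles of the reduced complex as functions. -/
def redCocyclesFun (q : ℕ) : Submodule F (FunCochain (F × Fin 2) (Fin 2 → F → F) q) :=
  polyCochains F q ⊓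
    ((polyCochains F (q + 1)).map (partialFun F (q + 1))).comap ((expAction F).diff q)

variable (F) in
/-- The representatives of the coboundaries of the reduced complex as functions. -/
def redCoboundariesFun (q : ℕ) : Submodule F (FunCochain (F × Fin 2) (Fin 2 → F → F) q) :=
  coboundariesFun F q ⊔ (polyCochains F q).map (partialFun F q)

theorem diff_eq_zero_of_mem_coboundariesFun {Φ : FunCochain (F × Fin 2) (Fin 2 → F → F) q}
    (h : Φ ∈ coboundariesFun F q) : (expAction F).diff q Φ = 0 := by
  cases q with
  | zero => rw [(Submodule.mem_bot F).1 h, map_zero]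
  | succ q =>
    obtain ⟨Ψ, -, rfl⟩ := h
    exact BasisAction.diff_diff _ _

theorem diff_ins_zero {Φ : FunCochain (F × Fin 2) (Fin 2 → F → F) (q + 1)}
    (h : (expAction F).diff (q + 1) Φ = 0) :
    (expAction F).diff q (ins F (Fin 2 → F → F) (0, 0) Φ) = partialFun F (q + 1) Φ := by
  have := congrArg (ins F (Fin 2 → F → F) (0, 0)) h
  rw [BasisAction.ins_diff, map_zero, sub_eq_zero] at this
  exact this.symm

/-- Cartan's formula for `(0, L)` writes `∂ Φ` as `d ι_{(0, L)} Φ` when `Φ` is a cocycle. -/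
theorem partialFun_mem_coboundariesFun {Φ : FunCochain (F × Fin 2) (Fin 2 → F → F) q}
    (h : Φ ∈ polyCochains F q) (h0 : (expAction F).diff q Φ = 0) :
    partialFun F q Φ ∈ coboundariesFun F q := by
  cases q with
  | zero =>
    refine (Submodule.mem_bot F).2 ?_
    rw [partialFun, ← BasisAction.ins_diff_zero, h0, map_zero]
  | succ q => exact ⟨_, ins_mem_polyCochains h, diff_ins_zero h0⟩

/-- The connecting map sends a reduced cocycle `z` with `d z = ∂ w` to the class of `w`. Since `d
ι_{(0, L)} w = ∂ w` for every cocycle `w`, it is onto, and insertion of `(0, L)` splits it. Its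
kernel is the image of basic cohomology, which injects because `∂` is zero on cohomology. -/
theorem isRelBasis_reduced [Infinite F] {n m : ℕ}
    {e : Fin n → FunCochain (F × Fin 2) (Fin 2 → F → F) q}
    {e' : Fin m → FunCochain (F × Fin 2) (Fin 2 → F → F) (q + 1)}
    (h : IsRelBasis (cocyclesFun F q) (coboundariesFun F q) e)
    (h' : IsRelBasis (cocyclesFun F (q + 1)) (coboundariesFun F (q + 1)) e') :
    IsRelBasis (redCocyclesFun F q) (redCoboundariesFun F q)
      (Fin.append e fun i => ins F (Fin 2 → F → F) (0, 0) (e' i)) := by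
  have he : ∀ g : Fin n → F, (expAction F).diff q (∑ i, g i • e i) = 0 := by
    intro g
    rw [map_sum]
    exact Finset.sum_eq_zero fun i _ => by rw [map_smul, (h.mem i).2, smul_zero]
  have he' : ∀ g : Fin m → F, (expAction F).diff q
      (∑ i, g i • ins F (Fin 2 → F → F) (0, 0) (e' i)) =
        partialFun F (q + 1) (∑ i, g i • e' i) := by
    intro g
    rw [map_sum, map_sum]
    exact Finset.sum_congr rfl fun i _ => by rw [map_smul, map_smul, diff_ins_zero (h'.mem i).2]
  have hcob : ∀ Φ ∈ polyCochains F q, partialFun F q Φ ∈ redCoboundariesFun F q := fun Φ hΦ =>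
    Submodule.mem_sup_right ⟨Φ, hΦ, rfl⟩
  constructor
  · intro i
    refine Fin.addCases (fun i => ?_) (fun i => ?_) i
    · rw [Fin.append_left]
      refine ⟨(h.mem i).1, 0, Submodule.zero_mem _, ?_⟩
      rw [map_zero, (h.mem i).2]
    · rw [Fin.append_right]
      exact ⟨ins_mem_polyCochains (h'.mem i).1, e' i, (h'.mem i).1,
        (diff_ins_zero (h'.mem i).2).symm⟩
  · intro g hg
    rw [Fin.sum_univ_add] at hg
    simp only [Fin.append_left, Fin.append_right] at hg
    obtain ⟨u, hu, _, ⟨w, hw, rfl⟩, huw⟩ := Submodule.mem_sup.1 hg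
    -- Apply `d` to the relation `∑ = u + ∂ w` and cancel `∂`. This makes the combination of the `e'
    -- i` equal to `d w`, so their coefficients vanish, `w` is a cocycle and `∂ w` is a coboundary.
    have h1 := congrArg ((expAction F).diff q) huw
    rw [map_add, map_add, he, he' fun i => g (Fin.natAdd n i),
      diff_eq_zero_of_mem_coboundariesFun hu, zero_add, zero_add, ← BasisAction.lie_diff] at h1
    have h2 : ∑ i, g (Fin.natAdd n i) • e' i = (expAction F).diff q w := by
      rw [← sub_eq_zero]
      refine eq_zero_of_partialFun_eq_zero (Submodule.sub_mem _ (Submodule.sum_mem _ fun i _ =>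
        Submodule.smul_mem _ _ (h'.mem i).1) (diff_mem_polyCochains hw)) ?_
      rw [map_sub, h1, sub_self]
    have h3 := h'.indep (fun i => g (Fin.natAdd n i)) (by rw [h2]; exact ⟨w, hw, rfl⟩)
    have h4 : (expAction F).diff q w = 0 := by
      rw [← h2]
      exact Finset.sum_eq_zero fun i _ => by rw [congrFun h3 i, Pi.zero_apply, zero_smul]
    have h5 : ∑ i, g (Fin.natAdd n i) • ins F (Fin 2 → F → F) (0, 0) (e' i) = 0 :=
      Finset.sum_eq_zero fun i _ => by rw [congrFun h3 i, Pi.zero_apply, zero_smul]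
    have h6 := h.indep (fun i => g (Fin.castAdd m i)) (by
      rw [h5, add_zero] at huw
      rw [← huw]
      exact Submodule.add_mem _ hu (partialFun_mem_coboundariesFun hw h4))
    funext i
    refine Fin.addCases (fun i => ?_) (fun i => ?_) i
    · exact congrFun h6 i
    · exact congrFun h3 i
  · rintro z ⟨hz, w, hw, hzw⟩
    have hw0 : (expAction F).diff (q + 1) w = 0 := by
      refine eq_zero_of_partialFun_eq_zero (diff_mem_polyCochains hw) ?_
      rw [BasisAction.lie_diff, hzw, BasisAction.diff_diff]
    obtain ⟨g', u, hu, hg'⟩ := h'.span w ⟨hw, hw0⟩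
    have hins : ∑ i, g' i • ins F (Fin 2 → F → F) (0, 0) (e' i) ∈ polyCochains F q :=
      Submodule.sum_mem _ fun i _ => Submodule.smul_mem _ _ (ins_mem_polyCochains (h'.mem i).1)
    -- With `w = ∑ g' i • e' i + d u`, subtracting the insertions and `∂ u` from `z` removes all of
    -- `d z = ∂ w`, leaving a genuine cocycle.
    obtain ⟨g, hg⟩ := h.span
      (z - ∑ i, g' i • ins F (Fin 2 → F → F) (0, 0) (e' i) - partialFun F q u)
      ⟨Submodule.sub_mem _ (Submodule.sub_mem _ hz hins) (partialFun_mem_polyCochains hu), by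
        change (expAction F).diff q _ = 0
        rw [map_sub, map_sub, he', ← hzw, ← BasisAction.lie_diff, hg', map_sub]
        abel⟩
    refine ⟨Fin.append g g', ?_⟩
    rw [Fin.sum_univ_add]
    simp only [Fin.append_left, Fin.append_right]
    have e1 : z - (∑ i, g i • e i + ∑ i, g' i • ins F (Fin 2 → F → F) (0, 0) (e' i)) =
        (z - ∑ i, g' i • ins F (Fin 2 → F → F) (0, 0) (e' i) - partialFun F q u -
          ∑ i, g i • e i) + partialFun F q u := by abel
    rw [e1]
    exact Submodule.add_mem _ (Submodule.mem_sup_left hg) (hcob u hu)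

section Transfer

variable [Infinite F] {f : PolyMap F (WSpace F) (WSpace F) q}

theorem eq_of_ev_eq_diff {g : PolyMap F (WSpace F) (WSpace F) (q + 1)} (hg : IsAntilinear g)
    (hf : f ∈ basicCochains (W (-1 : F)) (WSpace F) q)
    (h : (expAction F).diff q (ev F q f) = ev F (q + 1) g) : d (W (-1)).adjoint q f = g :=
  (isAntilinear_d (mem_basicCochains_iff.1 hf).1).ext_ev hg (by rw [ev_d hf, h])

theorem mem_basicCocycles_iff (hf : f ∈ basicCochains (W (-1 : F)) (WSpace F) q) :
    f ∈ basicCocycles (W (-1 : F)).adjoint q ↔ ev F q f ∈ cocyclesFun F q := by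
  constructor
  · exact fun h => ⟨ev_mem_polyCochains hf, by
      change (expAction F).diff q _ = 0
      rw [← ev_d hf, LinearMap.mem_ker.1 h.2, map_zero]⟩
  · refine fun h => ⟨hf, ?_⟩
    exact eq_of_ev_eq_diff (antilinear F (q + 1)).zero_mem hf (by
      rw [LinearMap.mem_ker.1 h.2, map_zero])

theorem ev_mem_coboundariesFun (h : f ∈ basicCoboundaries (W (-1 : F)).adjoint q) :
    ev F q f ∈ coboundariesFun F q := by
  cases q with
  | zero =>
    rw [(Submodule.mem_bot F).1 h, map_zero]
    exact Submodule.zero_mem _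
  | succ q =>
    obtain ⟨g, hg, rfl⟩ := h
    exact ⟨ev F q g, ev_mem_polyCochains hg, (ev_d hg).symm⟩

theorem exists_mem_basicCoboundaries {Φ : FunCochain (F × Fin 2) (Fin 2 → F → F) q}
    (h : Φ ∈ coboundariesFun F q) :
    ∃ g ∈ basicCoboundaries (W (-1 : F)).adjoint q, IsAntilinear g ∧ ev F q g = Φ := by
  cases q with
  | zero =>
    refine ⟨0, Submodule.zero_mem _, (antilinear F 0).zero_mem, ?_⟩
    rw [(Submodule.mem_bot F).1 h, map_zero]
  | succ q =>
    obtain ⟨Ψ, hΨ, rfl⟩ := h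
    obtain ⟨g, hg, rfl⟩ := exists_ev_eq hΨ
    exact ⟨_, ⟨g, hg, rfl⟩, isAntilinear_d (mem_basicCochains_iff.1 hg).1, ev_d hg⟩

theorem mem_reducedCocycles_iff (hf : f ∈ basicCochains (W (-1 : F)) (WSpace F) q) :
    f ∈ reducedCocycles (W (-1 : F)).adjoint q ↔ ev F q f ∈ redCocyclesFun F q := by
  constructor
  · rintro ⟨-, g, hg, hgf⟩
    refine ⟨ev_mem_polyCochains hf, ev F (q + 1) g, ev_mem_polyCochains hg, ?_⟩
    rw [← ev_d hf, ← hgf, ev_partialOp]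
  · rintro ⟨-, Ψ, hΨ, h⟩
    obtain ⟨g, hg, rfl⟩ := exists_ev_eq hΨ
    refine ⟨hf, g, hg, ?_⟩
    exact (eq_of_ev_eq_diff (isAntilinear_partialOp (mem_basicCochains_iff.1 hg).1) hf (by
      rw [ev_partialOp, ← h])).symm

theorem ev_mem_redCoboundariesFun (h : f ∈ reducedCoboundaries (W (-1 : F)).adjoint q) :
    ev F q f ∈ redCoboundariesFun F q := by
  obtain ⟨u, hu, _, ⟨w, hw, rfl⟩, rfl⟩ := Submodule.mem_sup.1 h
  rw [map_add, ev_partialOp]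
  exact Submodule.add_mem _ (Submodule.mem_sup_left (ev_mem_coboundariesFun hu))
    (Submodule.mem_sup_right ⟨_, ev_mem_polyCochains hw, rfl⟩)

theorem isBasicBasis_of_isRelBasis {n : ℕ} {f : Fin n → PolyMap F (WSpace F) (WSpace F) q}
    (hf : ∀ i, f i ∈ basicCochains (W (-1 : F)) (WSpace F) q)
    (h : IsRelBasis (cocyclesFun F q) (coboundariesFun F q) fun i => ev F q (f i)) :
    IsBasicBasis (W (-1 : F)).adjoint f := by
  have := h.of_map (Z := basicCocycles (W (-1 : F)).adjoint q)
    (B := basicCoboundaries (W (-1 : F)).adjoint q) (ev F q)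
    (fun u hu => (mem_basicCocycles_iff hu.1).1 hu)
    (fun i => (mem_basicCocycles_iff (hf i)).2 (h.mem i))
    (fun u hu => ev_mem_coboundariesFun hu) (fun u hu hu' => by
      obtain ⟨g, hg, hga, hgu⟩ := exists_mem_basicCoboundaries hu'
      rwa [← hga.ext_ev (mem_basicCochains_iff.1 hu.1).1 hgu])
  exact ⟨this.mem, this.exists_basis⟩

theorem isReducedBasis_of_isRelBasis {n : ℕ} {f : Fin n → PolyMap F (WSpace F) (WSpace F) q}
    (hf : ∀ i, f i ∈ basicCochains (W (-1 : F)) (WSpace F) q)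
    (h : IsRelBasis (redCocyclesFun F q) (redCoboundariesFun F q) fun i => ev F q (f i)) :
    IsReducedBasis (W (-1 : F)).adjoint f := by
  have := h.of_map (Z := reducedCocycles (W (-1 : F)).adjoint q)
    (B := reducedCoboundaries (W (-1 : F)).adjoint q) (ev F q)
    (fun u hu => (mem_reducedCocycles_iff hu.1).1 hu)
    (fun i => (mem_reducedCocycles_iff (hf i)).2 (h.mem i))
    (fun u hu => ev_mem_redCoboundariesFun hu) (fun u hu hu' => by
      obtain ⟨Φ, hΦ, _, ⟨Ψ, hΨ, rfl⟩, huv⟩ := Submodule.mem_sup.1 hu'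
      obtain ⟨g, hg, hga, rfl⟩ := exists_mem_basicCoboundaries hΦ
      obtain ⟨g', hg', rfl⟩ := exists_ev_eq hΨ
      have hpa := isAntilinear_partialOp (mem_basicCochains_iff.1 hg').1
      rw [← ((antilinear F q).add_mem hga hpa : IsAntilinear _).ext_ev
        (mem_basicCochains_iff.1 hu.1).1 (by rw [map_add, ev_partialOp, huv])]
      exact Submodule.add_mem _ (Submodule.mem_sup_left hg)
        (Submodule.mem_sup_right ⟨g', hg', rfl⟩))
  exact ⟨this.mem, this.exists_basis⟩

end Transfer

/-! ### Bases of the basic cohomology -/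

section BasicBases

theorem evData_mem_cocyclesFun {c : CochainData F q}
    (hs : evData F q c ∈ skew F (F × Fin 2) (Fin 2 → F → F) q)
    (hd : (expAction F).diff q (evData F q c) = 0) : evData F q c ∈ cocyclesFun F q :=
  ⟨⟨⟨c, rfl⟩, hs⟩, hd⟩

variable [CharZero F]

/-- Since `d` is homogeneous, only the component of `b` one degree below `c` contributes.
Independence of classes is thereby decided inside the finite weight-zero complex. -/
theorem exists_eq_diff_hasWeightZero {c : CochainData F (q + 1)} {b : CochainData F q}
    (hc : HasWeightZero c) (hb : evData F q b ∈ skew F (F × Fin 2) (Fin 2 → F → F) q)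
    (h : evData F (q + 1) c = (expAction F).diff q (evData F q b)) :
    ∃ b₀ : CochainData F q, HasWeightZero b₀ ∧
      evData F q b₀ ∈ skew F (F × Fin 2) (Fin 2 → F → F) q ∧
      evData F (q + 1) c = (expAction F).diff q (evData F q b₀) := by
  by_cases hq : q = 0
  · refine ⟨0, fun s j e he => absurd (MvPolynomial.coeff_zero e) he, ?_, ?_⟩
    · rw [map_zero]; exact Submodule.zero_mem _
    · have h0 : c = 0 := by
        funext s j
        ext e
        by_contra hne
        have := hc s j e hne
        omega
      rw [h0, map_zero, map_zero, map_zero]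
  obtain ⟨m, rfl⟩ := Nat.exists_eq_succ_of_ne_zero hq
  obtain ⟨N, hN⟩ := exists_degree_bound b
  have hN' : ∀ s j, (b s j).totalDegree < N + m := fun s j => by have := hN s j; omega
  set Ψ := (expAction F).diff (m + 1) (evData F (m + 1) b) with hΨ
  -- `u k` is the coefficient of `tᵏ` in `t • d (scale t b) - tᵐ Ψ`, which vanishes for all `t`. The
  -- shift to `k - 1` is the degree that `d` adds, so there is no contribution at `k = 0`.
  let u : ℕ → FunCochain (F × Fin 2) (Fin 2 → F → F) (m + 2) := fun k =>
    (if k = 0 then 0 else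
      (expAction F).diff (m + 1) (evData F (m + 1) (homComponent (k - 1) b))) -
    if k = m then Ψ else 0
  have hscale : ∀ t, scale F (m + 2) t Ψ = t ^ m • Ψ := by
    intro t
    rw [← h]
    exact scale_evData_of_isHomogeneous (hc.isHomogeneous rfl) t
  have key : u m ∈ (⊥ : Submodule F (FunCochain (F × Fin 2) (Fin 2 → F → F) (m + 2))) := by
    refine mem_of_sum_pow_smul_mem ⊥ (N + m + 1) u (fun t _ => ?_) (by omega)
    rw [Submodule.mem_bot]
    simp only [u, smul_sub, Finset.sum_sub_distrib, smul_ite, smul_zero]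
    rw [Finset.sum_ite_eq', if_pos (by simp), ← hscale, hΨ, ← diff_scale, scale_evData hN',
      Finset.sum_range_succ', map_sum, Finset.smul_sum, sub_eq_zero]
    simp only [Nat.add_eq_zero_iff, one_ne_zero, and_false, if_false, if_true, add_zero,
      Nat.add_sub_cancel, map_smul, smul_smul, pow_succ']
  rw [Submodule.mem_bot] at key
  simp only [u, if_true] at key
  -- For `m = 0` the required degree would be `-1`; then `c` itself evaluates to zero and `b₀ = 0`
  -- serves.
  by_cases hm : m = 0
  · refine ⟨0, fun s j e he => absurd (MvPolynomial.coeff_zero e) he, ?_, ?_⟩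
    · rw [map_zero]; exact Submodule.zero_mem _
    · rw [if_pos hm, zero_sub, neg_eq_zero] at key
      rw [map_zero, map_zero, h, key]
  · rw [if_neg hm, sub_eq_zero] at key
    refine ⟨homComponent (m - 1) b, hasWeightZero_of_isHomogeneous
      (fun s j => MvPolynomial.homogeneousComponent_isHomogeneous _ _) (by omega), ?_, ?_⟩
    · exact homComponent_mem _ (fun t _ => scale_mem_skew t hb) _
    · rw [key, h]

theorem exists_weightZero_of_mem_cocyclesFun {Φ : FunCochain (F × Fin 2) (Fin 2 → F → F) (q + 1)}
    (h : Φ ∈ cocyclesFun F (q + 1)) : ∃ c : CochainData F (q + 1), HasWeightZero c ∧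
      evData F (q + 1) c ∈ skew F (F × Fin 2) (Fin 2 → F → F) (q + 1) ∧
      (expAction F).diff (q + 1) (evData F (q + 1) c) = 0 ∧
      Φ - evData F (q + 1) c ∈ coboundariesFun F (q + 1) := by
  obtain ⟨⟨⟨c, rfl⟩, hs⟩, hd⟩ := h
  obtain ⟨c₀, b, h0, hc₀, hb, hcb⟩ := exists_eq_hasWeightZero_add_diff (c := c) ⟨hs, hd⟩
  refine ⟨c₀, h0, hc₀.1, hc₀.2, evData F q b, ⟨⟨b, rfl⟩, hb⟩, ?_⟩
  rw [hcb, add_sub_cancel_left]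

theorem isRelBasis_other (hq : q < 2 ∨ 4 < q)
    (e : Fin 0 → FunCochain (F × Fin 2) (Fin 2 → F → F) q) :
    IsRelBasis (cocyclesFun F q) (coboundariesFun F q) e where
  mem i := i.elim0
  indep g _ := Subsingleton.elim _ _
  span z hz := by
    refine ⟨0, ?_⟩
    rw [Finset.univ_eq_empty, Finset.sum_empty, sub_zero]
    cases q with
    | zero =>
      obtain ⟨⟨⟨c, rfl⟩, hs⟩, hd⟩ := hz
      exact (Submodule.mem_bot F).2 (eq_zero_of_mem_funCocycles_zero ⟨hs, hd⟩)
    | succ q =>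
      obtain ⟨c, hc, hs, -, hB⟩ := exists_weightZero_of_mem_cocyclesFun hz
      rwa [eq_zero_of_other hc hs hq, sub_zero] at hB

/-- There are no weight-zero cochains in degree one, hence no relations. A cocycle has no `u2 0`
term, because `d (u2 0) = 2 v3 1` is nonzero. -/
theorem isRelBasis_two : IsRelBasis (cocyclesFun F 2) (coboundariesFun F 2)
    ![evData F 2 (u2 F 1)] where
  mem i := by
    rw [Subsingleton.elim i 0]
    exact evData_mem_cocyclesFun (u2_mem_skew 1) diff_evData_u2_one
  indep g hg := by
    rw [Fin.sum_univ_one, Matrix.cons_val_zero, ← map_smul] at hg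
    obtain ⟨_, ⟨⟨b, rfl⟩, hb⟩, hgb⟩ := hg
    obtain ⟨b₀, hb₀, hs, hd⟩ := exists_eq_diff_hasWeightZero ((hasWeightZero_u2 1).smul (g 0)) hb
      hgb.symm
    rw [eq_zero_of_other hb₀ hs (Or.inl (by norm_num)), map_zero, map_smul] at hd
    have : g 0 • evData F 2 (u2 F 1) ![(0, 0), (0, 1)] 1 0 = 0 :=
      congrFun (congrFun (congrFun hd ![(0, 0), (0, 1)]) 1) 0
    rw [evData_u2_point] at this
    funext i
    rw [Subsingleton.elim i 0]
    simpa using this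
  span z hz := by
    obtain ⟨c, hc, hs, hd, hB⟩ := exists_weightZero_of_mem_cocyclesFun hz
    obtain ⟨r, hr⟩ := eq_u2_of_hasWeightZero hc hs
    rw [hr, map_add, map_smul, map_smul, diff_evData_u2_one, diff_evData_u2_zero] at hd
    have := congrFun (congrFun (congrFun hd ![(0, 0), (0, 1), (1, 1)]) 1) 0
    simp only [Pi.add_apply, Pi.smul_apply, evData_v3_point'] at this
    have hr0 : r 0 = 0 := by simpa using this
    refine ⟨![r 1], ?_⟩
    rw [hr, hr0, zero_smul, zero_add] at hB
    simpa using hB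

theorem isRelBasis_three : IsRelBasis (cocyclesFun F 3) (coboundariesFun F 3)
    ![evData F 3 (-v3 F 0), evData F 3 (-u3 F 1)] where
  mem i := by
    fin_cases i
    · refine evData_mem_cocyclesFun ?_ ?_
      · rw [map_neg]; exact Submodule.neg_mem _ (v3_mem_skew 0)
      · rw [map_neg, map_neg, diff_evData_v3, neg_zero]
    · refine evData_mem_cocyclesFun ?_ ?_
      · rw [map_neg]; exact Submodule.neg_mem _ (u3_mem_skew 1)
      · rw [map_neg, map_neg, diff_evData_u3_one, neg_zero]
  indep g hg := by
    rw [Fin.sum_univ_two, Matrix.cons_val_zero, Matrix.cons_val_one, map_neg, map_neg] at hg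
    obtain ⟨_, ⟨⟨b, rfl⟩, hb⟩, hgb⟩ := hg
    have hgb' : evData F 3 (-g 0 • v3 F 0 + -g 1 • u3 F 1) =
        (expAction F).diff 2 (evData F 2 b) := by
      rw [hgb, map_add, map_smul, map_smul, neg_smul, neg_smul, smul_neg, Matrix.cons_val_zero,
        smul_neg]
    obtain ⟨b₀, hb₀, hs, hd'⟩ := exists_eq_diff_hasWeightZero
      (((hasWeightZero_v3 0).smul _).add ((hasWeightZero_u3 1).smul _)) hb hgb'
    obtain ⟨r, hr⟩ := eq_u2_of_hasWeightZero hb₀ hs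
    have hd : -g 0 • evData F 3 (v3 F 0) + -g 1 • evData F 3 (u3 F 1) =
        r 0 • (2 : F) • evData F 3 (v3 F 1) := by
      rw [← diff_evData_u2_zero, ← map_smul, ← map_smul, ← map_add]
      refine hd'.trans ?_
      rw [hr, map_add, map_smul, map_smul, diff_evData_u2_one, smul_zero, add_zero]
    have h1 := congrFun (congrFun (congrFun hd ![(0, 0), (1, 0), (0, 1)]) 1) 0
    have h0 := congrFun (congrFun (congrFun hd ![(0, 0), (0, 1), (1, 1)]) 0) 0
    simp only [Pi.add_apply, Pi.smul_apply, evData_u3_point, evData_v3_point] at h1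
    simp only [Pi.add_apply, Pi.smul_apply, evData_u3_point', evData_v3_point'] at h0
    funext i
    fin_cases i
    · simpa using h0
    · simpa using h1
  span z hz := by
    obtain ⟨c, hc, hs, hd, hB⟩ := exists_weightZero_of_mem_cocyclesFun hz
    obtain ⟨r, r', hr⟩ := eq_u3_v3_of_hasWeightZero hc hs
    have hd' : (r 0 * -2) • evData F 4 (u4 F 1) = 0 := by
      rw [mul_smul, ← diff_evData_u3_zero]
      have hd' : (expAction F).diff 3 (evData F 3 c) = 0 := hd
      rw [hr] at hd'
      simpa only [map_add, map_smul, diff_evData_u3_one, diff_evData_v3, smul_zero, add_zero]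
        using hd'
    have : (r 0 * -2) • evData F 4 (u4 F 1) ![(0, 0), (1, 0), (0, 1), (1, 1)] 1 0 = 0 :=
      congrFun (congrFun (congrFun hd' ![(0, 0), (1, 0), (0, 1), (1, 1)]) 1) 0
    rw [evData_u4_point] at this
    have hr0 : r 0 = 0 := by simpa using this
    refine ⟨![-r' 0, -r 1], ?_⟩
    -- Of the three cocycles `u3 1`, `v3 0`, `v3 1`, the last is exact, with primitive `u2 0 / 2`.
    have hv : evData F 3 (v3 F 1) ∈ coboundariesFun F 3 := by
      refine ⟨(2 : F)⁻¹ • evData F 2 (u2 F 0),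
        Submodule.smul_mem _ _ ⟨⟨_, rfl⟩, u2_mem_skew 0⟩, ?_⟩
      rw [map_smul, diff_evData_u2_zero, smul_smul, inv_mul_cancel₀ two_ne_zero, one_smul]
    have := Submodule.add_mem _ hB (Submodule.smul_mem _ (r' 1) hv)
    rw [hr, hr0] at this
    convert this using 1
    rw [Fin.sum_univ_two]
    simp only [Matrix.cons_val_zero, Matrix.cons_val_one, map_neg]
    module

theorem isRelBasis_four : IsRelBasis (cocyclesFun F 4) (coboundariesFun F 4)
    ![evData F 4 (u4 F 0)] where
  mem i := by
    rw [Subsingleton.elim i 0]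
    exact evData_mem_cocyclesFun (u4_mem_skew 0) (diff_evData_u4 0)
  indep g hg := by
    rw [Fin.sum_univ_one, Matrix.cons_val_zero, ← map_smul] at hg
    obtain ⟨_, ⟨⟨b, rfl⟩, hb⟩, hgb⟩ := hg
    obtain ⟨b₀, hb₀, hs, hd⟩ := exists_eq_diff_hasWeightZero ((hasWeightZero_u4 0).smul (g 0)) hb
      hgb.symm
    obtain ⟨r, r', hr⟩ := eq_u3_v3_of_hasWeightZero hb₀ hs
    have hd' : g 0 • evData F 4 (u4 F 0) = (r 0 * -2) • evData F 4 (u4 F 1) := by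
      rw [mul_smul, ← diff_evData_u3_zero, ← map_smul]
      refine hd.trans ?_
      rw [hr]
      simp only [map_add, map_smul, diff_evData_u3_one, diff_evData_v3, smul_zero, add_zero]
    have : g 0 • evData F 4 (u4 F 0) ![(0, 0), (1, 0), (0, 1), (1, 1)] 0 0 =
        (r 0 * -2) • evData F 4 (u4 F 1) ![(0, 0), (1, 0), (0, 1), (1, 1)] 0 0 :=
      congrFun (congrFun (congrFun hd' ![(0, 0), (1, 0), (0, 1), (1, 1)]) 0) 0
    rw [evData_u4_point, evData_u4_point] at this
    funext i
    rw [Subsingleton.elim i 0]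
    simpa using this
  span z hz := by
    obtain ⟨c, hc, hs, hd, hB⟩ := exists_weightZero_of_mem_cocyclesFun hz
    obtain ⟨r, hr⟩ := eq_u4_of_hasWeightZero hc hs
    refine ⟨![r 0], ?_⟩
    -- Everything of weight zero in degree four is closed, and `u4 1` is the differential of `-u3 0
    -- / 2`.
    have hv : evData F 4 (u4 F 1) ∈ coboundariesFun F 4 := by
      refine ⟨(-2 : F)⁻¹ • evData F 3 (u3 F 0),
        Submodule.smul_mem _ _ ⟨⟨_, rfl⟩, u3_mem_skew 0⟩, ?_⟩
      rw [map_smul, diff_evData_u3_zero, smul_smul, inv_mul_cancel₀ (by norm_num), one_smul]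
    have := Submodule.add_mem _ hB (Submodule.smul_mem _ (r 1) hv)
    rw [hr] at this
    convert this using 1
    rw [Fin.sum_univ_one]
    simp only [Matrix.cons_val_zero]
    module

end BasicBases

end W

/-! ### The named representatives -/

namespace W

open FunCochain

variable {F : Type*} [Field F] {q : ℕ}

/-- A nonzero term of the Leibniz expansion matches the generators of `a` with those of `z` by a
permutation, and two monotone tuples that agree up to a permutation are equal. -/
theorem detFun_eq_zero_of_monotone {z : Fin q → Fin 2 × ℕ} (hz : Monotone fun k => (z k).1)
    {a : Fin q → F × Fin 2} (ha : Monotone fun i => (a i).2)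
    (h : (fun i => (a i).2) ≠ fun k => (z k).1) : detFun z a = 0 := by
  rw [detFun, ← Matrix.det_transpose, Matrix.det_apply]
  refine Finset.sum_eq_zero fun σ _ => ?_
  by_cases hσ : ∀ i, (a i).2 = (z (σ i)).1
  · refine absurd (Eq.trans (funext hσ) ?_) h
    refine Tuple.unique_monotone (f := fun k => (z k).1) (σ := σ) (τ := 1) ?_ hz
    rwa [show (fun k => (z k).1) ∘ σ = fun i => (a i).2 from funext fun i => (hσ i).symm]
  · obtain ⟨i, hi⟩ := not_forall.1 hσ
    rw [Finset.prod_eq_zero (Finset.mem_univ i), smul_zero]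
    simp [hi]

theorem evData_insData_zero (c : CochainData F (q + 1)) (a : Fin q → F × Fin 2) :
    evData F q (insData 0 c) a = evData F (q + 1) c (Fin.cons (0, 0) a) := by
  rw [← ins_zero_evData, ins_apply]

theorem partialFun_mem_redCocyclesFun [Infinite F]
    {Φ : FunCochain (F × Fin 2) (Fin 2 → F → F) q} (h : Φ ∈ redCocyclesFun F q) :
    partialFun F q Φ ∈ redCocyclesFun F q :=
  ⟨partialFun_mem_polyCochains h.1, _, diff_mem_polyCochains h.1, BasisAction.lie_diff _ _ _⟩

section IsGivenBy

variable [Infinite F] {s : Fin q → Fin 2} {v : MvPolynomial (Fin q) F ⊗[F] WSpace F} {r : F}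
  {j₀ : Fin 2}

theorem isGivenBy_of_ev {b : F} {f : PolyMap F (WSpace F) (WSpace F) q}
    (hf : f ∈ basicCochains (W b) (WSpace F) q)
    (h : ∀ l j x, ev F q f (fun i => (l i, s i)) j x = evR (MvPolynomial.aeval l) j x v)
    (h' : ∀ s' : Fin q → Fin 2, Monotone s' → s' ≠ s →
      ∀ l : Fin q → F, ev F q f (fun i => (l i, s' i)) = 0) : IsGivenBy b f s v := by
  refine ⟨hf, evR_injective fun l j x => h l j x, fun s' hs' hne => evR_injective fun l j x => ?_⟩
  rw [map_zero]
  exact congrFun (congrFun (h' s' hs' hne l) j) x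

theorem isGivenBy_ofPoly {c : CochainData F q} {z : Fin q → Fin 2 × ℕ}
    (hc : c = r • detData F z j₀) (hz : Monotone fun k => (z k).1) (hs : s = fun k => (z k).1)
    (h : ∀ l j x, r * (if j = j₀ then detFun z (fun i => (l i, s i)) else 0) =
      evR (MvPolynomial.aeval l) j x v) : IsGivenBy (-1) (ofPoly c) s v := by
  have hev : ∀ a j x, ev F q (ofPoly c) a j x = r * (if j = j₀ then detFun z a else 0) := by
    intro a j x
    rw [ev_ofPoly, hc, map_smul, ← evData_detData z j₀ j a x]
    rfl
  refine isGivenBy_of_ev (ofPoly_mem_basicCochains ?_)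
    (fun l j x => by rw [hev, h]) fun s' hs' hne l => ?_
  · rw [hc, map_smul]
    exact Submodule.smul_mem _ _ (detData_mem_skew z j₀)
  · funext j x
    rw [hev, detFun_eq_zero_of_monotone hz hs' (by rwa [← hs])]
    simp

/-- A tuple of the form `(L, …, L, H, …, H)` keeps this form when `L` is put in front, so the
insertion of `(0, L)` inherits the vanishing from the determinant. -/
theorem isGivenBy_ofPoly_insData {c : CochainData F (q + 1)} {z : Fin (q + 1) → Fin 2 × ℕ}
    (hc : c = r • detData F z j₀) (hz : Monotone fun k => (z k).1)
    (hs : Fin.cons 0 s = fun k => (z k).1)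
    (h : ∀ l j x, r * (if j = j₀ then detFun z (Fin.cons (0, 0) fun i => (l i, s i)) else 0) =
      evR (MvPolynomial.aeval l) j x v) : IsGivenBy (-1) (ofPoly (insData 0 c)) s v := by
  have hev : ∀ a j x, ev F q (ofPoly (insData 0 c)) a j x =
      r * (if j = j₀ then detFun z (Fin.cons (0, 0) a) else 0) := by
    intro a j x
    rw [ev_ofPoly, evData_insData_zero, hc, map_smul, ← evData_detData z j₀ j _ x]
    rfl
  have hcons : ∀ (l : Fin q → F) (s' : Fin q → Fin 2),
      (fun i => ((Fin.cons (0, 0) fun i => (l i, s' i) : Fin (q + 1) → F × Fin 2) i).2) =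
        Fin.cons 0 s' := by
    intro l s'
    funext i
    refine Fin.cases ?_ (fun i => ?_) i <;> simp
  refine isGivenBy_of_ev (ofPoly_mem_basicCochains ?_)
    (fun l j x => by rw [hev, h]) fun s' hs' hne l => ?_
  · rw [← ins_zero_evData, hc, map_smul, map_smul]
    exact Submodule.smul_mem _ _ (ins_mem_skew (detData_mem_skew z j₀) _)
  · funext j x
    rw [hev, detFun_eq_zero_of_monotone hz]
    · simp
    · rw [hcons]
      intro i i' hii
      refine Fin.cases (fun _ => ?_) (fun i hii => ?_) i hii
      · exact Fin.zero_le _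
      · refine Fin.cases (fun h0 => absurd h0 (by simp)) (fun i' hii => ?_) i' hii
        simpa using hs' (Fin.succ_le_succ_iff.1 hii)
    · rw [hcons, ← hs]
      exact fun heq => hne (Fin.cons_injective2 heq).2

variable (F)

theorem isGivenBy_f21 : IsGivenBy (-1) (ofPoly (u2 F 1)) ![0, 1] (1 ⊗ₜ H F) := by
  refine isGivenBy_ofPoly (r := 1) (one_smul _ _).symm (by decide) (by decide) fun l j x => ?_
  rw [detFun, Matrix.det_fin_two]
  fin_cases j <;> simp [H]

theorem isGivenBy_f31 : IsGivenBy (-1) (ofPoly (-v3 F 0)) ![0, 1, 1]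
    ((MvPolynomial.X 1 - MvPolynomial.X 2) ⊗ₜ L F) := by
  refine isGivenBy_ofPoly (r := -1) (neg_one_smul _ _).symm (by decide) (by decide) fun l j x => ?_
  rw [detFun, Matrix.det_fin_three]
  fin_cases j <;> simp [L]

theorem isGivenBy_f32 : IsGivenBy (-1) (ofPoly (-u3 F 1)) ![0, 0, 1]
    ((MvPolynomial.X 0 - MvPolynomial.X 1) ⊗ₜ H F) := by
  refine isGivenBy_ofPoly (r := -1) (neg_one_smul _ _).symm (by decide) (by decide) fun l j x => ?_
  rw [detFun, Matrix.det_fin_three]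
  fin_cases j <;> simp [H]

theorem isGivenBy_f41 : IsGivenBy (-1) (ofPoly (u4 F 0)) ![0, 0, 1, 1]
    (((MvPolynomial.X 0 - MvPolynomial.X 1) * (MvPolynomial.X 2 - MvPolynomial.X 3)) ⊗ₜ L F) := by
  refine isGivenBy_ofPoly (r := 1) (one_smul _ _).symm (by decide) (by decide) fun l j x => ?_
  rw [detFun]
  fin_cases j <;>
    simp [L, Matrix.det_succ_row_zero, Fin.sum_univ_succ, Fin.succAbove]
  ring

theorem isGivenBy_f11 : IsGivenBy (-1) (ofPoly (insData 0 (u2 F 1))) ![1] (1 ⊗ₜ H F) := by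
  refine isGivenBy_ofPoly_insData (r := 1) (one_smul _ _).symm (by decide) (by decide)
    fun l j x => ?_
  rw [detFun, Matrix.det_fin_two]
  fin_cases j <;> simp [H]

theorem isGivenBy_f22 : IsGivenBy (-1) (ofPoly (insData 0 (-v3 F 0))) ![1, 1]
    ((MvPolynomial.X 0 - MvPolynomial.X 1) ⊗ₜ L F) := by
  refine isGivenBy_ofPoly_insData (r := -1) (neg_one_smul _ _).symm (by decide) (by decide)
    fun l j x => ?_
  have hl : (Fin.cons (0, 0) fun i => (l i, ![1, 1] i) : Fin 3 → F × Fin 2) =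
      ![(0, 0), (l 0, 1), (l 1, 1)] := by
    funext i; fin_cases i <;> rfl
  rw [hl, detFun, Matrix.det_fin_three]
  fin_cases j <;> simp [L]

theorem isGivenBy_insData_u3 : IsGivenBy (-1) (ofPoly (insData 0 (-u3 F 1))) ![0, 1]
    ((-MvPolynomial.X 0) ⊗ₜ H F) := by
  refine isGivenBy_ofPoly_insData (r := -1) (neg_one_smul _ _).symm (by decide) (by decide)
    fun l j x => ?_
  have hl : (Fin.cons (0, 0) fun i => (l i, ![0, 1] i) : Fin 3 → F × Fin 2) =
      ![(0, 0), (l 0, 0), (l 1, 1)] := by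
    funext i; fin_cases i <;> rfl
  rw [hl, detFun, Matrix.det_fin_three]
  fin_cases j <;> simp [H]

theorem isGivenBy_f33 : IsGivenBy (-1) (ofPoly (insData 0 (u4 F 0))) ![0, 1, 1]
    (((MvPolynomial.X 1 - MvPolynomial.X 2) * -MvPolynomial.X 0) ⊗ₜ L F) := by
  refine isGivenBy_ofPoly_insData (r := 1) (one_smul _ _).symm (by decide) (by decide)
    fun l j x => ?_
  have hl : (Fin.cons (0, 0) fun i => (l i, ![0, 1, 1] i) : Fin 4 → F × Fin 2) =
      ![(0, 0), (l 0, 0), (l 1, 1), (l 2, 1)] := by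
    funext i; fin_cases i <;> rfl
  rw [hl, detFun]
  fin_cases j <;>
    simp [L, Matrix.det_succ_row_zero, Fin.sum_univ_succ, Fin.succAbove]
  ring

theorem partialOp_mem_basicCochains {f : PolyMap F (WSpace F) (WSpace F) q}
    (hf : f ∈ basicCochains (W (-1 : F)) (WSpace F) q) :
    partialOp (W (-1 : F)).adjoint q f ∈ basicCochains (W (-1 : F)) (WSpace F) q := by
  rw [mem_basicCochains_iff] at hf ⊢
  exact ⟨isAntilinear_partialOp hf.1, by
    rw [ev_partialOp]; exact BasisAction.lie_mem_skew _ hf.2 _⟩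

/-- The insertion into `f32` has the value `-λ₁ H`. Adding `∂ f21`, whose value is `(∂ + λ₁ + λ₂)
H`, gives `(∂ + λ₂) H` in the same reduced class. -/
theorem isGivenBy_f23 : IsGivenBy (-1)
    (ofPoly (insData 0 (-u3 F 1)) + partialOp (W (-1 : F)).adjoint 2 (ofPoly (u2 F 1))) ![0, 1]
    (dAdd (W (-1 : F)).D (MvPolynomial.X 1) (1 ⊗ₜ H F)) := by
  obtain ⟨h1, h2, h3⟩ := isGivenBy_f21 F
  obtain ⟨g1, g2, g3⟩ := isGivenBy_insData_u3 F
  have hp : ∀ a, partialOp (W (-1 : F)).adjoint 2 (ofPoly (u2 F 1)) a =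
      dAdd (W (-1 : F)).D (∑ k : Fin 2, MvPolynomial.X k) (ofPoly (u2 F 1) a) := fun a => rfl
  refine ⟨Submodule.add_mem _ g1 (partialOp_mem_basicCochains F h1), ?_, fun s' hs hne => ?_⟩
  · rw [add_apply, g2, hp, h2, Fin.sum_univ_two, dAdd_eq _ (_ + _),
      dAdd_eq _ (MvPolynomial.X 1), add_smul, TensorProduct.neg_tmul]
    simp only [TensorProduct.smul_tmul', smul_eq_mul, mul_one]
    abel
  · rw [add_apply, g3 s' hs hne, hp, h3 s' hs hne, map_zero, add_zero]

end IsGivenBy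

/-! ### Bases of the cohomology spaces by the named cochains -/

section Cohomology

variable (F) [CharZero F]

theorem isBasicBasis_two : IsBasicBasis (W (-1 : F)).adjoint ![ofPoly (u2 F 1)] := by
  refine isBasicBasis_of_isRelBasis (fun i => ?_) ?_
  · fin_cases i
    exact (isGivenBy_f21 F).1
  · convert isRelBasis_two (F := F) using 1
    funext i
    fin_cases i
    exact ev_ofPoly _

theorem isBasicBasis_three :
    IsBasicBasis (W (-1 : F)).adjoint ![ofPoly (-v3 F 0), ofPoly (-u3 F 1)] := by
  refine isBasicBasis_of_isRelBasis (fun i => ?_) ?_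
  · fin_cases i
    · exact (isGivenBy_f31 F).1
    · exact (isGivenBy_f32 F).1
  · convert isRelBasis_three (F := F) using 1
    funext i
    fin_cases i <;> exact ev_ofPoly _

theorem isBasicBasis_four : IsBasicBasis (W (-1 : F)).adjoint ![ofPoly (u4 F 0)] := by
  refine isBasicBasis_of_isRelBasis (fun i => ?_) ?_
  · fin_cases i
    exact (isGivenBy_f41 F).1
  · convert isRelBasis_four (F := F) using 1
    funext i
    fin_cases i
    exact ev_ofPoly _

theorem isReducedBasis_one : IsReducedBasis (W (-1 : F)).adjoint ![ofPoly (insData 0 (u2 F 1))] := by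
  refine isReducedBasis_of_isRelBasis (fun i => ?_) ?_
  · fin_cases i
    exact (isGivenBy_f11 F).1
  · convert isRelBasis_reduced (isRelBasis_other (F := F) (q := 1) (by norm_num) ![])
      isRelBasis_two using 1
    funext i
    fin_cases i
    exact (ev_ofPoly _).trans (ins_zero_evData _).symm

theorem isReducedBasis_two : IsReducedBasis (W (-1 : F)).adjoint ![ofPoly (u2 F 1),
    ofPoly (insData 0 (-v3 F 0)),
    ofPoly (insData 0 (-u3 F 1)) + partialOp (W (-1 : F)).adjoint 2 (ofPoly (u2 F 1))] := by
  have h : IsRelBasis (redCocyclesFun F 2) (redCoboundariesFun F 2) ![ev F 2 (ofPoly (u2 F 1)),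
      ev F 2 (ofPoly (insData 0 (-v3 F 0))), ev F 2 (ofPoly (insData 0 (-u3 F 1)))] := by
    convert isRelBasis_reduced (isRelBasis_two (F := F)) isRelBasis_three using 1
    funext i
    fin_cases i
    · exact ev_ofPoly _
    · exact (ev_ofPoly _).trans (ins_zero_evData _).symm
    · exact (ev_ofPoly _).trans (ins_zero_evData _).symm
  have hp : ev F 2 (partialOp (W (-1 : F)).adjoint 2 (ofPoly (u2 F 1))) ∈
      redCoboundariesFun F 2 := by
    rw [ev_partialOp]
    exact Submodule.mem_sup_right ⟨_, ev_mem_polyCochains (isGivenBy_f21 F).1, rfl⟩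
  have hpZ := partialFun_mem_redCocyclesFun (h.mem 0)
  rw [Matrix.cons_val_zero, partialFun, ← ev_partialOp] at hpZ
  -- The third representative is changed by `∂ f21`, a reduced coboundary, to obtain `f23`.
  refine isReducedBasis_of_isRelBasis (fun i => ?_) (h.congr_mod (fun i => ?_) fun i => ?_)
  · fin_cases i
    · exact (isGivenBy_f21 F).1
    · exact (isGivenBy_f22 F).1
    · exact (isGivenBy_f23 F).1
  · fin_cases i
    · exact h.mem 0
    · exact h.mem 1
    · refine (congrArg (· ∈ redCocyclesFun F 2) (map_add (ev F 2) _ _)).mpr ?_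
      exact Submodule.add_mem _ (h.mem 2) hpZ
  · fin_cases i
    · exact (congrArg (· ∈ redCoboundariesFun F 2) (sub_self _)).mpr (Submodule.zero_mem _)
    · exact (congrArg (· ∈ redCoboundariesFun F 2) (sub_self _)).mpr (Submodule.zero_mem _)
    · refine (congrArg (· ∈ redCoboundariesFun F 2) ?_).mpr hp
      exact (congrArg (· - _) (map_add (ev F 2) _ _)).trans (add_sub_cancel_left _ _)

theorem isReducedBasis_three : IsReducedBasis (W (-1 : F)).adjoint
    ![ofPoly (-v3 F 0), ofPoly (-u3 F 1), ofPoly (insData 0 (u4 F 0))] := by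
  refine isReducedBasis_of_isRelBasis (fun i => ?_) ?_
  · fin_cases i
    · exact (isGivenBy_f31 F).1
    · exact (isGivenBy_f32 F).1
    · exact (isGivenBy_f33 F).1
  · convert isRelBasis_reduced (isRelBasis_three (F := F)) isRelBasis_four using 1
    funext i
    fin_cases i
    · exact ev_ofPoly _
    · exact ev_ofPoly _
    · exact (ev_ofPoly _).trans (ins_zero_evData _).symm

theorem isReducedBasis_four : IsReducedBasis (W (-1 : F)).adjoint ![ofPoly (u4 F 0)] := by
  refine isReducedBasis_of_isRelBasis (fun i => ?_) ?_
  · fin_cases i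
    exact (isGivenBy_f41 F).1
  · convert isRelBasis_reduced (isRelBasis_four (F := F))
      (isRelBasis_other (F := F) (q := 5) (by norm_num) ![]) using 1
    funext i
    fin_cases i
    exact ev_ofPoly _

theorem isBasicBasis_other (hq : q < 2 ∨ 4 < q) :
    IsBasicBasis (W (-1 : F)).adjoint (q := q) ![] :=
  isBasicBasis_of_isRelBasis (fun i => i.elim0) (isRelBasis_other hq _)

/-- Degree one is excluded here, unlike in the basic case, because reduced cohomology in degree `q`
also receives basic cohomology in degree `q + 1`. -/
theorem isReducedBasis_other (hq : q < 1 ∨ 4 < q) :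
    IsReducedBasis (W (-1 : F)).adjoint (q := q) ![] := by
  refine isReducedBasis_of_isRelBasis (fun i => i.elim0) ?_
  convert isRelBasis_reduced (isRelBasis_other (F := F) (q := q) (by omega) ![])
    (isRelBasis_other (F := F) (q := q + 1) (by omega) ![]) using 1

end Cohomology

end W

theorem IsBasicBasis.rank_eq {F A M : Type*} [Field F] [AddCommGroup A] [Module F A]
    [AddCommGroup M] [Module F M] {𝓐 : LieConformalAlgebra F A} {𝓜 : LieConformalModule 𝓐 M}
    {q n : ℕ} {f : Fin n → PolyMap F A M q} (h : IsBasicBasis 𝓜 f) :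
    Module.rank F (BasicCohomology 𝓜 q) = n := by
  obtain ⟨-, e, -⟩ := h
  rw [rank_eq_card_basis e, Fintype.card_fin]

theorem IsReducedBasis.rank_eq {F A M : Type*} [Field F] [AddCommGroup A] [Module F A]
    [AddCommGroup M] [Module F M] {𝓐 : LieConformalAlgebra F A} {𝓜 : LieConformalModule 𝓐 M}
    {q n : ℕ} {f : Fin n → PolyMap F A M q} (h : IsReducedBasis 𝓜 f) :
    Module.rank F (ReducedCohomology 𝓜 q) = n := by
  obtain ⟨-, e, -⟩ := h
  rw [rank_eq_card_basis e, Fintype.card_fin]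

end LieConformal
end

theorem mainTheorem7 (F : Type*) [Field F] [CharZero F] :
    (∀ q : ℕ, Module.rank F (BasicCohomology (W (-1 : F)).adjoint q) =
      if q = 2 ∨ q = 4 then 1 else if q = 3 then 2 else 0) ∧
    (∀ q : ℕ, Module.rank F (ReducedCohomology (W (-1 : F)).adjoint q) =
      if q = 1 ∨ q = 4 then 1 else if q = 2 ∨ q = 3 then 3 else 0) ∧
    ∃ (f11 : PolyMap F (WSpace F) (WSpace F) 1) (f21 f22 f23 : PolyMap F (WSpace F) (WSpace F) 2)
      (f31 f32 f33 : PolyMap F (WSpace F) (WSpace F) 3) (f41 : PolyMap F (WSpace F) (WSpace F) 4),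
      W.IsGivenBy (-1) f11 ![1] (1 ⊗ₜ W.H F) ∧
      W.IsGivenBy (-1) f21 ![0, 1] (1 ⊗ₜ W.H F) ∧
      W.IsGivenBy (-1) f22 ![1, 1] ((MvPolynomial.X 0 - MvPolynomial.X 1) ⊗ₜ W.L F) ∧
      W.IsGivenBy (-1) f23 ![0, 1] (dAdd (W (-1 : F)).D (MvPolynomial.X 1) (1 ⊗ₜ W.H F)) ∧
      W.IsGivenBy (-1) f31 ![0, 1, 1] ((MvPolynomial.X 1 - MvPolynomial.X 2) ⊗ₜ W.L F) ∧
      W.IsGivenBy (-1) f32 ![0, 0, 1] ((MvPolynomial.X 0 - MvPolynomial.X 1) ⊗ₜ W.H F) ∧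
      W.IsGivenBy (-1) f33 ![0, 1, 1]
        (((MvPolynomial.X 1 - MvPolynomial.X 2) * -MvPolynomial.X 0) ⊗ₜ W.L F) ∧
      W.IsGivenBy (-1) f41 ![0, 0, 1, 1]
        (((MvPolynomial.X 0 - MvPolynomial.X 1) * (MvPolynomial.X 2 - MvPolynomial.X 3)) ⊗ₜ
          W.L F) ∧
      IsBasicBasis (W (-1 : F)).adjoint ![f21] ∧
      IsBasicBasis (W (-1 : F)).adjoint ![f31, f32] ∧
      IsBasicBasis (W (-1 : F)).adjoint ![f41] ∧
      IsReducedBasis (W (-1 : F)).adjoint ![f11] ∧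
      IsReducedBasis (W (-1 : F)).adjoint ![f21, f22, f23] ∧
      IsReducedBasis (W (-1 : F)).adjoint ![f31, f32, f33] ∧
      IsReducedBasis (W (-1 : F)).adjoint ![f41] := by
  refine ⟨fun q => ?_, fun q => ?_, _, _, _, _, _, _, _, _, W.isGivenBy_f11 F, W.isGivenBy_f21 F,
    W.isGivenBy_f22 F, W.isGivenBy_f23 F, W.isGivenBy_f31 F, W.isGivenBy_f32 F, W.isGivenBy_f33 F,
    W.isGivenBy_f41 F, W.isBasicBasis_two F, W.isBasicBasis_three F, W.isBasicBasis_four F,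
    W.isReducedBasis_one F, W.isReducedBasis_two F, W.isReducedBasis_three F,
    W.isReducedBasis_four F⟩
  · by_cases h : q < 2 ∨ 4 < q
    · rw [(W.isBasicBasis_other F h).rank_eq, if_neg (by omega), if_neg (by omega), Nat.cast_zero]
    · obtain rfl | rfl | rfl : q = 2 ∨ q = 3 ∨ q = 4 := by omega
      · simpa using (W.isBasicBasis_two F).rank_eq
      · simpa using (W.isBasicBasis_three F).rank_eq
      · simpa using (W.isBasicBasis_four F).rank_eq
  · by_cases h : q < 1 ∨ 4 < q
    · rw [(W.isReducedBasis_other F h).rank_eq, if_neg (by omega), if_neg (by omega),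
        Nat.cast_zero]
    · obtain rfl | rfl | rfl | rfl : q = 1 ∨ q = 2 ∨ q = 3 ∨ q = 4 := by omega
      · simpa using (W.isReducedBasis_one F).rank_eq
      · simpa using (W.isReducedBasis_two F).rank_eq
      · simpa using (W.isReducedBasis_three F).rank_eq
      · simpa using (W.isReducedBasis_four F).rank_eq
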